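/- Let $N \ge 3$, let $\Omega \subset \mathbb{R}^N$ be a bounded domain with boundary of class $C^2$, let $\lambda, \kappa > 0$, and let $2^* = 2N/(N-2)$. For $u \in H^1_0(\Omega)$ set $$J(u) = \int_\Omega \left[\frac{1}{2}\,|\nabla u|^2 + \chi_{\{u > 1\}}(x) - \frac{\lambda}{2}\,(u-1)_+^2 - \frac{\kappa}{2^*}\,(u-1)_+^{2^*}\right] dx,$$ where $t_+ = \max\{t, 0\}$ and $\chi_{\{u>1\}}$ is the characteristic function of $\{u > 1\} \subset \Omega$, and let $$\mathcal{M} = \left\{u \in H^1_0(\Omega) : \int_{\{u > 1\}} \left[|\nabla u|^2 - \lambda\,(u-1)^2\right] dx = \kappa \int_{\{u > 1\}} (u-1)^{2^*}\, dx > 0\right\}.$$ **Theorem 1.1.** Every minimizer $u$ of $J|_{\mathcal{M}}$ that is locally Lipschitz continuous in $\Omega$ is nondegenerate. That is, there are constants $r_0, c > 0$ such that $$u(x_0) \ge 1 + c\, r \quad \text{whenever } x_0 \in \{u > 1\} \text{ and } r := \operatorname{dist}(x_0, \{u \le 1\}) \le r_0,$$ where $\{u > 1\}$ and $\{u \le 1\}$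 are taken as subsets of $\Omega$. -/

import Mathlib

open MeasureTheory Filter Topology
open scoped ContDiff ENNReal

noncomputable section

namespace CriticalFreeBoundary

/-- Real Euclidean space of dimension `N`. -/
abbrev Euc (N : ℕ) : Type := EuclideanSpace ℝ (Fin N)

/-- A bounded domain with boundary of class `C²`: a nonempty, connected, bounded open set which near
each boundary point is the sublevel set `{ρ < 0}` of a `C²` function `ρ` with nonvanishing
differential at that point. -/
structure IsBoundedC2Domain {N : ℕ} (Ω : Set (Euc N)) : Prop where
  isOpen : IsOpen Ω
  isConnected : IsConnected Ω
  isBounded : Bornology.IsBounded Ω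
  boundary : ∀ p ∈ frontier Ω, ∃ (V : Set (Euc N)) (ρ : Euc N → ℝ), IsOpen V ∧ p ∈ V ∧
    ContDiffOn ℝ 2 ρ V ∧ ρ p = 0 ∧ fderiv ℝ ρ p ≠ 0 ∧ ∀ x ∈ V, x ∈ Ω ↔ ρ x < 0

/-- Test functions: the space `C_c^∞(Ω)`. -/
structure IsTestFunction {N : ℕ} (Ω : Set (Euc N)) (φ : Euc N → ℝ) : Prop where
  contDiff : ContDiff ℝ ∞ φ
  hasCompactSupport : HasCompactSupport φ
  tsupport_subset : tsupport φ ⊆ Ω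

/-- `g` is a weak (distributional) gradient of `u` in `Ω`. Only the values in `Ω` matter. -/
structure IsWeakGradient {N : ℕ} (Ω : Set (Euc N)) (u : Euc N → ℝ) (g : Euc N → Euc N) :
    Prop where
  locallyIntegrable : LocallyIntegrableOn u Ω
  locallyIntegrable_grad : LocallyIntegrableOn g Ω
  integral_eq : ∀ φ : Euc N → ℝ, IsTestFunction Ω φ →
    ∫ x in Ω, u x • gradient φ x = -∫ x in Ω, φ x • g x

open Classical in
/-- The weak gradient `∇u` of `u` in `Ω`, a function determined up to a null subset of `Ω`
(see `IsWeakGradient.ae_eq`); it is `0` by convention if `u` is not weakly differentiable. -/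
def weakGradient {N : ℕ} (Ω : Set (Euc N)) (u : Euc N → ℝ) : Euc N → Euc N :=
  if h : ∃ g, IsWeakGradient Ω u g then h.choose else 0

theorem IsWeakGradient.weakGradient {N : ℕ} {Ω : Set (Euc N)} {u : Euc N → ℝ}
    {g : Euc N → Euc N} (h : IsWeakGradient Ω u g) :
    IsWeakGradient Ω u (weakGradient Ω u) := by
  have h' : ∃ g, IsWeakGradient Ω u g := ⟨g, h⟩
  unfold CriticalFreeBoundary.weakGradient
  rw [dif_pos h']
  exact h'.choose_spec

theorem IsWeakGradient.ae_eq {N : ℕ} {Ω : Set (Euc N)} (hΩ : IsOpen Ω) {u : Euc N → ℝ}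
    {g₁ g₂ : Euc N → Euc N} (h₁ : IsWeakGradient Ω u g₁) (h₂ : IsWeakGradient Ω u g₂) :
    ∀ᵐ x, x ∈ Ω → g₁ x = g₂ x := by
  have hint : ∀ {g : Euc N → Euc N}, LocallyIntegrableOn g Ω → ∀ φ : Euc N → ℝ,
      IsTestFunction Ω φ → Integrable (fun x => φ x • g x) := by
    intro g hg φ hφ
    have hK : IsCompact (tsupport φ) := hφ.hasCompactSupport
    have h1 : IntegrableOn g (tsupport φ) :=
      hg.integrableOn_compact_subset hφ.tsupport_subset hK
    have h2 : IntegrableOn (fun x => φ x • g x) (tsupport φ) :=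
      h1.continuousOn_smul hφ.contDiff.continuous.continuousOn hK
    exact (integrableOn_iff_integrable_of_support_subset
      ((Function.support_smul_subset_left φ g).trans (subset_tsupport φ))).1 h2
  have key := hΩ.ae_eq_zero_of_integral_contDiff_smul_eq_zero
    (h₁.locallyIntegrable_grad.sub h₂.locallyIntegrable_grad) (fun φ hc hs ht => by
      have hφ : IsTestFunction Ω φ := ⟨hc, hs, ht⟩
      have e := (h₁.integral_eq φ hφ).symm.trans (h₂.integral_eq φ hφ)
      have hz : ∀ g : Euc N → Euc N, ∫ x in Ω, φ x • g x = ∫ x, φ x • g x := fun g =>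
        setIntegral_eq_integral_of_forall_compl_eq_zero fun x hx => by
          rw [image_eq_zero_of_notMem_tsupport fun h => hx (ht h), zero_smul]
      rw [hz, hz, neg_inj] at e
      simp only [Pi.sub_apply, smul_sub]
      rw [integral_sub (hint h₁.locallyIntegrable_grad φ hφ)
        (hint h₂.locallyIntegrable_grad φ hφ), e, sub_self])
  filter_upwards [key] with x hx hxΩ
  exact sub_eq_zero.mp (hx hxΩ)

/-- The Sobolev space `H¹₀(Ω)`: functions in `L²(Ω)` with weak gradient in `L²(Ω)` that are limits,
in the norm of `H¹(Ω)`, of functions in `C_c^∞(Ω)`. Only the values in `Ω` matter. -/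
def H10 {N : ℕ} (Ω : Set (Euc N)) : Set (Euc N → ℝ) :=
  {u | MemLp u 2 (volume.restrict Ω) ∧
    (∃ g, IsWeakGradient Ω u g) ∧
    MemLp (weakGradient Ω u) 2 (volume.restrict Ω) ∧
    ∃ φ : ℕ → Euc N → ℝ, (∀ n, IsTestFunction Ω (φ n)) ∧
      Tendsto (fun n => eLpNorm (φ n - u) 2 (volume.restrict Ω)) atTop (𝓝 0) ∧
      Tendsto (fun n => eLpNorm (gradient (φ n) - weakGradient Ω u) 2 (volume.restrict Ω))
        atTop (𝓝 0)}

/-- The critical Sobolev exponent `2* = 2N/(N-2)`, for `N ≥ 3`. -/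
def twoStar (N : ℕ) : ℝ := 2 * (N : ℝ) / ((N : ℝ) - 2)

/-- The set `{u > 1}`, as a subset of `Ω`. -/
def superOne {N : ℕ} (Ω : Set (Euc N)) (u : Euc N → ℝ) : Set (Euc N) := {x ∈ Ω | 1 < u x}

/-- The set `{u ≤ 1}`, as a subset of `Ω`. -/
def subOne {N : ℕ} (Ω : Set (Euc N)) (u : Euc N → ℝ) : Set (Euc N) := {x ∈ Ω | u x ≤ 1}

/-- The energy functional
`J(u) = ∫_Ω [|∇u|²/2 + χ_{u > 1} - (lam/2) (u - 1)₊² - (κ/2*) (u - 1)₊^{2*}] dx` on `H¹₀(Ω)`. -/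
def J {N : ℕ} (Ω : Set (Euc N)) (lam κ : ℝ) (u : Euc N → ℝ) : ℝ :=
  ∫ x in Ω, ((1 / 2) * ‖weakGradient Ω u x‖ ^ 2 + (superOne Ω u).indicator (fun _ => (1 : ℝ)) x
    - lam / 2 * (max (u x - 1) 0) ^ 2 - κ / twoStar N * (max (u x - 1) 0) ^ twoStar N)

/-- The Nehari-type manifold: all `u ∈ H¹₀(Ω)` such that
`∫_{u > 1} [|∇u|² - lam (u - 1)²] dx = κ ∫_{u > 1} (u - 1)^{2*} dx > 0`. -/
def nehari {N : ℕ} (Ω : Set (Euc N)) (lam κ : ℝ) : Set (Euc N → ℝ) :=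
  {u | u ∈ H10 Ω ∧
    ∫ x in superOne Ω u, (‖weakGradient Ω u x‖ ^ 2 - lam * (u x - 1) ^ 2)
      = κ * ∫ x in superOne Ω u, (u x - 1) ^ twoStar N ∧
    0 < κ * ∫ x in superOne Ω u, (u x - 1) ^ twoStar N}

/-- Nondegeneracy: `u` grows at least linearly away from `{u ≤ 1}` in `{u > 1}`. -/
def Nondegenerate {N : ℕ} (Ω : Set (Euc N)) (u : Euc N → ℝ) : Prop :=
  ∃ r₀ > 0, ∃ c > 0, ∀ x₀ ∈ superOne Ω u,
    Metric.infDist x₀ (subOne Ω u) ≤ r₀ → 1 + c * Metric.infDist x₀ (subOne Ω u) ≤ u x₀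

end CriticalFreeBoundary

end

/-! Write v = u - 1 and S = {u > 1}. Suppose that v(a) is much smaller than r at the center a of a
small ball of radius 2r inside S. Then v is small, in an integral sense, on a smaller ball. Cutting
u down to 1 there costs less Dirichlet and critical energy than the saving in the volume of S, which
minimality forbids.

To compare energies, a competitor must be moved onto the manifold. If A = ∫ (|∇w|² - lam (w-1)²) and
B = κ ∫ (w-1)^{2*}, both over {w > 1}, are positive, then scaling w - 1 on {w > 1} by a suitable t
reaches the manifold. The energy becomes A (A/B)^{(N-2)/2} / N + |{w > 1}| plus the Dirichlet energy
outside {w > 1} (`energy_le_of_isMinOn`). Small variations of u inside S leave S unchanged, so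
differentiating this expression gives -Δv = lam v + κ v^{2*-1} weakly in S
(`IsContinuousMinimizer.euler_lagrange`).

This equation is used twice. Its right-hand side is nonnegative, so v is superharmonic and its
averages over balls are at most a multiple of v(a) (`setIntegral_closedBall_le`). Tested with a
squared cutoff times v, it gives a Caccioppoli identity. Sobolev's inequality, the uniform smallness
of ∫ v^{2*} on small balls (which absorbs the critical term) and interpolation between L¹ and L^{2*}
then bound the L^{2*} norm by the L¹ norm (`exists_local_bound`). Together they give (∫_{B_{r/2}}
v^{2*})^{2/2*} ≤ C (v(a)/r)² r^N (`exists_critical_le`).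

With a cutoff χ, the competitor u - χ v removes a ball of radius r/4 from S. When v(a)/r is small, A
and B move by at most a multiple of (v(a)/r)² r^N, whereas the volume drops by a fixed multiple of
r^N. So v(a)/r is bounded below (`volume_closedBall_le`, `exists_linear_growth`).

It remains to see that the ball around x₀ of radius dist(x₀, {u ≤ 1}) does not leave Ω. Otherwise
min(u, 1) would equal 1 in Ω near a boundary point, contradicting the zero boundary values of H¹₀(Ω)
(`ball_infDist_subset_superOne`). -/

namespace CriticalFreeBoundary

/-! ### Gradients and test functions. -/

section Gradient

variable {N : ℕ}

lemma hasGradientAt_add {f₁ f₂ : Euc N → ℝ} {g₁ g₂ x : Euc N} (h₁ : HasGradientAt f₁ g₁ x)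
    (h₂ : HasGradientAt f₂ g₂ x) : HasGradientAt (fun y => f₁ y + f₂ y) (g₁ + g₂) x := by
  rw [hasGradientAt_iff_hasFDerivAt] at *
  rw [map_add]
  exact h₁.add h₂

lemma hasGradientAt_mul {f₁ f₂ : Euc N → ℝ} {g₁ g₂ x : Euc N} (h₁ : HasGradientAt f₁ g₁ x)
    (h₂ : HasGradientAt f₂ g₂ x) :
    HasGradientAt (fun y => f₁ y * f₂ y) (f₁ x • g₂ + f₂ x • g₁) x := by
  rw [hasGradientAt_iff_hasFDerivAt] at *
  have : (InnerProductSpace.toDual ℝ (Euc N)) (f₁ x • g₂ + f₂ x • g₁)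
      = f₁ x • (InnerProductSpace.toDual ℝ (Euc N)) g₂
        + f₂ x • (InnerProductSpace.toDual ℝ (Euc N)) g₁ := by
    simp
  rw [this]
  exact h₁.mul h₂

lemma hasGradientAt_comp {T : ℝ → ℝ} {f : Euc N → ℝ} {g x : Euc N} {T' : ℝ}
    (hT : HasDerivAt T T' (f x)) (h : HasGradientAt f g x) :
    HasGradientAt (fun y => T (f y)) (T' • g) x := by
  rw [hasGradientAt_iff_hasFDerivAt] at *
  have : (InnerProductSpace.toDual ℝ (Euc N)) (T' • g)
      = T' • (InnerProductSpace.toDual ℝ (Euc N)) g := by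
    simp
  rw [this]
  exact hT.comp_hasFDerivAt x h

lemma continuous_gradient {f : Euc N → ℝ} (hf : ContDiff ℝ 1 f) : Continuous (gradient f) := by
  unfold gradient
  exact (InnerProductSpace.toDual ℝ (Euc N)).symm.continuous.comp (hf.continuous_fderiv one_ne_zero)

lemma gradient_eq_zero_of_notMem_tsupport {f : Euc N → ℝ} {x : Euc N} (hx : x ∉ tsupport f) :
    gradient f x = 0 := by
  have : fderiv ℝ f x = 0 := by
    by_contra h
    exact hx (support_fderiv_subset ℝ h)
  simp [gradient, this]

lemma norm_gradient (f : Euc N → ℝ) (x : Euc N) : ‖gradient f x‖ = ‖fderiv ℝ f x‖ := by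
  simp [gradient]

end Gradient

namespace IsTestFunction

variable {N : ℕ} {Ω : Set (Euc N)} {φ ψ : Euc N → ℝ}

lemma differentiable (hφ : IsTestFunction Ω φ) : Differentiable ℝ φ :=
  hφ.contDiff.differentiable (by simp)

lemma continuous (hφ : IsTestFunction Ω φ) : Continuous φ := hφ.contDiff.continuous

lemma hasGradientAt (hφ : IsTestFunction Ω φ) (x : Euc N) :
    HasGradientAt φ (gradient φ x) x := (hφ.differentiable x).hasGradientAt

lemma continuous_gradient (hφ : IsTestFunction Ω φ) : Continuous (gradient φ) :=
  CriticalFreeBoundary.continuous_gradient (hφ.contDiff.of_le (by exact_mod_cast le_top))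

lemma hasCompactSupport_gradient (hφ : IsTestFunction Ω φ) : HasCompactSupport (gradient φ) :=
  HasCompactSupport.intro hφ.hasCompactSupport
    fun _ hx => gradient_eq_zero_of_notMem_tsupport hx

lemma memLp (hφ : IsTestFunction Ω φ) (p : ℝ≥0∞) (μ : Measure (Euc N))
    [IsFiniteMeasureOnCompacts μ] : MemLp φ p μ :=
  hφ.continuous.memLp_of_hasCompactSupport hφ.hasCompactSupport

lemma memLp_gradient (hφ : IsTestFunction Ω φ) (p : ℝ≥0∞) (μ : Measure (Euc N))
    [IsFiniteMeasureOnCompacts μ] : MemLp (gradient φ) p μ :=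
  hφ.continuous_gradient.memLp_of_hasCompactSupport hφ.hasCompactSupport_gradient

lemma add (hφ : IsTestFunction Ω φ) (hψ : IsTestFunction Ω ψ) :
    IsTestFunction Ω (fun x => φ x + ψ x) where
  contDiff := hφ.contDiff.add hψ.contDiff
  hasCompactSupport := hφ.hasCompactSupport.add hψ.hasCompactSupport
  tsupport_subset := (tsupport_add φ ψ).trans
    (Set.union_subset hφ.tsupport_subset hψ.tsupport_subset)

lemma mul_smooth (hφ : IsTestFunction Ω φ) (hψ : ContDiff ℝ ∞ ψ) :
    IsTestFunction Ω (fun x => φ x * ψ x) where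
  contDiff := hφ.contDiff.mul hψ
  hasCompactSupport := hφ.hasCompactSupport.mul_right
  tsupport_subset := (tsupport_mul_subset_left).trans hφ.tsupport_subset

lemma comp {T : ℝ → ℝ} (hφ : IsTestFunction Ω φ) (hT : ContDiff ℝ ∞ T) (h0 : T 0 = 0) :
    IsTestFunction Ω (fun x => T (φ x)) where
  contDiff := hT.comp hφ.contDiff
  hasCompactSupport := hφ.hasCompactSupport.comp_left h0
  tsupport_subset := (closure_mono (Function.support_comp_subset h0 φ)).trans hφ.tsupport_subset

lemma mono {Ω' : Set (Euc N)} (hφ : IsTestFunction Ω φ) (h : Ω ⊆ Ω') : IsTestFunction Ω' φ :=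
  ⟨hφ.contDiff, hφ.hasCompactSupport, hφ.tsupport_subset.trans h⟩

/-- Integration by parts of a test function against a smooth function. -/
lemma integral_mul_gradient (hψ : IsTestFunction Ω ψ) (hφ : ContDiff ℝ 1 φ) :
    ∫ x, φ x • gradient ψ x = -∫ x, ψ x • gradient φ x := by
  have hcψ := hψ.hasCompactSupport
  have i1 : Integrable (fun x => φ x • gradient ψ x) :=
    (hφ.continuous.smul hψ.continuous_gradient).integrable_of_hasCompactSupport
      (HasCompactSupport.smul_left hψ.hasCompactSupport_gradient)
  have i2 : Integrable (fun x => ψ x • gradient φ x) :=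
    (hψ.continuous.smul (CriticalFreeBoundary.continuous_gradient hφ)).integrable_of_hasCompactSupport
      (HasCompactSupport.smul_right hψ.hasCompactSupport)
  have i3 : Integrable (fun x => φ x * ψ x) :=
    (hφ.continuous.mul hψ.continuous).integrable_of_hasCompactSupport
      (HasCompactSupport.mul_left hψ.hasCompactSupport)
  refine ext_inner_right ℝ fun y => ?_
  rw [inner_neg_left, real_inner_comm, ← integral_inner i1, real_inner_comm, ← integral_inner i2]
  have key := integral_mul_fderiv_eq_neg_fderiv_mul_of_integrable (μ := volume) (f := φ) (g := ψ)
    (v := y) ?_ ?_ i3 (fun x _ => hφ.differentiable one_ne_zero x)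
    (fun x _ => hψ.differentiable x)
  · simp only [inner_smul_right, inner_gradient_right, conj_trivial]
    rw [key]
    simp only [mul_comm]
  · refine (i2.const_inner y).congr (ae_of_all _ fun x => ?_)
    simp only [inner_smul_right, inner_gradient_right, conj_trivial]
    ring
  · refine (i1.const_inner y).congr (ae_of_all _ fun x => ?_)
    simp only [inner_smul_right, inner_gradient_right, conj_trivial]

end IsTestFunction

/-! ### The space H¹₀(Ω) as pairs (function, gradient): limits, sums, compositions, products. -/

section DominatedConvergence

variable {X E : Type*} [MeasurableSpace X] {μ : Measure X} [NormedAddCommGroup E] [NormedSpace ℝ E]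

/-- Bounded multipliers that tend to `0` almost everywhere send `L²` functions to `0` in `L²`. -/
lemma tendsto_eLpNorm_smul_zero {m : ℕ → X → ℝ} {g : X → E} {C : ℝ}
    (hm : ∀ n, AEStronglyMeasurable (m n) μ) (hC : ∀ n, ∀ᵐ x ∂μ, |m n x| ≤ C)
    (hlim : ∀ᵐ x ∂μ, Tendsto (fun n => m n x) atTop (𝓝 0)) (hg : MemLp g 2 μ) :
    Tendsto (fun n => eLpNorm (fun x => m n x • g x) 2 μ) atTop (𝓝 0) := by
  have hfin : ∫⁻ x, ‖C • g x‖ₑ ^ (2 : ℝ) ∂μ ≠ ⊤ := by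
    have := (hg.const_smul C).eLpNorm_lt_top
    rw [eLpNorm_lt_top_iff_lintegral_rpow_enorm_lt_top (by norm_num) (by norm_num)] at this
    simpa using this.ne
  have key : Tendsto (fun n => ∫⁻ x, ‖m n x • g x‖ₑ ^ (2 : ℝ) ∂μ) atTop (𝓝 (∫⁻ _, 0 ∂μ)) := by
    refine tendsto_lintegral_of_dominated_convergence' _
      (fun n => ((hm n).smul hg.1).enorm.pow_const _) (fun n => ?_) hfin ?_
    · filter_upwards [hC n] with x hx
      refine ENNReal.rpow_le_rpow ?_ (by norm_num)
      rw [enorm_smul, enorm_smul]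
      gcongr
      rw [Real.enorm_eq_ofReal_abs, Real.enorm_eq_ofReal_abs]
      exact ENNReal.ofReal_le_ofReal (hx.trans (le_abs_self C))
    · filter_upwards [hlim] with x hx
      have h1 : Tendsto (fun n => m n x • g x) atTop (𝓝 0) := by
        simpa using hx.smul_const (g x)
      have h2 : Tendsto (fun n => ‖m n x • g x‖ₑ) atTop (𝓝 0) := by
        simpa using h1.enorm
      simpa using h2.ennrpow_const 2
  have := key.ennrpow_const (1 / 2 : ℝ)
  simp only [lintegral_const, zero_mul] at this
  rw [ENNReal.zero_rpow_of_pos (by norm_num)] at this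
  refine this.congr fun n => ?_
  rw [eLpNorm_eq_lintegral_rpow_enorm_toReal (by norm_num) (by norm_num)]
  simp

end DominatedConvergence

/-- `u` belongs to `H¹₀(Ω)`, with gradient `g`. -/
structure IsH10Pair {N : ℕ} (Ω : Set (Euc N)) (u : Euc N → ℝ) (g : Euc N → Euc N) : Prop where
  memLp : MemLp u 2 (volume.restrict Ω)
  memLp_grad : MemLp g 2 (volume.restrict Ω)
  approx : ∀ ε : ℝ≥0∞, ε ≠ 0 → ∃ φ, IsTestFunction Ω φ ∧
    eLpNorm (φ - u) 2 (volume.restrict Ω) ≤ ε ∧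
    eLpNorm (gradient φ - g) 2 (volume.restrict Ω) ≤ ε

namespace IsH10Pair

variable {N : ℕ} {Ω : Set (Euc N)} {u w : Euc N → ℝ} {g h : Euc N → Euc N}

lemma of_mem_H10 (hu : u ∈ H10 Ω) : IsH10Pair Ω u (weakGradient Ω u) := by
  obtain ⟨h1, -, h2, φ, hφ, h3, h4⟩ := hu
  refine ⟨h1, h2, fun ε hε => ?_⟩
  obtain ⟨n, hn⟩ := ((h3.eventually (ge_mem_nhds (pos_iff_ne_zero.2 hε))).and
    (h4.eventually (ge_mem_nhds (pos_iff_ne_zero.2 hε)))).exists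
  exact ⟨φ n, hφ n, hn⟩

/-- The almost everywhere convergence, obtained along a subsequence, is what the chain rule and the
Fatou argument in `exists_sobolev` need in addition to convergence in norm. -/
lemma exists_seq (hu : IsH10Pair Ω u g) : ∃ φ : ℕ → Euc N → ℝ, (∀ n, IsTestFunction Ω (φ n)) ∧
    Tendsto (fun n => eLpNorm (φ n - u) 2 (volume.restrict Ω)) atTop (𝓝 0) ∧
    Tendsto (fun n => eLpNorm (gradient (φ n) - g) 2 (volume.restrict Ω)) atTop (𝓝 0) ∧
    ∀ᵐ x ∂volume.restrict Ω, Tendsto (fun n => φ n x) atTop (𝓝 (u x)) := by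
  have h : ∀ n : ℕ, ∃ φ, IsTestFunction Ω φ ∧
    eLpNorm (φ - u) 2 (volume.restrict Ω) ≤ (n : ℝ≥0∞)⁻¹ ∧
    eLpNorm (gradient φ - g) 2 (volume.restrict Ω) ≤ (n : ℝ≥0∞)⁻¹ :=
    fun n => hu.approx _ (by simp)
  choose φ hφ h1 h2 using h
  have t1 := tendsto_of_tendsto_of_tendsto_of_le_of_le tendsto_const_nhds
    ENNReal.tendsto_inv_nat_nhds_zero (fun n => zero_le) h1
  have t2 := tendsto_of_tendsto_of_tendsto_of_le_of_le tendsto_const_nhds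
    ENNReal.tendsto_inv_nat_nhds_zero (fun n => zero_le) h2
  obtain ⟨ns, hns, hlim⟩ := (tendstoInMeasure_of_tendsto_eLpNorm (by norm_num)
    (fun n => (hφ n).continuous.aestronglyMeasurable) hu.memLp.1 t1).exists_seq_tendsto_ae
  exact ⟨fun n => φ (ns n), fun n => hφ _, t1.comp hns.tendsto_atTop, t2.comp hns.tendsto_atTop,
    hlim⟩

lemma congr (hu : IsH10Pair Ω u g) (h1 : u =ᵐ[volume.restrict Ω] w)
    (h2 : g =ᵐ[volume.restrict Ω] h) : IsH10Pair Ω w h := by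
  refine ⟨(memLp_congr_ae h1).1 hu.memLp, (memLp_congr_ae h2).1 hu.memLp_grad, fun ε hε => ?_⟩
  obtain ⟨φ, hφ, h3, h4⟩ := hu.approx ε hε
  refine ⟨φ, hφ, ?_, ?_⟩
  · rwa [← eLpNorm_congr_ae (EventuallyEq.rfl.sub h1)]
  · rwa [← eLpNorm_congr_ae (EventuallyEq.rfl.sub h2)]

lemma of_test (hu : IsTestFunction Ω u) : IsH10Pair Ω u (gradient u) :=
  ⟨hu.memLp _ _, hu.memLp_gradient _ _, fun ε _ => ⟨u, hu, by simp, by simp⟩⟩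

/-- `H¹₀(Ω)` is closed. -/
lemma of_tendsto {w : ℕ → Euc N → ℝ} {h : ℕ → Euc N → Euc N} (hw : ∀ n, IsH10Pair Ω (w n) (h n))
    (hu : MemLp u 2 (volume.restrict Ω)) (hg : MemLp g 2 (volume.restrict Ω))
    (h1 : Tendsto (fun n => eLpNorm (w n - u) 2 (volume.restrict Ω)) atTop (𝓝 0))
    (h2 : Tendsto (fun n => eLpNorm (h n - g) 2 (volume.restrict Ω)) atTop (𝓝 0)) :
    IsH10Pair Ω u g := by
  refine ⟨hu, hg, fun ε hε => ?_⟩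
  have hε2 : ε / 2 ≠ 0 := by simpa using hε
  obtain ⟨n, hn1, hn2⟩ := ((h1.eventually (ge_mem_nhds (pos_iff_ne_zero.2 hε2))).and
    (h2.eventually (ge_mem_nhds (pos_iff_ne_zero.2 hε2)))).exists
  obtain ⟨φ, hφ, h3, h4⟩ := (hw n).approx _ hε2
  refine ⟨φ, hφ, ?_, ?_⟩
  · have : φ - u = (φ - w n) + (w n - u) := by abel
    rw [this]
    refine (eLpNorm_add_le ((hφ.memLp 2 _).sub (hw n).memLp).1 ((hw n).memLp.sub hu).1
      (by norm_num)).trans ((add_le_add h3 hn1).trans (ENNReal.add_halves ε).le)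
  · have : gradient φ - g = (gradient φ - h n) + (h n - g) := by abel
    rw [this]
    refine (eLpNorm_add_le ((hφ.memLp_gradient 2 _).sub (hw n).memLp_grad).1
      ((hw n).memLp_grad.sub hg).1
      (by norm_num)).trans ((add_le_add h4 hn2).trans (ENNReal.add_halves ε).le)

lemma add (hu : IsH10Pair Ω u g) (hw : IsH10Pair Ω w h) :
    IsH10Pair Ω (fun x => u x + w x) (fun x => g x + h x) := by
  refine ⟨hu.memLp.add hw.memLp, hu.memLp_grad.add hw.memLp_grad, fun ε hε => ?_⟩
  have hε2 : ε / 2 ≠ 0 := by simpa using hε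
  obtain ⟨φ, hφ, h1, h2⟩ := hu.approx _ hε2
  obtain ⟨ψ, hψ, h3, h4⟩ := hw.approx _ hε2
  refine ⟨_, hφ.add hψ, ?_, ?_⟩
  · have : (fun x => φ x + ψ x) - (fun x => u x + w x) = (φ - u) + (ψ - w) := by
      ext x; simp; ring
    rw [this]
    exact (eLpNorm_add_le ((hφ.memLp 2 _).sub hu.memLp).1 ((hψ.memLp 2 _).sub hw.memLp).1
      (by norm_num)).trans ((add_le_add h1 h3).trans (ENNReal.add_halves ε).le)
  · have : gradient (fun x => φ x + ψ x) - (fun x => g x + h x)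
        = (gradient φ - g) + (gradient ψ - h) := by
      funext x
      rw [Pi.sub_apply, (hasGradientAt_add (hφ.hasGradientAt x) (hψ.hasGradientAt x)).gradient]
      simp only [Pi.add_apply, Pi.sub_apply]
      abel
    rw [this]
    exact (eLpNorm_add_le ((hφ.memLp_gradient 2 _).sub hu.memLp_grad).1
      ((hψ.memLp_gradient 2 _).sub hw.memLp_grad).1
      (by norm_num)).trans ((add_le_add h2 h4).trans (ENNReal.add_halves ε).le)

/-- Composition with a smooth function with bounded derivative vanishing at the origin. -/
lemma comp_smooth {T : ℝ → ℝ} {C : ℝ} (hu : IsH10Pair Ω u g) (hT : ContDiff ℝ ∞ T) (h0 : T 0 = 0)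
    (hC : ∀ s, |deriv T s| ≤ C) :
    IsH10Pair Ω (fun x => T (u x)) (fun x => deriv T (u x) • g x) := by
  obtain ⟨φ, hφ, h1, h2, hlim⟩ := hu.exists_seq
  have hTd : Differentiable ℝ T := hT.differentiable (by simp)
  have hT' : Continuous (deriv T) := hT.continuous_deriv (by exact_mod_cast le_top)
  have hC0 : 0 ≤ C := (abs_nonneg _).trans (hC 0)
  have hlip : ∀ a b, ‖T a - T b‖ ≤ C * ‖a - b‖ := fun a b =>
    Convex.norm_image_sub_le_of_norm_deriv_le (fun x _ => hTd x) (fun x _ => hC x) convex_univ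
      (Set.mem_univ b) (Set.mem_univ a)
  have hTu : AEStronglyMeasurable (fun x => T (u x)) (volume.restrict Ω) :=
    hT.continuous.comp_aestronglyMeasurable hu.memLp.1
  have hdTu : AEStronglyMeasurable (fun x => deriv T (u x)) (volume.restrict Ω) :=
    hT'.comp_aestronglyMeasurable hu.memLp.1
  refine of_tendsto (w := fun n x => T (φ n x)) (h := fun n x => deriv T (φ n x) • gradient (φ n) x)
    (fun n => ?_) ?_ ?_ ?_ ?_
  · refine (of_test ((hφ n).comp hT h0)).congr EventuallyEq.rfl (ae_of_all _ fun x => ?_)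
    exact (hasGradientAt_comp (hTd _).hasDerivAt ((hφ n).hasGradientAt x)).gradient
  · refine hu.memLp.of_le_mul (c := C) hTu (ae_of_all _ fun x => ?_)
    simpa [h0] using hlip (u x) 0
  · refine hu.memLp_grad.of_le_mul (c := C) (hdTu.smul hu.memLp_grad.1) (ae_of_all _ fun x => ?_)
    rw [norm_smul]
    exact mul_le_mul_of_nonneg_right (hC _) (norm_nonneg _)
  · have : Tendsto (fun n => ENNReal.ofReal C * eLpNorm (φ n - u) 2 (volume.restrict Ω)) atTop
        (𝓝 0) := by
      simpa using ENNReal.Tendsto.const_mul h1 (Or.inr ENNReal.ofReal_ne_top)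
    refine tendsto_of_tendsto_of_tendsto_of_le_of_le tendsto_const_nhds this
      (fun n => zero_le) fun n => ?_
    exact eLpNorm_le_mul_eLpNorm_of_ae_le_mul (ae_of_all _ fun x => hlip _ _) 2
  · have t1 : Tendsto (fun n => ENNReal.ofReal C *
        eLpNorm (gradient (φ n) - g) 2 (volume.restrict Ω)) atTop (𝓝 0) := by
      simpa using ENNReal.Tendsto.const_mul h2 (Or.inr ENNReal.ofReal_ne_top)
    have hm : ∀ n, AEStronglyMeasurable (fun x => deriv T (φ n x) - deriv T (u x))
        (volume.restrict Ω) := fun n =>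
      (hT'.comp (hφ n).continuous).aestronglyMeasurable.sub hdTu
    -- No rate is available for `deriv T (φ n x) - deriv T (u x)`: it is only bounded and tends to
    -- zero almost everywhere, so dominated convergence against the fixed g is used.
    have t2 : Tendsto (fun n => eLpNorm (fun x => (deriv T (φ n x) - deriv T (u x)) • g x) 2
        (volume.restrict Ω)) atTop (𝓝 0) := by
      refine tendsto_eLpNorm_smul_zero (C := C + C) hm (fun n => ae_of_all _ fun x => ?_) ?_
        hu.memLp_grad
      · exact (abs_sub _ _).trans (add_le_add (hC _) (hC _))
      · filter_upwards [hlim] with x hx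
        simpa using ((hT'.tendsto _).comp hx).sub_const (deriv T (u x))
    have t3 := t1.add t2
    rw [add_zero] at t3
    refine tendsto_of_tendsto_of_tendsto_of_le_of_le tendsto_const_nhds t3
      (fun n => zero_le) fun n => ?_
    have e : (fun x => deriv T (φ n x) • gradient (φ n) x) - (fun x => deriv T (u x) • g x)
        = (fun x => deriv T (φ n x) • (gradient (φ n) x - g x))
          + (fun x => (deriv T (φ n x) - deriv T (u x)) • g x) := by
      funext x
      simp only [Pi.sub_apply, Pi.add_apply, smul_sub, sub_smul]
      abel
    have m1 : AEStronglyMeasurable (fun x => deriv T (φ n x) • (gradient (φ n) x - g x))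
        (volume.restrict Ω) :=
      (hT'.comp (hφ n).continuous).aestronglyMeasurable.smul
        ((hφ n).continuous_gradient.aestronglyMeasurable.sub hu.memLp_grad.1)
    simp only [e]
    refine (eLpNorm_add_le m1 ((hm n).smul hu.memLp_grad.1) (by norm_num)).trans
      (add_le_add ?_ le_rfl)
    refine eLpNorm_le_mul_eLpNorm_of_ae_le_mul (ae_of_all _ fun x => ?_) 2
    rw [norm_smul]
    exact mul_le_mul_of_nonneg_right (hC _) (norm_nonneg _)

lemma const_mul (hu : IsH10Pair Ω u g) (c : ℝ) :
    IsH10Pair Ω (fun x => c * u x) (fun x => c • g x) := by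
  have hd : ∀ s, deriv (fun s : ℝ => c * s) s = c := fun s => by simp
  refine (hu.comp_smooth (T := fun s => c * s) (C := |c|) (contDiff_const.mul contDiff_id)
    (by simp) (fun s => by rw [hd])).congr EventuallyEq.rfl (ae_of_all _ fun x => ?_)
  simp only [hd]

/-- Product of `u - 1` with a test function. -/
lemma mul_test {ψ : Euc N → ℝ} (hu : IsH10Pair Ω u g) (hψ : IsTestFunction Ω ψ) :
    IsH10Pair Ω (fun x => ψ x * (u x - 1)) (fun x => ψ x • g x + (u x - 1) • gradient ψ x) := by
  obtain ⟨φ, hφ, h1, h2, -⟩ := hu.exists_seq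
  obtain ⟨C, hC⟩ := hψ.hasCompactSupport.exists_bound_of_continuous hψ.continuous
  obtain ⟨D, hD⟩ := hψ.hasCompactSupport_gradient.exists_bound_of_continuous hψ.continuous_gradient
  have hgr : ∀ n x, gradient (fun x => ψ x * (φ n x - 1)) x
      = ψ x • gradient (φ n) x + (φ n x - 1) • gradient ψ x := fun n x => by
    have hc : HasGradientAt (fun _ : Euc N => (-1 : ℝ)) 0 x := hasGradientAt_const x _
    have := hasGradientAt_mul (hψ.hasGradientAt x)
      (hasGradientAt_add ((hφ n).hasGradientAt x) hc)
    simpa [← sub_eq_add_neg] using this.gradient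
  have hψu : MemLp (fun x => ψ x * u x) 2 (volume.restrict Ω) :=
    hu.memLp.of_le_mul (c := C) (hψ.continuous.aestronglyMeasurable.mul hu.memLp.1)
      (ae_of_all _ fun x => by
        rw [norm_mul]; exact mul_le_mul_of_nonneg_right (hC x) (norm_nonneg _))
  have hψg : MemLp (fun x => ψ x • g x) 2 (volume.restrict Ω) :=
    hu.memLp_grad.of_le_mul (c := C) (hψ.continuous.aestronglyMeasurable.smul hu.memLp_grad.1)
      (ae_of_all _ fun x => by
        rw [norm_smul]; exact mul_le_mul_of_nonneg_right (hC x) (norm_nonneg _))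
  have huψ : MemLp (fun x => u x • gradient ψ x) 2 (volume.restrict Ω) :=
    hu.memLp.of_le_mul (c := D) (hu.memLp.1.smul hψ.continuous_gradient.aestronglyMeasurable)
      (ae_of_all _ fun x => by
        rw [norm_smul, mul_comm]; exact mul_le_mul_of_nonneg_right (hD x) (norm_nonneg _))
  refine of_tendsto (w := fun n x => ψ x * (φ n x - 1))
    (h := fun n x => ψ x • gradient (φ n) x + (φ n x - 1) • gradient ψ x)
    (fun n => ?_) ?_ ?_ ?_ ?_
  -- `φ n - 1` has no compact support, but its product with ψ has.
  · exact (of_test (hψ.mul_smooth ((hφ n).contDiff.sub contDiff_const))).congr EventuallyEq.rfl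
      (ae_of_all _ fun x => hgr n x)
  · refine (hψu.sub (hψ.memLp 2 _)).ae_eq (ae_of_all _ fun x => ?_)
    simp; ring
  · refine (hψg.add (huψ.sub (hψ.memLp_gradient 2 _))).ae_eq (ae_of_all _ fun x => ?_)
    simp [sub_smul]
  · have : Tendsto (fun n => ENNReal.ofReal C * eLpNorm (φ n - u) 2 (volume.restrict Ω)) atTop
        (𝓝 0) := by
      simpa using ENNReal.Tendsto.const_mul h1 (Or.inr ENNReal.ofReal_ne_top)
    refine tendsto_of_tendsto_of_tendsto_of_le_of_le tendsto_const_nhds this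
      (fun n => zero_le) fun n => ?_
    refine eLpNorm_le_mul_eLpNorm_of_ae_le_mul (ae_of_all _ fun x => ?_) 2
    have : (fun x => ψ x * (φ n x - 1)) x - ψ x * (u x - 1) = ψ x * (φ n x - u x) := by
      simp only; ring
    rw [Pi.sub_apply, this, norm_mul]
    exact mul_le_mul_of_nonneg_right (hC x) (norm_nonneg _)
  · have t1 : Tendsto (fun n => ENNReal.ofReal C *
        eLpNorm (gradient (φ n) - g) 2 (volume.restrict Ω)) atTop (𝓝 0) := by
      simpa using ENNReal.Tendsto.const_mul h2 (Or.inr ENNReal.ofReal_ne_top)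
    have t2 : Tendsto (fun n => ENNReal.ofReal D * eLpNorm (φ n - u) 2 (volume.restrict Ω)) atTop
        (𝓝 0) := by
      simpa using ENNReal.Tendsto.const_mul h1 (Or.inr ENNReal.ofReal_ne_top)
    have t3 := t1.add t2
    rw [add_zero] at t3
    refine tendsto_of_tendsto_of_tendsto_of_le_of_le tendsto_const_nhds t3
      (fun n => zero_le) fun n => ?_
    have e : (fun x => ψ x • gradient (φ n) x + (φ n x - 1) • gradient ψ x)
          - (fun x => ψ x • g x + (u x - 1) • gradient ψ x)
        = (fun x => ψ x • (gradient (φ n) x - g x))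
          + (fun x => (φ n x - u x) • gradient ψ x) := by
      funext x
      simp only [Pi.sub_apply, Pi.add_apply, smul_sub, sub_smul]
      abel
    simp only [e]
    refine (eLpNorm_add_le (hψ.continuous.aestronglyMeasurable.smul
      ((hφ n).continuous_gradient.aestronglyMeasurable.sub hu.memLp_grad.1))
      (((hφ n).continuous.aestronglyMeasurable.sub hu.memLp.1).smul
        hψ.continuous_gradient.aestronglyMeasurable) (by norm_num)).trans (add_le_add ?_ ?_)
    · refine eLpNorm_le_mul_eLpNorm_of_ae_le_mul (ae_of_all _ fun x => ?_) 2
      rw [Pi.smul_apply', norm_smul]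
      exact mul_le_mul_of_nonneg_right (hC _) (norm_nonneg _)
    · refine eLpNorm_le_mul_eLpNorm_of_ae_le_mul (ae_of_all _ fun x => ?_) 2
      rw [Pi.smul_apply', norm_smul, mul_comm]
      exact mul_le_mul_of_nonneg_right (hD _) (norm_nonneg _)

end IsH10Pair

/-! ### A smooth ramp, and the positive part (u - 1)₊. -/

section SoftRamp

/-- A smooth convex function vanishing on `(-∞, 0]` whose derivative is `Real.smoothTransition`. -/
noncomputable def softRamp (s : ℝ) : ℝ := ∫ τ in (0 : ℝ)..s, Real.smoothTransition τ

lemma hasDerivAt_softRamp (s : ℝ) : HasDerivAt softRamp (Real.smoothTransition s) s :=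
  intervalIntegral.integral_hasDerivAt_right
    (Real.smoothTransition.continuous.intervalIntegrable _ _)
    (Real.smoothTransition.continuous.stronglyMeasurableAtFilter _ _)
    Real.smoothTransition.continuous.continuousAt

lemma deriv_softRamp : deriv softRamp = Real.smoothTransition :=
  funext fun s => (hasDerivAt_softRamp s).deriv

lemma contDiff_softRamp : ContDiff ℝ ∞ softRamp := by
  rw [contDiff_infty_iff_deriv, deriv_softRamp]
  exact ⟨fun s => (hasDerivAt_softRamp s).differentiableAt, Real.smoothTransition.contDiff⟩

lemma softRamp_of_nonpos {s : ℝ} (hs : s ≤ 0) : softRamp s = 0 := by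
  unfold softRamp
  rw [intervalIntegral.integral_symm, neg_eq_zero]
  refine intervalIntegral.integral_zero_ae (ae_of_all _ fun x hx => ?_)
  rw [Set.uIoc_of_le hs] at hx
  exact Real.smoothTransition.zero_of_nonpos hx.2

lemma softRamp_nonneg (s : ℝ) : 0 ≤ softRamp s := by
  rcases le_total s 0 with hs | hs
  · exact (softRamp_of_nonpos hs).ge
  · exact intervalIntegral.integral_nonneg hs fun _ _ => Real.smoothTransition.nonneg _

lemma softRamp_le {s : ℝ} (hs : 0 ≤ s) : softRamp s ≤ s := by
  have := intervalIntegral.integral_mono_on hs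
    (Real.smoothTransition.continuous.intervalIntegrable _ _)
    (continuous_const.intervalIntegrable (μ := volume) _ _)
    (fun x _ => Real.smoothTransition.le_one x)
  simpa [softRamp] using this

lemma sub_one_le_softRamp (s : ℝ) : s - 1 ≤ softRamp s := by
  rcases le_total s 1 with hs | hs
  · exact (sub_nonpos.2 hs).trans (softRamp_nonneg s)
  · have h1 : softRamp 1 + ∫ τ in (1 : ℝ)..s, Real.smoothTransition τ = softRamp s :=
      intervalIntegral.integral_add_adjacent_intervals
        (Real.smoothTransition.continuous.intervalIntegrable _ _)
        (Real.smoothTransition.continuous.intervalIntegrable _ _)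
    have h2 : ∫ τ in (1 : ℝ)..s, Real.smoothTransition τ = ∫ τ in (1 : ℝ)..s, (1 : ℝ) := by
      refine intervalIntegral.integral_congr fun x hx => ?_
      rw [Set.uIcc_of_le hs] at hx
      exact Real.smoothTransition.one_of_one_le hx.1
    rw [h2, intervalIntegral.integral_const, smul_eq_mul, mul_one] at h1
    linarith [softRamp_nonneg 1]

/-- After rescaling by n + 1 this fixed error becomes 1 / (n + 1), which gives uniform convergence
to the positive part. -/
lemma abs_softRamp_sub_max (s : ℝ) : |softRamp s - max s 0| ≤ 1 := by
  rcases le_total s 0 with hs | hs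
  · simp [softRamp_of_nonpos hs, hs]
  · rw [max_eq_left hs, abs_le]
    constructor <;> linarith [softRamp_le hs, sub_one_le_softRamp s]

end SoftRamp

namespace IsH10Pair

variable {N : ℕ} {Ω : Set (Euc N)} {u : Euc N → ℝ} {g : Euc N → Euc N}

/-- The chain rule for `(u - 1)₊`. -/
lemma posPart (hu : IsH10Pair Ω u g) (hΩ : volume Ω ≠ ⊤) :
    IsH10Pair Ω (fun x => max (u x - 1) 0) ({x | 1 < u x}.indicator g) := by
  have : IsFiniteMeasure (volume.restrict Ω) := ⟨by simpa using hΩ.lt_top⟩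
  -- The derivatives of `T n` lie in [0, 1] and converge at every s to the indicator of {s > 1}. The
  -- value s = 1 is included because the transition function vanishes at 0, so nothing has to be
  -- known about the gradient on {u = 1}.
  set T : ℕ → ℝ → ℝ := fun n s => softRamp ((n + 1) * (s - 1)) / (n + 1) with hTdef
  have hn : ∀ n : ℕ, (0 : ℝ) < n + 1 := fun n => by positivity
  have hT : ∀ n s, HasDerivAt (T n) (Real.smoothTransition ((n + 1) * (s - 1))) s := fun n s => by
    have h1 : HasDerivAt (fun s : ℝ => ((n : ℝ) + 1) * (s - 1)) (n + 1) s := by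
      simpa using ((hasDerivAt_id s).sub_const 1).const_mul ((n : ℝ) + 1)
    have := ((hasDerivAt_softRamp _).comp s h1).div_const ((n : ℝ) + 1)
    rwa [mul_div_cancel_right₀ _ (hn n).ne'] at this
  have hTd : ∀ n, deriv (T n) = fun s => Real.smoothTransition ((n + 1) * (s - 1)) := fun n =>
    funext fun s => (hT n s).deriv
  have hTbound : ∀ n s, |T n s - max (s - 1) 0| ≤ 1 / ((n : ℝ) + 1) := fun n s => by
    have e : T n s - max (s - 1) 0
        = (softRamp ((n + 1) * (s - 1)) - max ((n + 1) * (s - 1)) 0) / (n + 1) := by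
      have : max (((n : ℝ) + 1) * (s - 1)) 0 = (n + 1) * max (s - 1) 0 := by
        rw [mul_max_of_nonneg _ _ (hn n).le, mul_zero]
      rw [this, hTdef]
      field_simp
    rw [e, abs_div, abs_of_pos (hn n)]
    exact div_le_div_of_nonneg_right (abs_softRamp_sub_max _) (hn n).le
  have hind : {x | 1 < u x}.indicator g = fun x => ({s : ℝ | 1 < s}.indicator 1 (u x) : ℝ) • g x := by
    funext x
    by_cases hx : 1 < u x <;> simp [Set.indicator, hx]
  have hmeas1 : AEStronglyMeasurable (fun x => ({s : ℝ | 1 < s}.indicator 1 (u x) : ℝ))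
      (volume.restrict Ω) :=
    ((measurable_one.indicator measurableSet_Ioi).comp_aemeasurable
      hu.memLp.1.aemeasurable).aestronglyMeasurable
  have hbd1 : ∀ s : ℝ, |({s : ℝ | 1 < s}.indicator 1 s : ℝ)| ≤ 1 := fun s => by
    by_cases hs : 1 < s <;> simp [Set.indicator, hs]
  have hsm : ∀ s, |Real.smoothTransition s| ≤ 1 := fun s => by
    rw [abs_of_nonneg (Real.smoothTransition.nonneg s)]
    exact Real.smoothTransition.le_one s
  refine of_tendsto (w := fun n x => T n (u x)) (h := fun n x => deriv (T n) (u x) • g x)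
    (fun n => ?_) ?_ ?_ ?_ ?_
  · refine hu.comp_smooth (C := 1) ?_ ?_ ?_
    · exact (contDiff_softRamp.comp
        (contDiff_const.mul (contDiff_id.sub contDiff_const))).div_const _
    · simp only [hTdef]
      rw [softRamp_of_nonpos (by nlinarith [hn n]), zero_div]
    · intro s
      rw [hTd]
      exact hsm _
  · refine hu.memLp.of_le_mul (c := 1)
      ((hu.memLp.1.sub aestronglyMeasurable_const).sup aestronglyMeasurable_const)
      (ae_of_all _ fun x => ?_)
    rw [one_mul, Real.norm_eq_abs, Real.norm_eq_abs, abs_of_nonneg (le_max_right _ _)]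
    exact max_le (by linarith [le_abs_self (u x)]) (abs_nonneg _)
  · rw [hind]
    refine hu.memLp_grad.of_le_mul (c := 1) (hmeas1.smul hu.memLp_grad.1) (ae_of_all _ fun x => ?_)
    rw [norm_smul]
    exact mul_le_mul_of_nonneg_right (hbd1 _) (norm_nonneg _)
  · have t : Tendsto (fun n : ℕ => volume.restrict Ω Set.univ ^ (2 : ℝ≥0∞).toReal⁻¹ *
        ENNReal.ofReal (1 / ((n : ℝ) + 1))) atTop (𝓝 0) := by
      have h0 := ENNReal.tendsto_ofReal tendsto_one_div_add_atTop_nhds_zero_nat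
      rw [ENNReal.ofReal_zero] at h0
      have := ENNReal.Tendsto.const_mul (a := volume.restrict Ω Set.univ ^ (2 : ℝ≥0∞).toReal⁻¹)
        h0 (Or.inr (ENNReal.rpow_ne_top_of_nonneg (by positivity) (measure_ne_top _ _)))
      simpa using this
    refine tendsto_of_tendsto_of_tendsto_of_le_of_le tendsto_const_nhds t
      (fun n => zero_le) fun n => ?_
    exact eLpNorm_le_of_ae_bound (ae_of_all _ fun x => hTbound n (u x))
  · have e : ∀ n, (fun x => deriv (T n) (u x) • g x) - {x | 1 < u x}.indicator g
        = fun x => (Real.smoothTransition ((n + 1) * (u x - 1))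
          - {s : ℝ | 1 < s}.indicator 1 (u x)) • g x := fun n => by
      rw [hind]
      funext x
      rw [Pi.sub_apply, hTd, sub_smul]
    simp only [e]
    refine tendsto_eLpNorm_smul_zero (C := 1 + 1) (fun n => ?_) (fun n => ae_of_all _ fun x => ?_)
      (ae_of_all _ fun x => ?_) hu.memLp_grad
    · refine AEStronglyMeasurable.sub ?_ hmeas1
      exact (Real.smoothTransition.continuous.comp
        (continuous_const.mul (continuous_id.sub continuous_const))).comp_aestronglyMeasurable
        hu.memLp.1
    · exact (abs_sub _ _).trans (add_le_add (hsm _) (hbd1 _))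
    · refine tendsto_const_nhds.congr' ?_
      by_cases hx : 1 < u x
      · obtain ⟨k, hk⟩ := exists_nat_ge (1 / (u x - 1))
        filter_upwards [eventually_ge_atTop k] with n hnk
        have hpos : 0 < u x - 1 := by linarith
        have : (1 : ℝ) ≤ (n + 1) * (u x - 1) := by
          rw [div_le_iff₀ hpos] at hk
          have : (k : ℝ) ≤ n + 1 := by exact_mod_cast hnk.trans n.le_succ
          nlinarith
        simp [Set.indicator, hx, Real.smoothTransition.one_of_one_le this]
      · filter_upwards with n
        have : (n + 1) * (u x - 1) ≤ 0 := by
          have := hn n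
          nlinarith
        simp [Set.indicator, hx, Real.smoothTransition.zero_of_nonpos this]

end IsH10Pair

/-! ### Integration by parts in H¹₀(Ω) and agreement with the weak gradient. -/

section Limits

variable {X E : Type*} [MeasurableSpace X] {μ : Measure X} [NormedAddCommGroup E] [NormedSpace ℝ E]

lemma tendsto_integral_smul_left {f : ℕ → X → ℝ} {f₀ : X → ℝ} {h : X → E}
    (hf : ∀ n, MemLp (f n) 2 μ) (hf₀ : MemLp f₀ 2 μ) (hh : MemLp h 2 μ)
    (hlim : Tendsto (fun n => eLpNorm (f n - f₀) 2 μ) atTop (𝓝 0)) :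
    Tendsto (fun n => ∫ x, f n x • h x ∂μ) atTop (𝓝 (∫ x, f₀ x • h x ∂μ)) := by
  refine tendsto_integral_of_L1' (fun x => f₀ x • h x) (hf₀.1.smul hh.1)
    (Eventually.of_forall fun n => (memLp_one_iff_integrable.1 (hh.smul (hf n) (r := 1)))) ?_
  have t : Tendsto (fun n => eLpNorm (f n - f₀) 2 μ * eLpNorm h 2 μ) atTop (𝓝 0) := by
    simpa using ENNReal.Tendsto.mul_const hlim (Or.inr hh.eLpNorm_ne_top)
  refine tendsto_of_tendsto_of_tendsto_of_le_of_le tendsto_const_nhds t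
    (fun n => zero_le) fun n => ?_
  have e : (fun x => f n x • h x) - (fun x => f₀ x • h x) = (f n - f₀) • h := by
    funext x; simp [sub_smul]
  simp only [e]
  exact eLpNorm_smul_le_mul_eLpNorm hh.1 ((hf n).sub hf₀).1

lemma tendsto_integral_smul_right {f : X → ℝ} {h : ℕ → X → E} {h₀ : X → E}
    (hf : MemLp f 2 μ) (hh : ∀ n, MemLp (h n) 2 μ) (hh₀ : MemLp h₀ 2 μ)
    (hlim : Tendsto (fun n => eLpNorm (h n - h₀) 2 μ) atTop (𝓝 0)) :
    Tendsto (fun n => ∫ x, f x • h n x ∂μ) atTop (𝓝 (∫ x, f x • h₀ x ∂μ)) := by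
  refine tendsto_integral_of_L1' (fun x => f x • h₀ x) (hf.1.smul hh₀.1)
    (Eventually.of_forall fun n => memLp_one_iff_integrable.1 ((hh n).smul hf (r := 1))) ?_
  have t : Tendsto (fun n => eLpNorm f 2 μ * eLpNorm (h n - h₀) 2 μ) atTop (𝓝 0) := by
    simpa using ENNReal.Tendsto.const_mul hlim (Or.inr hf.eLpNorm_ne_top)
  refine tendsto_of_tendsto_of_tendsto_of_le_of_le tendsto_const_nhds t
    (fun n => zero_le) fun n => ?_
  have e : (fun x => f x • h n x) - (fun x => f x • h₀ x) = f • (h n - h₀) := by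
    funext x; simp [smul_sub]
  simp only [e]
  exact eLpNorm_smul_le_mul_eLpNorm ((hh n).sub hh₀).1 hf.1

end Limits

namespace IsH10Pair

variable {N : ℕ} {Ω : Set (Euc N)} {u : Euc N → ℝ} {g : Euc N → Euc N}

/-- ψ need not vanish near the boundary of Ω: the approximating functions do, so no boundary term
arises. This is the form in which the zero boundary values of u are used in `false_of_eq_one`. -/
lemma integral_smul_gradient (hu : IsH10Pair Ω u g) {ψ : Euc N → ℝ}
    (hψ : IsTestFunction Set.univ ψ) :
    ∫ x in Ω, u x • gradient ψ x = -∫ x in Ω, ψ x • g x := by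
  obtain ⟨φ, hφ, h1, h2, -⟩ := hu.exists_seq
  have t1 := tendsto_integral_smul_left (fun n => (hφ n).memLp 2 _) hu.memLp
    (hψ.memLp_gradient 2 (volume.restrict Ω)) h1
  have t2 := (tendsto_integral_smul_right (hψ.memLp 2 (volume.restrict Ω))
    (fun n => (hφ n).memLp_gradient 2 _) hu.memLp_grad h2).neg
  refine tendsto_nhds_unique t1 (t2.congr fun n => ?_)
  rw [setIntegral_eq_integral_of_forall_compl_eq_zero,
    setIntegral_eq_integral_of_forall_compl_eq_zero,
    hψ.integral_mul_gradient ((hφ n).contDiff.of_le (by exact_mod_cast le_top))]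
  · intro x hx
    rw [image_eq_zero_of_notMem_tsupport fun h => hx ((hφ n).tsupport_subset h), zero_smul]
  · intro x hx
    rw [gradient_eq_zero_of_notMem_tsupport fun h => hx ((hφ n).tsupport_subset h), smul_zero]

lemma isWeakGradient (hu : IsH10Pair Ω u g) : IsWeakGradient Ω u g where
  locallyIntegrable := locallyIntegrableOn_of_locallyIntegrable_restrict
    (hu.memLp.locallyIntegrable (by norm_num))
  locallyIntegrable_grad := locallyIntegrableOn_of_locallyIntegrable_restrict
    (hu.memLp_grad.locallyIntegrable (by norm_num))
  integral_eq _ hψ := hu.integral_smul_gradient (hψ.mono (Set.subset_univ _))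

lemma weakGradient_ae_eq (hu : IsH10Pair Ω u g) (hΩ : IsOpen Ω) :
    weakGradient Ω u =ᵐ[volume.restrict Ω] g :=
  (ae_restrict_iff' hΩ.measurableSet).2 (hu.isWeakGradient.weakGradient.ae_eq hΩ hu.isWeakGradient)

lemma mem_H10 (hu : IsH10Pair Ω u g) (hΩ : IsOpen Ω) : u ∈ H10 Ω := by
  have hg := hu.weakGradient_ae_eq hΩ
  have hu' := hu.congr EventuallyEq.rfl hg.symm
  obtain ⟨φ, hφ, h1, h2, -⟩ := hu'.exists_seq
  exact ⟨hu.memLp, ⟨g, hu.isWeakGradient⟩, hu'.memLp_grad, φ, hφ, h1, h2⟩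

end IsH10Pair

/-! ### Radial cutoff functions. -/

section Cutoff

lemma exists_abs_deriv_smoothTransition_le : ∃ C > 0, ∀ s, |deriv Real.smoothTransition s| ≤ C := by
  have hc : Continuous (deriv Real.smoothTransition) :=
    Real.smoothTransition.contDiff.continuous_deriv (n := 1) le_rfl
  obtain ⟨C, hC⟩ := (isCompact_Icc (a := (0 : ℝ)) (b := 1)).exists_bound_of_continuousOn
    hc.continuousOn
  refine ⟨|C| + 1, by positivity, fun s => ?_⟩
  by_cases hs : s ∈ Set.Icc (0 : ℝ) 1
  · exact (hC s hs).trans ((le_abs_self C).trans (by linarith))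
  · have h0 : deriv Real.smoothTransition s = 0 := by
      rcases not_and_or.1 hs with h | h
      · have : Real.smoothTransition =ᶠ[𝓝 s] fun _ => 0 := by
          filter_upwards [Iio_mem_nhds (not_le.1 h)] with t ht
          exact Real.smoothTransition.zero_of_nonpos (le_of_lt ht)
        rw [this.deriv_eq, deriv_const]
      · have : Real.smoothTransition =ᶠ[𝓝 s] fun _ => 1 := by
          filter_upwards [Ioi_mem_nhds (not_le.1 h)] with t ht
          exact Real.smoothTransition.one_of_one_le (le_of_lt ht)
        rw [this.deriv_eq, deriv_const]
    rw [h0, abs_zero]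
    positivity

/-- A smooth radial cutoff function, equal to `1` on the ball of radius `ρ / 2` around `a` and
supported in the closed ball of radius `ρ`. -/
noncomputable def cut {N : ℕ} (a : Euc N) (ρ : ℝ) (x : Euc N) : ℝ :=
  Real.smoothTransition (2 - 2 * ‖x - a‖ ^ 2 / ρ ^ 2)

variable {N : ℕ} {a x : Euc N} {ρ : ℝ}

lemma cut_nonneg : 0 ≤ cut a ρ x := Real.smoothTransition.nonneg _

lemma cut_le_one : cut a ρ x ≤ 1 := Real.smoothTransition.le_one _

/-- Center and variable can be exchanged, so that `cut` also serves as a symmetric mollifier kernel.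
-/
lemma cut_comm (a x : Euc N) (ρ : ℝ) : cut a ρ x = cut x ρ a := by
  simp only [cut, norm_sub_rev]

lemma cut_eq_one (hρ : 0 < ρ) (hx : ‖x - a‖ ≤ ρ / 2) : cut a ρ x = 1 := by
  refine Real.smoothTransition.one_of_one_le ?_
  have : 2 * ‖x - a‖ ^ 2 / ρ ^ 2 ≤ 1 := by
    rw [div_le_one (by positivity)]
    nlinarith [norm_nonneg (x - a)]
  linarith

lemma cut_eq_zero (hρ : 0 < ρ) (hx : ρ ≤ ‖x - a‖) : cut a ρ x = 0 := by
  refine Real.smoothTransition.zero_of_nonpos ?_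
  have : 2 ≤ 2 * ‖x - a‖ ^ 2 / ρ ^ 2 := by
    rw [le_div_iff₀ (by positivity)]
    nlinarith [norm_nonneg (x - a)]
  linarith

lemma contDiff_cut : ContDiff ℝ ∞ (cut a ρ) :=
  Real.smoothTransition.contDiff.comp (contDiff_const.sub
    ((contDiff_const.mul ((contDiff_id.sub contDiff_const).norm_sq ℝ)).div_const _))

lemma hasGradientAt_norm_sub_sq (a x : Euc N) :
    HasGradientAt (fun y => ‖y - a‖ ^ 2) ((2 : ℝ) • (x - a)) x := by
  rw [hasGradientAt_iff_hasFDerivAt]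
  have := ((hasFDerivAt_id x).sub_const a).norm_sq
  refine this.congr_fderiv ?_
  ext y
  simp

lemma hasGradientAt_radial {T : ℝ → ℝ} {T' : ℝ} (hT : HasDerivAt T T' (2 - 2 * ‖x - a‖ ^ 2 / ρ ^ 2)) :
    HasGradientAt (fun y => T (2 - 2 * ‖y - a‖ ^ 2 / ρ ^ 2)) (-(4 * T' / ρ ^ 2) • (x - a)) x := by
  have h1 : HasDerivAt (fun s : ℝ => 2 - 2 * s / ρ ^ 2) (-(2 / ρ ^ 2)) (‖x - a‖ ^ 2) := by
    simpa using (((hasDerivAt_id (‖x - a‖ ^ 2)).const_mul 2).div_const (ρ ^ 2)).const_sub 2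
  have h2 := hasGradientAt_comp (T := fun s : ℝ => T (2 - 2 * s / ρ ^ 2))
    (f := fun y => ‖y - a‖ ^ 2) (HasDerivAt.comp (‖x - a‖ ^ 2) hT h1) (hasGradientAt_norm_sub_sq a x)
  have e : -(4 * T' / ρ ^ 2) • (x - a) = (T' * -(2 / ρ ^ 2)) • (2 : ℝ) • (x - a) := by
    rw [smul_smul]
    congr 1
    ring
  rw [e]
  exact h2

lemma gradient_cut : gradient (cut a ρ) x
    = -(4 * deriv Real.smoothTransition (2 - 2 * ‖x - a‖ ^ 2 / ρ ^ 2) / ρ ^ 2) • (x - a) :=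
  (hasGradientAt_radial ((Real.smoothTransition.contDiff (n := 1)).differentiable
    one_ne_zero _).hasDerivAt).gradient

lemma tsupport_cut_subset (hρ : 0 < ρ) : tsupport (cut a ρ) ⊆ Metric.closedBall a ρ := by
  refine closure_minimal (fun x hx => ?_) Metric.isClosed_closedBall
  by_contra h
  rw [Metric.mem_closedBall, dist_eq_norm, not_le] at h
  exact hx (cut_eq_zero hρ h.le)

lemma isTestFunction_cut {U : Set (Euc N)} (hρ : 0 < ρ) (h : Metric.closedBall a ρ ⊆ U) :
    IsTestFunction U (cut a ρ) where
  contDiff := contDiff_cut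
  hasCompactSupport := (isCompact_closedBall a ρ).of_isClosed_subset (isClosed_tsupport _)
    (tsupport_cut_subset hρ)
  tsupport_subset := (tsupport_cut_subset hρ).trans h

/-- The profile has bounded derivative, and its argument has gradient of size at most 4 / ρ on the
support. The constant therefore depends on neither the center, the radius nor the dimension. -/
lemma exists_norm_gradient_cut_le : ∃ C > 0, ∀ {N : ℕ} (a : Euc N) {ρ : ℝ}, 0 < ρ → ∀ x,
    ‖gradient (cut a ρ) x‖ ≤ C / ρ := by
  obtain ⟨C, hC, h⟩ := exists_abs_deriv_smoothTransition_le
  refine ⟨4 * C, by positivity, fun {N} a ρ hρ x => ?_⟩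
  by_cases hx : x ∈ Metric.closedBall a ρ
  · rw [Metric.mem_closedBall, dist_eq_norm] at hx
    rw [gradient_cut, norm_smul, norm_neg, norm_div, norm_mul, Real.norm_eq_abs, Real.norm_eq_abs,
      Real.norm_eq_abs, abs_of_pos (by positivity : (0 : ℝ) < ρ ^ 2), abs_of_pos four_pos]
    calc 4 * |deriv Real.smoothTransition (2 - 2 * ‖x - a‖ ^ 2 / ρ ^ 2)| / ρ ^ 2 * ‖x - a‖
        ≤ 4 * C / ρ ^ 2 * ρ := by
          gcongr
          exact h _
      _ = 4 * C / ρ := by field_simp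
  · rw [gradient_eq_zero_of_notMem_tsupport fun h => hx (tsupport_cut_subset hρ h), norm_zero]
    positivity

end Cutoff

/-! ### Zero boundary values keep {u > 1} away from the boundary of Ω. -/

section Boundary

variable {N : ℕ} {Ω : Set (Euc N)} {u : Euc N → ℝ}

/-- As its differential at p does not vanish, the defining function has no local maximum there. It
is thus positive at points arbitrarily close to p, hence on small balls around them. -/
lemma IsBoundedC2Domain.exists_ball_subset_compl (hΩ : IsBoundedC2Domain Ω) {p : Euc N}
    (hp : p ∈ frontier Ω) {U : Set (Euc N)} (hU : U ∈ 𝓝 p) :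
    ∃ y ∈ U, ∃ ε > 0, Metric.ball y ε ⊆ Ωᶜ := by
  obtain ⟨V, ρ, hV, hpV, hρ, hρp, hdρ, hVΩ⟩ := hΩ.boundary p hp
  have hfreq : ∃ᶠ y in 𝓝 p, 0 < ρ y := fun h => hdρ <| by
    refine IsLocalMax.fderiv_eq_zero ?_
    filter_upwards [h] with y hy
    rw [hρp]
    exact not_lt.1 hy
  obtain ⟨y, hy, hyV, hyU⟩ := (hfreq.and_eventually ((hV.eventually_mem hpV).and
    (eventually_mem_set.2 hU))).exists
  have hopen : IsOpen (V ∩ ρ ⁻¹' Set.Ioi 0) := hρ.continuousOn.isOpen_inter_preimage hV isOpen_Ioi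
  obtain ⟨ε, hε, hball⟩ := Metric.isOpen_iff.1 hopen y ⟨hyV, hy⟩
  refine ⟨y, hyU, ε, hε, fun z hz hzΩ => ?_⟩
  have h1 := hball hz
  exact absurd ((hVΩ z h1.1).1 hzΩ) (not_lt.2 (le_of_lt h1.2))

/-- A function of `H¹₀(Ω)` cannot be constantly `1` in `Ω` near a boundary point. -/
lemma IsH10Pair.false_of_eq_one {w : Euc N → ℝ} {h : Euc N → Euc N} (hw : IsH10Pair Ω w h)
    (hΩo : IsOpen Ω) {p : Euc N} {δ : ℝ} (hδ : 0 < δ)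
    (hw1 : ∀ x ∈ Ω, x ∈ Metric.ball p δ → w x = 1)
    (hh0 : ∀ x ∈ Ω, x ∈ Metric.ball p δ → h x = 0)
    {y₁ y₂ : Euc N} (hy₁ : y₁ ∈ Metric.ball p (δ / 2)) (hy₂ : y₂ ∈ Metric.ball p (δ / 2))
    {ε : ℝ} (hε : 0 < ε) (hy₁Ω : Metric.ball y₁ ε ⊆ Ωᶜ) (hy₂Ω : y₂ ∈ Ω) : False := by
  -- The bound ε keeps the r-ball around y₁ outside Ω; the bound δ/4 keeps the r-balls around points
  -- of the half ball inside B.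
  set r := min ε (δ / 4) with hr
  have hr0 : 0 < r := lt_min hε (by linarith)
  set B := Metric.ball p δ with hB
  have hBm : MeasurableSet B := Metric.isOpen_ball.measurableSet
  have hfin : volume (Ω ∩ B) < ⊤ := (measure_mono Set.inter_subset_right).trans_lt measure_ball_lt_top
  have : IsFiniteMeasure (volume.restrict (Ω ∩ B)) := ⟨by simpa using hfin⟩
  have hsub : ∀ y ∈ Metric.ball p (δ / 2), Metric.closedBall y r ⊆ B := fun y hy z hz => by
    rw [Metric.mem_ball] at *
    rw [Metric.mem_closedBall] at hz
    have := dist_triangle z y p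
    have : r ≤ δ / 4 := min_le_right _ _
    linarith
  obtain ⟨C, hC, hCb⟩ := exists_norm_gradient_cut_le
  have htest : ∀ y : Euc N, IsTestFunction Set.univ (cut y r) := fun y =>
    isTestFunction_cut hr0 (Set.subset_univ _)
  -- integrals of derivatives of bumps vanish
  have hzero : ∀ y ∈ Metric.ball p (δ / 2), ∫ x in Ω ∩ B, gradient (cut x r) y = 0 := by
    intro y hy
    have e : ∀ x, gradient (cut x r) y = -gradient (cut y r) x := fun x => by
      rw [gradient_cut, gradient_cut, norm_sub_rev, ← smul_neg, neg_sub]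
    simp only [e]
    rw [integral_neg, neg_eq_zero]
    have h1 := hw.integral_smul_gradient (htest y)
    have h2 : ∫ x in Ω, cut y r x • h x = 0 := by
      rw [← integral_zero (Euc N) (Euc N) (μ := volume.restrict Ω)]
      refine setIntegral_congr_fun hΩo.measurableSet fun x hx => ?_
      by_cases hxB : x ∈ B
      · simp only [hh0 x hx hxB, smul_zero]
      · simp only [image_eq_zero_of_notMem_tsupport
          fun h' => hxB (hsub y hy (tsupport_cut_subset hr0 h')), zero_smul]
    rw [h2, neg_zero] at h1
    rw [← h1, setIntegral_eq_of_subset_of_forall_sdiff_eq_zero (s := Ω ∩ B) hΩo.measurableSet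
      Set.inter_subset_left]
    · refine setIntegral_congr_fun (hΩo.measurableSet.inter hBm) fun x hx => ?_
      simp only [hw1 x hx.1 hx.2, one_smul]
    · intro x hx
      rw [gradient_eq_zero_of_notMem_tsupport
        fun h' => hx.2 ⟨hx.1, hsub y hy (tsupport_cut_subset hr0 h')⟩, smul_zero]
  have hcontG : Continuous fun q : Euc N × Euc N => gradient (cut q.1 r) q.2 := by
    simp only [gradient_cut]
    have hc : Continuous (deriv Real.smoothTransition) :=
      Real.smoothTransition.contDiff.continuous_deriv (n := 1) le_rfl
    fun_prop
  have hcontC : Continuous fun q : Euc N × Euc N => cut q.1 r q.2 := by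
    have hc := Real.smoothTransition.continuous
    unfold cut
    fun_prop
  -- This function of y is a mollified indicator of Ω ∩ B. By `hzero` it is constant on the half
  -- ball around p; yet it vanishes at y₁, near which there are no points of Ω, and is positive at
  -- y₂ ∈ Ω.
  have hderiv : ∀ y, HasFDerivAt (fun y => ∫ x in Ω ∩ B, cut x r y)
      (∫ x in Ω ∩ B, fderiv ℝ (cut x r) y) y := by
    intro y
    refine hasFDerivAt_integral_of_dominated_of_fderiv_le (𝕜 := ℝ) (F := fun y x => cut x r y)
      (F' := fun y x => fderiv ℝ (cut x r) y) (s := Set.univ) (bound := fun _ => C / r)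
      univ_mem ?_ ?_ ?_ ?_ ?_ ?_
    · exact Eventually.of_forall fun y =>
        (hcontC.comp (continuous_id.prodMk continuous_const)).aestronglyMeasurable
    · refine Integrable.of_bound (C := 1)
        (hcontC.comp (continuous_id.prodMk continuous_const)).aestronglyMeasurable
        (ae_of_all _ fun x => ?_)
      rw [Real.norm_eq_abs, abs_of_nonneg cut_nonneg]
      exact cut_le_one
    · have : (fun x => fderiv ℝ (cut x r) y)
          = fun x => (InnerProductSpace.toDual ℝ (Euc N)) (gradient (cut x r) y) := by
        funext x; rw [toDual_gradient]
      rw [this]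
      exact ((InnerProductSpace.toDual ℝ (Euc N)).continuous.comp
        (hcontG.comp (continuous_id.prodMk continuous_const))).aestronglyMeasurable
    · exact ae_of_all _ fun x y _ => by
        rw [← norm_gradient]
        exact hCb x hr0 y
    · exact integrable_const _
    · exact ae_of_all _ fun x y _ => ((htest x).differentiable y).hasFDerivAt
  have hderiv0 : ∀ y ∈ Metric.ball p (δ / 2), ∫ x in Ω ∩ B, fderiv ℝ (cut x r) y = 0 := by
    intro y hy
    have := congrArg (InnerProductSpace.toDual ℝ (Euc N)) (hzero y hy)
    rw [map_zero] at this
    rw [← this]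
    refine Eq.trans ?_ ((InnerProductSpace.toDual ℝ (Euc N)).toContinuousLinearEquiv.toContinuousLinearMap.integral_comp_comm ?_)
    · refine integral_congr_ae (ae_of_all _ fun x => ?_)
      exact (toDual_gradient ..).symm
    · refine Integrable.of_bound (C := C / r)
        (hcontG.comp (continuous_id.prodMk continuous_const)).aestronglyMeasurable
        (ae_of_all _ fun x => hCb x hr0 y)
  have hconst : ∫ x in Ω ∩ B, cut x r y₂ = ∫ x in Ω ∩ B, cut x r y₁ := by
    have := (convex_ball p (δ / 2)).norm_image_sub_le_of_norm_hasFDerivWithin_le (C := 0)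
      (fun y _ => (hderiv y).hasFDerivWithinAt) (fun y hy => by rw [hderiv0 y hy, norm_zero]) hy₁ hy₂
    rw [zero_mul] at this
    exact sub_eq_zero.1 (norm_le_zero_iff.1 this)
  have h1 : ∫ x in Ω ∩ B, cut x r y₁ = 0 := by
    rw [← integral_zero (Euc N) ℝ (μ := volume.restrict (Ω ∩ B))]
    refine setIntegral_congr_fun (hΩo.measurableSet.inter hBm) fun x hx => ?_
    rw [cut_comm]
    refine cut_eq_zero hr0 ?_
    by_contra hlt
    rw [not_le, ← dist_eq_norm] at hlt
    exact hy₁Ω (Metric.mem_ball.2 (hlt.trans_le (min_le_left _ _))) hx.1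
  have h2 : 0 < ∫ x in Ω ∩ B, cut x r y₂ := by
    have hint : Integrable (fun x => cut x r y₂) (volume.restrict (Ω ∩ B)) :=
      Integrable.of_bound (C := 1)
        (hcontC.comp (continuous_id.prodMk continuous_const)).aestronglyMeasurable
        (ae_of_all _ fun x => by
          rw [Real.norm_eq_abs, abs_of_nonneg cut_nonneg]
          exact cut_le_one)
    rw [integral_pos_iff_support_of_nonneg (fun x => cut_nonneg) hint]
    have hy₂B : y₂ ∈ B := Metric.ball_subset_ball (by linarith) hy₂
    have ho : IsOpen (Metric.ball y₂ (r / 2) ∩ (Ω ∩ B)) :=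
      Metric.isOpen_ball.inter (hΩo.inter Metric.isOpen_ball)
    refine (ho.measure_pos volume ⟨y₂, Metric.mem_ball_self (by linarith), hy₂Ω, hy₂B⟩).trans_le ?_
    rw [← Measure.restrict_apply Metric.isOpen_ball.measurableSet]
    refine measure_mono fun x hx => ?_
    rw [Metric.mem_ball, dist_eq_norm] at hx
    rw [Function.mem_support, cut_comm, cut_eq_one hr0 hx.le]
    exact one_ne_zero
  rw [hconst, h1] at h2
  exact lt_irrefl _ h2

/-- The ball around a point of `{u > 1}` that reaches to `{u ≤ 1}` is contained in `Ω`. -/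
lemma ball_infDist_subset_superOne (hΩ : IsBoundedC2Domain Ω) (hu : u ∈ H10 Ω) {x₀ : Euc N}
    (hx₀ : x₀ ∈ superOne Ω u) :
    Metric.ball x₀ (Metric.infDist x₀ (subOne Ω u)) ⊆ superOne Ω u := by
  set d := Metric.infDist x₀ (subOne Ω u) with hd
  have hgt : ∀ y ∈ Metric.ball x₀ d, y ∈ Ω → 1 < u y := fun y hy hyΩ => by
    by_contra h
    rw [not_lt] at h
    have := Metric.infDist_le_dist_of_mem (x := x₀) (show y ∈ subOne Ω u from ⟨hyΩ, h⟩)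
    rw [Metric.mem_ball, dist_comm] at hy
    linarith
  suffices hsub : Metric.ball x₀ d ⊆ Ω from fun y hy => ⟨hsub hy, hgt y hy (hsub hy)⟩
  rcases le_or_gt d 0 with hd0 | hd0
  · rw [Metric.ball_eq_empty.2 hd0]
    exact Set.empty_subset _
  -- A connected set that meets the open set Ω but not its frontier lies in Ω.
  refine (convex_ball x₀ d).isPreconnected.subset_of_closure_inter_subset hΩ.isOpen
    ⟨x₀, Metric.mem_ball_self hd0, hx₀.1⟩ ?_
  rintro p ⟨hpc, hpB⟩
  by_contra hpΩ
  have hpf : p ∈ frontier Ω := ⟨hpc, by rwa [hΩ.isOpen.interior_eq]⟩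
  obtain ⟨δ, hδ, hδB⟩ := Metric.isOpen_iff.1 Metric.isOpen_ball p hpB
  obtain ⟨y₁, hy₁, ε, hε, hy₁Ω⟩ := hΩ.exists_ball_subset_compl hpf
    (Metric.ball_mem_nhds p (half_pos hδ))
  obtain ⟨y₂, hy₂, hy₂Ω⟩ := mem_closure_iff_nhds.1 hpc _ (Metric.ball_mem_nhds p (half_pos hδ))
  have hpair := IsH10Pair.of_mem_H10 hu
  -- The function u - (u - 1)₊ = min(u, 1), which equals 1 with zero gradient wherever u > 1.
  have hw := hpair.add ((hpair.posPart hΩ.isBounded.measure_lt_top.ne).const_mul (-1))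
  refine hw.false_of_eq_one hΩ.isOpen hδ (fun x hx hxB => ?_) (fun x hx hxB => ?_) hy₁ hy₂ hε
    hy₁Ω hy₂Ω
  · have := hgt x (hδB hxB) hx
    rw [max_eq_left (by linarith)]
    ring
  · have := hgt x (hδB hxB) hx
    simp [this]

end Boundary

/-! ### Projection onto the Nehari manifold and the reduced energy. -/

section Exponents

variable {N : ℕ}

lemma two_lt_twoStar (hN : 3 ≤ N) : 2 < twoStar N := by
  have h : (3 : ℝ) ≤ N := by exact_mod_cast hN
  rw [twoStar, lt_div_iff₀ (by linarith)]
  linarith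

lemma twoStar_sub_two (hN : 3 ≤ N) : twoStar N - 2 = 4 / ((N : ℝ) - 2) := by
  have h : (3 : ℝ) ≤ N := by exact_mod_cast hN
  have : (N : ℝ) - 2 ≠ 0 := by linarith
  rw [twoStar]
  field_simp
  ring

lemma half_sub_inv_twoStar (hN : 3 ≤ N) : 1 / 2 - 1 / twoStar N = 1 / (N : ℝ) := by
  have h : (3 : ℝ) ≤ N := by exact_mod_cast hN
  have : (N : ℝ) - 2 ≠ 0 := by linarith
  have : (N : ℝ) ≠ 0 := by linarith
  rw [twoStar]
  field_simp
  ring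

/-- The factor that projects onto the Nehari manifold. -/
lemma exists_scaling (hN : 3 ≤ N) {A B : ℝ} (hA : 0 < A) (hB : 0 < B) :
    ∃ t > 0, t ^ 2 * A = t ^ twoStar N * B ∧ t ^ 2 * A = A * (A / B) ^ (((N : ℝ) - 2) / 2) := by
  have h : (3 : ℝ) ≤ N := by exact_mod_cast hN
  have hAB : 0 < A / B := div_pos hA hB
  have hN2 : (N : ℝ) - 2 ≠ 0 := by linarith
  -- The solution of t^{2* - 2} = A / B, since 2* - 2 = 4 / (N - 2).
  refine ⟨(A / B) ^ (((N : ℝ) - 2) / 4), Real.rpow_pos_of_pos hAB _, ?_, ?_⟩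
  · set t := (A / B) ^ (((N : ℝ) - 2) / 4) with ht
    have htp : 0 < t := Real.rpow_pos_of_pos hAB _
    have h1 : t ^ (twoStar N - 2) = A / B := by
      rw [twoStar_sub_two hN, ht, ← Real.rpow_mul hAB.le]
      rw [show ((N : ℝ) - 2) / 4 * (4 / ((N : ℝ) - 2)) = 1 by field_simp, Real.rpow_one]
    have h2 : t ^ twoStar N = t ^ 2 * (A / B) := by
      rw [← h1, ← Real.rpow_natCast t 2, ← Real.rpow_add htp]
      congr 1
      push_cast
      ring
    rw [h2]
    field_simp
  · rw [← Real.rpow_natCast, ← Real.rpow_mul hAB.le, mul_comm A]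
    congr 2
    push_cast
    ring

end Exponents

variable {N : ℕ} {Ω : Set (Euc N)} {lam κ : ℝ} {u w : Euc N → ℝ} {g h : Euc N → Euc N}

lemma superOne_subset : superOne Ω u ⊆ Ω := fun _ hx => hx.1

/-- The energy, split along the free boundary. -/
lemma IsH10Pair.J_eq (hN : 3 ≤ N) (hw : IsH10Pair Ω w h) (hΩ : IsOpen Ω) (hfin : volume Ω ≠ ⊤)
    (hS : MeasurableSet (superOne Ω w))
    (hint : IntegrableOn (fun x => (w x - 1) ^ twoStar N) (superOne Ω w)) :
    J Ω lam κ w = 1 / 2 * (∫ x in Ω \ superOne Ω w, ‖h x‖ ^ 2)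
      + volume.real (superOne Ω w)
      + 1 / 2 * (∫ x in superOne Ω w, (‖h x‖ ^ 2 - lam * (w x - 1) ^ 2))
      - κ / twoStar N * ∫ x in superOne Ω w, (w x - 1) ^ twoStar N := by
  have : IsFiniteMeasure (volume.restrict Ω) := ⟨by simpa using hfin.lt_top⟩
  set S := superOne Ω w with hSdef
  have hSΩ : S ⊆ Ω := superOne_subset
  have hp0 : twoStar N ≠ 0 := by linarith [two_lt_twoStar hN]
  have ih : IntegrableOn (fun x => ‖h x‖ ^ 2) Ω := hw.memLp_grad.integrable_norm_pow (by norm_num)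
  have iw : IntegrableOn (fun x => (w x - 1) ^ 2) Ω :=
    (hw.memLp.sub (memLp_const 1)).integrable_sq
  have e : J Ω lam κ w = ∫ x in Ω, (1 / 2 * ‖h x‖ ^ 2 + S.indicator (fun x => 1
      - lam / 2 * (w x - 1) ^ 2 - κ / twoStar N * (w x - 1) ^ twoStar N) x) := by
    refine integral_congr_ae ?_
    filter_upwards [hw.weakGradient_ae_eq hΩ, ae_restrict_mem hΩ.measurableSet] with x hx hxΩ
    rw [hx]
    by_cases hxS : x ∈ S
    · have : 1 < w x := hxS.2
      rw [← hSdef, Set.indicator_of_mem hxS, Set.indicator_of_mem hxS,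
        max_eq_left (by linarith)]
      ring
    · have : w x ≤ 1 := not_lt.1 fun h => hxS ⟨hxΩ, h⟩
      rw [← hSdef, Set.indicator_of_notMem hxS, Set.indicator_of_notMem hxS,
        max_eq_right (by linarith), Real.zero_rpow hp0]
      ring
  have i1 : IntegrableOn (fun _ : Euc N => (1 : ℝ)) S := integrableOn_const
    ((measure_mono hSΩ).trans_lt hfin.lt_top).ne
  have i2 : IntegrableOn (fun x => lam / 2 * (w x - 1) ^ 2) S := (iw.mono_set hSΩ).const_mul _
  have i3 : IntegrableOn (fun x => κ / twoStar N * (w x - 1) ^ twoStar N) S := hint.const_mul _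
  have i4 : IntegrableOn (fun x => 1 - lam / 2 * (w x - 1) ^ 2
      - κ / twoStar N * (w x - 1) ^ twoStar N) S := (i1.sub i2).sub i3
  have e2 : ∫ x in S, (1 - lam / 2 * (w x - 1) ^ 2 - κ / twoStar N * (w x - 1) ^ twoStar N)
      = (∫ x in S, (1 - lam / 2 * (w x - 1) ^ 2))
        - ∫ x in S, κ / twoStar N * (w x - 1) ^ twoStar N := integral_sub (i1.sub i2) i3
  rw [e, integral_add (ih.const_mul _) (i4.integrable_indicator hS).restrict,
    setIntegral_indicator hS, Set.inter_eq_self_of_subset_right hSΩ,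
    e2, integral_sub i1 i2, integral_const_mul, integral_const_mul,
    integral_const_mul, integral_sub (ih.mono_set hSΩ) ((iw.mono_set hSΩ).const_mul _),
    integral_const_mul, setIntegral_const,
    setIntegral_sdiff hS ih hSΩ]
  simp only [smul_eq_mul, mul_one]
  ring

/-- A nonintegrable function has Bochner integral zero, which the strict positivity in the manifold
excludes. -/
lemma integrableOn_of_mem_nehari (hu : u ∈ nehari Ω lam κ) :
    IntegrableOn (fun x => (u x - 1) ^ twoStar N) (superOne Ω u) := by
  by_contra hcon
  have := hu.2.2
  rw [integral_undef hcon, mul_zero] at this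
  exact lt_irrefl _ this

/-- The minimality of `u`, tested with the projection of `w` onto the Nehari manifold. -/
lemma energy_le_of_isMinOn (hN : 3 ≤ N) (hΩ : IsOpen Ω) (hfin : volume Ω ≠ ⊤)
    (hmem : u ∈ nehari Ω lam κ) (hmin : IsMinOn (J Ω lam κ) (nehari Ω lam κ) u)
    (hS : MeasurableSet (superOne Ω u)) (hw : IsH10Pair Ω w h)
    (hS' : MeasurableSet (superOne Ω w)) (hsub : superOne Ω w ⊆ superOne Ω u)
    (hout : ∀ x ∈ Ω \ superOne Ω u, h x = weakGradient Ω u x)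
    (hzero : ∀ x ∈ superOne Ω u \ superOne Ω w, h x = 0)
    (hint : IntegrableOn (fun x => (w x - 1) ^ twoStar N) (superOne Ω w)) {A B : ℝ}
    (hA : A = ∫ x in superOne Ω w, (‖h x‖ ^ 2 - lam * (w x - 1) ^ 2))
    (hB : B = κ * ∫ x in superOne Ω w, (w x - 1) ^ twoStar N) (hA0 : 0 < A) (hB0 : 0 < B) :
    (κ * ∫ x in superOne Ω u, (u x - 1) ^ twoStar N) / N + volume.real (superOne Ω u)
      ≤ A * (A / B) ^ (((N : ℝ) - 2) / 2) / N + volume.real (superOne Ω w) := by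
  obtain ⟨t, ht, ht1, ht2⟩ := exists_scaling hN hA0 hB0
  have hp0 : twoStar N ≠ 0 := by linarith [two_lt_twoStar hN]
  have hupair := IsH10Pair.of_mem_H10 hmem.1
  -- Adding (t - 1)(w - 1)₊ multiplies w - 1 by t on {w > 1} and leaves w untouched elsewhere, so
  -- the superlevel set is preserved.
  have hwt := hw.add ((hw.posPart hfin).const_mul (t - 1))
  set wt : Euc N → ℝ := fun x => w x + (t - 1) * max (w x - 1) 0 with hwtdef
  set ht' : Euc N → Euc N := fun x => h x + (t - 1) • {x | 1 < w x}.indicator h x with htdef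
  have hpos : ∀ x, 1 < w x → wt x - 1 = t * (w x - 1) := fun x hx => by
    rw [hwtdef]
    simp only
    rw [max_eq_left (by linarith)]
    ring
  have hneg : ∀ x, ¬ 1 < w x → wt x = w x := fun x hx => by
    rw [hwtdef]
    simp only
    rw [max_eq_right (by linarith), mul_zero, add_zero]
  have hgpos : ∀ x, 1 < w x → ht' x = t • h x := fun x hx => by
    rw [htdef]
    simp only
    rw [Set.indicator_of_mem (show x ∈ {x | 1 < w x} from hx), sub_smul, one_smul]
    abel
  have hgneg : ∀ x, ¬ 1 < w x → ht' x = h x := fun x hx => by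
    rw [htdef]
    simp only
    rw [Set.indicator_of_notMem (show x ∉ {x | 1 < w x} from hx), smul_zero, add_zero]
  have hSt : superOne Ω wt = superOne Ω w := by
    ext x
    refine and_congr_right fun _ => ?_
    by_cases hx : 1 < w x
    · refine iff_of_true ?_ hx
      have := hpos x hx
      have : 0 < t * (w x - 1) := mul_pos ht (by linarith)
      linarith
    · rw [hneg x hx]
  have hpow : ∀ x ∈ superOne Ω w, (wt x - 1) ^ twoStar N = t ^ twoStar N * (w x - 1) ^ twoStar N :=
    fun x hx => by rw [hpos x hx.2, Real.mul_rpow ht.le (by linarith [hx.2])]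
  have hintt : IntegrableOn (fun x => (wt x - 1) ^ twoStar N) (superOne Ω w) :=
    IntegrableOn.congr_fun (hint.const_mul _) (fun x hx => (hpow x hx).symm) hS'
  have hBt : ∫ x in superOne Ω w, (wt x - 1) ^ twoStar N
      = t ^ twoStar N * ∫ x in superOne Ω w, (w x - 1) ^ twoStar N := by
    rw [setIntegral_congr_fun hS' hpow, integral_const_mul]
  have hAt : ∫ x in superOne Ω w, (‖ht' x‖ ^ 2 - lam * (wt x - 1) ^ 2) = t ^ 2 * A := by
    rw [hA, ← integral_const_mul]
    refine setIntegral_congr_fun hS' fun x hx => ?_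
    rw [hpos x hx.2, hgpos x hx.2, norm_smul, Real.norm_eq_abs, mul_pow, sq_abs]
    ring
  have hwtmem : wt ∈ nehari Ω lam κ := by
    refine ⟨hwt.mem_H10 hΩ, ?_, ?_⟩
    · rw [hSt, hBt]
      have : ∫ x in superOne Ω w, (‖weakGradient Ω wt x‖ ^ 2 - lam * (wt x - 1) ^ 2)
          = ∫ x in superOne Ω w, (‖ht' x‖ ^ 2 - lam * (wt x - 1) ^ 2) := by
        refine integral_congr_ae ?_
        filter_upwards [ae_restrict_of_ae_restrict_of_subset superOne_subset
          (hwt.weakGradient_ae_eq hΩ)] with x hx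
        rw [hx]
      rw [this, hAt, ht1, hB]
      ring
    · rw [hSt, hBt]
      have : 0 < t ^ twoStar N * B := mul_pos (Real.rpow_pos_of_pos ht _) hB0
      rw [hB] at this
      linarith
  have hle : J Ω lam κ u ≤ J Ω lam κ wt := hmin hwtmem
  rw [hupair.J_eq hN hΩ hfin hS (integrableOn_of_mem_nehari hmem),
    hwt.J_eq hN hΩ hfin (hSt ▸ hS') (hSt ▸ hintt), hSt, hAt, hBt, hmem.2.1] at hle
  -- The Dirichlet energies outside the superlevel sets agree and cancel: the gradients coincide
  -- outside {u > 1}, and the part removed from {u > 1} carries zero gradient.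
  have hG : ∫ x in Ω \ superOne Ω w, ‖ht' x‖ ^ 2
      = ∫ x in Ω \ superOne Ω u, ‖weakGradient Ω u x‖ ^ 2 := by
    rw [setIntegral_eq_of_subset_of_forall_sdiff_eq_zero (s := Ω \ superOne Ω u)
      (hΩ.measurableSet.diff hS') (Set.sdiff_subset_sdiff_right hsub)]
    · refine setIntegral_congr_fun (hΩ.measurableSet.diff hS) fun x hx => ?_
      rw [hgneg x fun h => hx.2 (hsub ⟨hx.1, h⟩), hout x hx]
    · intro x hx
      have hxS : x ∈ superOne Ω u := by
        by_contra hcon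
        exact hx.2 ⟨hx.1.1, hcon⟩
      rw [hgneg x fun h => hx.1.2 ⟨hx.1.1, h⟩, hzero x ⟨hxS, hx.1.2⟩]
      simp
  rw [hG] at hle
  have hbB : κ / twoStar N * (t ^ twoStar N * ∫ x in superOne Ω w, (w x - 1) ^ twoStar N)
      = 1 / twoStar N * (t ^ twoStar N * B) := by
    rw [hB]; ring
  rw [hbB, ← ht1] at hle
  -- On the manifold the quadratic and critical terms combine with the factor 1/2 - 1/2* = 1/N.
  have hdiv : ∀ c : ℝ, c / N = c * (1 / 2 - 1 / twoStar N) := fun c => by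
    rw [half_sub_inv_twoStar hN, div_eq_mul_one_div]
  rw [← ht2, hdiv, hdiv]
  have : κ / twoStar N = κ * (1 / twoStar N) := div_eq_mul_one_div _ _
  rw [this] at hle
  linarith

/-! ### The Euler-Lagrange equation in {u > 1}. -/

lemma integrable_inner_of_memLp {X E : Type*} [MeasurableSpace X] {μ : Measure X}
    [NormedAddCommGroup E] [InnerProductSpace ℝ E] {f g : X → E} (hf : MemLp f 2 μ)
    (hg : MemLp g 2 μ) : Integrable (fun x => (inner ℝ (f x) (g x) : ℝ)) μ :=
  (hf.norm.integrable_mul hg.norm).mono' (hf.1.inner hg.1)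
    (ae_of_all _ fun x => norm_inner_le_norm (f x) (g x))

/-- The standing assumptions: `u` is a continuous minimizer of `J` on the Nehari manifold. -/
structure IsContinuousMinimizer {N : ℕ} (Ω : Set (Euc N)) (lam κ : ℝ) (u : Euc N → ℝ) : Prop where
  three_le : 3 ≤ N
  domain : IsBoundedC2Domain Ω
  lam_pos : 0 < lam
  kappa_pos : 0 < κ
  continuousOn : ContinuousOn u Ω
  mem : u ∈ nehari Ω lam κ
  isMinOn : IsMinOn (J Ω lam κ) (nehari Ω lam κ) u

namespace IsContinuousMinimizer

variable {N : ℕ} {Ω : Set (Euc N)} {lam κ : ℝ} {u φ : Euc N → ℝ} {h : Euc N → Euc N}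

lemma pair (hu : IsContinuousMinimizer Ω lam κ u) : IsH10Pair Ω u (weakGradient Ω u) :=
  IsH10Pair.of_mem_H10 hu.mem.1

lemma volume_ne_top (hu : IsContinuousMinimizer Ω lam κ u) : volume Ω ≠ ⊤ :=
  hu.domain.isBounded.measure_lt_top.ne

lemma isOpen_superOne (hu : IsContinuousMinimizer Ω lam κ u) : IsOpen (superOne Ω u) :=
  hu.continuousOn.isOpen_inter_preimage hu.domain.isOpen isOpen_Ioi

lemma measurableSet_superOne (hu : IsContinuousMinimizer Ω lam κ u) :
    MeasurableSet (superOne Ω u) := hu.isOpen_superOne.measurableSet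

lemma isFiniteMeasure_restrict (hu : IsContinuousMinimizer Ω lam κ u) :
    IsFiniteMeasure (volume.restrict (superOne Ω u)) :=
  ⟨by simpa using (measure_mono superOne_subset).trans_lt hu.volume_ne_top.lt_top⟩

lemma memLp_sub_one (hu : IsContinuousMinimizer Ω lam κ u) :
    MemLp (fun x => u x - 1) 2 (volume.restrict (superOne Ω u)) := by
  have := hu.isFiniteMeasure_restrict
  exact (hu.pair.memLp.mono_measure (Measure.restrict_mono superOne_subset le_rfl)).sub
    (memLp_const 1)

lemma memLp_grad (hu : IsContinuousMinimizer Ω lam κ u) :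
    MemLp (weakGradient Ω u) 2 (volume.restrict (superOne Ω u)) :=
  hu.pair.memLp_grad.mono_measure (Measure.restrict_mono superOne_subset le_rfl)

lemma integrable_rpow (hu : IsContinuousMinimizer Ω lam κ u) :
    IntegrableOn (fun x => (u x - 1) ^ twoStar N) (superOne Ω u) :=
  integrableOn_of_mem_nehari hu.mem

lemma exists_bounds (hu : IsContinuousMinimizer Ω lam κ u) {K : Set (Euc N)} (hK : IsCompact K)
    (hKS : K ⊆ superOne Ω u) : ∃ m > 0, ∃ V, ∀ x ∈ K, m ≤ u x - 1 ∧ u x - 1 ≤ V := by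
  have hc : ContinuousOn (fun x => u x - 1) K :=
    (hu.continuousOn.mono (hKS.trans superOne_subset)).sub continuousOn_const
  rcases K.eq_empty_or_nonempty with rfl | hne
  · exact ⟨1, one_pos, 0, fun x hx => hx.elim⟩
  · obtain ⟨y, hyK, hy⟩ := hK.exists_isMinOn hne hc
    obtain ⟨z, hzK, hz⟩ := hK.exists_isMaxOn hne hc
    exact ⟨u y - 1, sub_pos.2 (hKS hyK).2, u z - 1, fun x hx => ⟨hy hx, hz hx⟩⟩

/-- The Euler-Lagrange equation in `{u > 1}`. -/
lemma euler_lagrange (hu : IsContinuousMinimizer Ω lam κ u) (hφ : IsH10Pair Ω φ h)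
    {K : Set (Euc N)} (hK : IsCompact K) (hKS : K ⊆ superOne Ω u) (hφ0 : ∀ x ∉ K, φ x = 0)
    (hh0 : ∀ x ∉ K, h x = 0) {M : ℝ} (hM : ∀ x, |φ x| ≤ M) :
    IntegrableOn (fun x => (u x - 1) ^ (twoStar N - 1) * φ x) (superOne Ω u) ∧
    ∫ x in superOne Ω u, inner ℝ (weakGradient Ω u x) (h x)
      = lam * (∫ x in superOne Ω u, (u x - 1) * φ x)
        + κ * ∫ x in superOne Ω u, (u x - 1) ^ (twoStar N - 1) * φ x := by
  have hfinm := hu.isFiniteMeasure_restrict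
  set S := superOne Ω u with hS
  set g := weakGradient Ω u with hg
  set p := twoStar N with hp
  set μ := volume.restrict S with hμ
  have hp2 : 2 < p := two_lt_twoStar hu.three_le
  have hN : (3 : ℝ) ≤ N := by exact_mod_cast hu.three_le
  have hSm := hu.measurableSet_superOne
  have hM0 : 0 ≤ M := (abs_nonneg _).trans (hM 0)
  obtain ⟨m, hm, V, hmV⟩ := hu.exists_bounds hK hKS
  -- For |s| < s₀ the perturbation s φ is at most m/2, half the lower bound m of u - 1 on K. Hence
  -- {u + s φ > 1} = {u > 1} and the volume term does not vary. The summand 1 guards against M = 0.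
  set s₀ := m / (2 * (M + 1)) with hs₀
  have hs₀pos : 0 < s₀ := by positivity
  have hsφ : ∀ s : ℝ, |s| < s₀ → ∀ x, |s * φ x| ≤ m / 2 := fun s hs x => by
    rw [abs_mul]
    calc |s| * |φ x| ≤ s₀ * (M + 1) := by
          gcongr
          linarith [hM x]
      _ = m / 2 := by rw [hs₀]; field_simp
  have hK_pos : ∀ s : ℝ, |s| < s₀ → ∀ x ∈ K, 0 < u x - 1 + s * φ x ∧ u x - 1 + s * φ x ≤ |V| + m :=
    fun s hs x hx => by
      have h1 := abs_le.1 (hsφ s hs x)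
      have h2 := hmV x hx
      have h3 := le_abs_self V
      constructor <;> linarith
  have hS_pos : ∀ s : ℝ, |s| < s₀ → ∀ x ∈ S, 0 < u x - 1 + s * φ x := fun s hs x hx => by
    by_cases hxK : x ∈ K
    · exact (hK_pos s hs x hxK).1
    · rw [hφ0 x hxK, mul_zero, add_zero]
      exact sub_pos.2 hx.2
  have hφm : AEStronglyMeasurable φ μ := (hφ.memLp.mono_measure
    (Measure.restrict_mono superOne_subset le_rfl)).1
  have hφ2 : MemLp φ 2 μ := hφ.memLp.mono_measure (Measure.restrict_mono superOne_subset le_rfl)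
  have hh2 : MemLp h 2 μ := hφ.memLp_grad.mono_measure
    (Measure.restrict_mono superOne_subset le_rfl)
  have hv2 : MemLp (fun x => u x - 1) 2 μ := hu.memLp_sub_one
  have hg2 : MemLp g 2 μ := hu.memLp_grad
  -- perturbed quantities
  set A : ℝ → ℝ := fun s => ∫ x, (‖g x + s • h x‖ ^ 2 - lam * (u x - 1 + s * φ x) ^ 2) ∂μ with hA
  set b : ℝ → ℝ := fun s => ∫ x, (u x - 1 + s * φ x) ^ p ∂μ with hb
  set A₀ := κ * ∫ x in S, (u x - 1) ^ p with hA₀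
  have hA₀pos : 0 < A₀ := hu.mem.2.2
  set a₁ := (∫ x, inner ℝ (g x) (h x) ∂μ) - lam * ∫ x, (u x - 1) * φ x ∂μ with ha₁
  have igh : Integrable (fun x => (inner ℝ (g x) (h x) : ℝ)) μ :=
    integrable_inner_of_memLp hg2 hh2
  have ivφ : Integrable (fun x => (u x - 1) * φ x) μ := hv2.integrable_mul hφ2
  have ihh : Integrable (fun x => ‖h x‖ ^ 2) μ := hh2.integrable_norm_pow (by norm_num)
  have igg : Integrable (fun x => ‖g x‖ ^ 2) μ := hg2.integrable_norm_pow (by norm_num)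
  have iφφ : Integrable (fun x => φ x ^ 2) μ := hφ2.integrable_sq
  have ivv : Integrable (fun x => (u x - 1) ^ 2) μ := hv2.integrable_sq
  have hAexp : ∀ s, A s = A₀ + s * (2 * a₁)
      + s ^ 2 * ∫ x, (‖h x‖ ^ 2 - lam * φ x ^ 2) ∂μ := by
    intro s
    have e : ∀ x, ‖g x + s • h x‖ ^ 2 - lam * (u x - 1 + s * φ x) ^ 2
        = (‖g x‖ ^ 2 - lam * (u x - 1) ^ 2)
          + s * (2 * (inner ℝ (g x) (h x) - lam * ((u x - 1) * φ x)))
          + s ^ 2 * (‖h x‖ ^ 2 - lam * φ x ^ 2) := fun x => by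
      rw [norm_add_sq_real, inner_smul_right, norm_smul, mul_pow, Real.norm_eq_abs, sq_abs]
      ring
    have i1 : Integrable (fun x => ‖g x‖ ^ 2 - lam * (u x - 1) ^ 2) μ := igg.sub (ivv.const_mul _)
    have i2 : Integrable (fun x => (inner ℝ (g x) (h x) : ℝ) - lam * ((u x - 1) * φ x)) μ :=
      igh.sub (ivφ.const_mul _)
    have i3 : Integrable (fun x => ‖h x‖ ^ 2 - lam * φ x ^ 2) μ := ihh.sub (iφφ.const_mul _)
    have i4 : Integrable (fun x => ‖g x‖ ^ 2 - lam * (u x - 1) ^ 2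
        + s * (2 * (inner ℝ (g x) (h x) - lam * ((u x - 1) * φ x)))) μ :=
      i1.add ((i2.const_mul 2).const_mul s)
    simp only [hA, e]
    rw [integral_add i4 (i3.const_mul _),
      integral_add i1 ((i2.const_mul 2).const_mul s), integral_const_mul, integral_const_mul,
      integral_const_mul, integral_sub igh (ivφ.const_mul _), integral_const_mul, hμ, hg, hS,
      hu.mem.2.1]
  have hA'0 : HasDerivAt A (2 * a₁) 0 := by
    have h1 : HasDerivAt (fun s : ℝ => A₀ + s * (2 * a₁)
      + s ^ 2 * ∫ x, (‖h x‖ ^ 2 - lam * φ x ^ 2) ∂μ) (2 * a₁) 0 := by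
      have := (((hasDerivAt_id (0 : ℝ)).mul_const (2 * a₁)).const_add A₀).add
        ((hasDerivAt_pow 2 (0 : ℝ)).mul_const (∫ x, (‖h x‖ ^ 2 - lam * φ x ^ 2) ∂μ))
      exact this.congr_deriv (by simp)
    rwa [show A = _ from funext hAexp]
  have hbm : ∀ s, AEStronglyMeasurable (fun x => u x - 1 + s * φ x) μ := fun s =>
    hv2.1.add (hφm.const_mul s)
  have hvp : Integrable (fun x => (u x - 1) ^ p) μ := hu.integrable_rpow
  have hbint : ∀ s : ℝ, |s| < s₀ → Integrable (fun x => (u x - 1 + s * φ x) ^ p) μ := by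
    intro s hs
    refine (hvp.add (integrable_const ((|V| + m) ^ p))).mono'
      ((hbm s).aemeasurable.pow_const p).aestronglyMeasurable ?_
    filter_upwards [ae_restrict_mem hSm] with x hx
    have hpos := hS_pos s hs x hx
    rw [Real.norm_eq_abs, abs_of_nonneg (Real.rpow_nonneg hpos.le _)]
    have hv : 0 ≤ (u x - 1) ^ p := Real.rpow_nonneg (sub_pos.2 hx.2).le _
    have hV : 0 ≤ (|V| + m) ^ p := by positivity
    by_cases hxK : x ∈ K
    · have := Real.rpow_le_rpow hpos.le (hK_pos s hs x hxK).2 (by linarith : 0 ≤ p)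
      simp only [Pi.add_apply]
      linarith
    · rw [hφ0 x hxK, mul_zero, add_zero]
      simp only [Pi.add_apply]
      linarith
  have hb'0 : Integrable (fun x => p * (u x - 1) ^ (p - 1) * φ x) μ ∧
      HasDerivAt b (∫ x, p * (u x - 1) ^ (p - 1) * φ x ∂μ) 0 := by
    have hder := hasDerivAt_integral_of_dominated_loc_of_deriv_le (μ := μ) (𝕜 := ℝ)
      (F := fun s x => (u x - 1 + s * φ x) ^ p)
      (F' := fun s x => φ x * p * (u x - 1 + s * φ x) ^ (p - 1)) (x₀ := 0)
      (s := Metric.ball 0 s₀) (bound := fun _ => M * p * (|V| + m) ^ (p - 1))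
      (Metric.ball_mem_nhds _ hs₀pos) ?_ ?_ ?_ ?_ (integrable_const _) ?_
    · simp only [zero_mul, add_zero] at hder
      have e : (fun x => φ x * p * (u x - 1) ^ (p - 1)) = fun x => p * (u x - 1) ^ (p - 1) * φ x := by
        funext x; ring
      rwa [e] at hder
    · exact Eventually.of_forall fun s => ((hbm s).aemeasurable.pow_const p).aestronglyMeasurable
    · exact hbint 0 (by simpa using hs₀pos)
    · exact ((hφm.aemeasurable.mul_const p).mul
        ((hbm 0).aemeasurable.pow_const (p - 1))).aestronglyMeasurable
    · refine ae_of_all _ fun x s hs => ?_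
      rw [Metric.mem_ball, dist_zero_right, Real.norm_eq_abs] at hs
      by_cases hxK : x ∈ K
      · obtain ⟨h1, h2⟩ := hK_pos s hs x hxK
        rw [norm_mul, norm_mul, Real.norm_eq_abs, Real.norm_eq_abs, Real.norm_eq_abs,
          abs_of_nonneg (by linarith : 0 ≤ p), abs_of_nonneg (Real.rpow_nonneg h1.le _)]
        gcongr
        · exact hM x
        · linarith
      · rw [hφ0 x hxK, zero_mul, zero_mul, norm_zero]
        have : 0 ≤ p := by linarith
        positivity
    · refine ae_of_all _ fun x s _ => ?_
      have h1 : HasDerivAt (fun s : ℝ => u x - 1 + s * φ x) (φ x) s := by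
        simpa using ((hasDerivAt_id s).mul_const (φ x)).const_add (u x - 1)
      exact h1.rpow_const (Or.inr (by linarith))
  obtain ⟨hb'int, hb'⟩ := hb'0
  set b₁ := ∫ x, (u x - 1) ^ (p - 1) * φ x ∂μ with hb₁
  have hb₁e : ∫ x, p * (u x - 1) ^ (p - 1) * φ x ∂μ = p * b₁ := by
    rw [hb₁, ← integral_const_mul]
    simp only [mul_assoc]
  have hb₁int : Integrable (fun x => (u x - 1) ^ (p - 1) * φ x) μ := by
    have := hb'int.const_mul p⁻¹
    refine this.congr (ae_of_all _ fun x => ?_)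
    have : p ≠ 0 := by linarith
    simp only
    field_simp
  refine ⟨hb₁int, ?_⟩
  -- the reduced energy has a minimum at `0`
  set q : ℝ := ((N : ℝ) - 2) / 2 with hq
  set B : ℝ → ℝ := fun s => κ * b s with hB
  have hB' : HasDerivAt B (κ * (p * b₁)) 0 := by
    rw [← hb₁e]
    exact hb'.const_mul κ
  have hAat : A 0 = A₀ := by rw [hAexp]; simp
  have hBat : B 0 = A₀ := by
    simp only [hB, hb, zero_mul, add_zero]
    rfl
  -- At s = 0 the quotient A / B equals 1, so its q-th power has derivative q (A' - B') / A₀.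
  have hF : HasDerivAt (fun s => A s * (A s / B s) ^ q)
      (2 * a₁ + q * (2 * a₁ - κ * (p * b₁))) 0 := by
    have h1 := hA'0.div hB' (by rw [hBat]; exact hA₀pos.ne')
    have h2 := h1.rpow_const (p := q) (Or.inl (by
      simp only [Pi.div_apply]
      rw [hAat, hBat, div_self hA₀pos.ne']; exact one_ne_zero))
    have h3 := hA'0.mul h2
    refine h3.congr_deriv ?_
    simp only [Pi.div_apply]
    rw [hAat, hBat, div_self hA₀pos.ne', Real.one_rpow, Real.one_rpow]
    field_simp
  -- Minimality is tested with u + s φ, which is off the manifold in general but has positive A and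
  -- B for small s. The two volumes are equal and cancel.
  have hmin : IsLocalMin (fun s => A s * (A s / B s) ^ q) 0 := by
    have e1 : ∀ᶠ s in 𝓝 (0 : ℝ), 0 < A s :=
      hA'0.continuousAt.eventually (lt_mem_nhds (by rw [hAat]; exact hA₀pos))
    have e2 : ∀ᶠ s in 𝓝 (0 : ℝ), 0 < B s :=
      hB'.continuousAt.eventually (lt_mem_nhds (by rw [hBat]; exact hA₀pos))
    filter_upwards [e1, e2, Metric.ball_mem_nhds (0 : ℝ) hs₀pos] with s hs1 hs2 hs
    rw [Metric.mem_ball, dist_zero_right, Real.norm_eq_abs] at hs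
    rw [hAat, hBat, div_self hA₀pos.ne', Real.one_rpow, mul_one]
    have hw := hu.pair.add (hφ.const_mul s)
    have hSs : superOne Ω (fun x => u x + s * φ x) = S := by
      ext x
      constructor
      · rintro ⟨hxΩ, hx⟩
        simp only at hx
        by_cases hxK : x ∈ K
        · exact hKS hxK
        · rw [hφ0 x hxK, mul_zero, add_zero] at hx
          exact ⟨hxΩ, hx⟩
      · intro hx
        refine ⟨hx.1, ?_⟩
        have := hS_pos s hs x hx
        linarith
    have ev : ∀ x, u x + s * φ x - 1 = u x - 1 + s * φ x := fun x => by ring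
    have key := energy_le_of_isMinOn (A := A s) (B := B s) hu.three_le hu.domain.isOpen
      hu.volume_ne_top hu.mem hu.isMinOn hSm hw (hSs ▸ hSm) hSs.le
      (fun x hx => by rw [hh0 x fun hxK => hx.2 (hKS hxK), smul_zero, add_zero])
      (fun x hx => absurd (hSs.symm ▸ hx.1) hx.2)
      (by rw [hSs]; simp only [ev]; exact hbint s hs)
      (by rw [hSs]; simp only [ev]; rfl) (by rw [hSs]; simp only [ev]; rfl) hs1 hs2
    rw [hSs] at key
    have hN0 : (0 : ℝ) < N := by linarith
    have := le_of_add_le_add_right key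
    exact (div_le_div_iff_of_pos_right hN0).1 this
  have hzero := hmin.hasDerivAt_eq_zero hF
  have hpN : p = 2 * N / (N - 2) := rfl
  have hN2 : (N : ℝ) - 2 ≠ 0 := by linarith
  -- These two identities make the vanishing derivative equal to N (a₁ - κ b₁), which is the weak
  -- equation.
  have h1 : q * p = N := by rw [hq, hpN]; field_simp
  have h2 : 1 + q = N / 2 := by rw [hq]; ring
  have h3 : (N : ℝ) * (a₁ - κ * b₁) = 0 := by
    have : (2 * a₁ + q * (2 * a₁ - κ * (p * b₁))) = (1 + q) * (2 * a₁) - (q * p) * κ * b₁ := by ring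
    rw [this, h1, h2] at hzero
    linarith
  have h4 : a₁ = κ * b₁ := by
    rcases mul_eq_zero.1 h3 with h | h
    · linarith
    · linarith
  rw [ha₁] at h4
  linarith

end IsContinuousMinimizer

/-! ### Superharmonicity of u - 1 and the mean value inequality. -/

/-- The constant 1 contributes nothing, because the gradient of a compactly supported function has
integral zero. -/
lemma IsH10Pair.integral_sub_one_smul_gradient {N : ℕ} {Ω : Set (Euc N)} {u ψ : Euc N → ℝ}
    {g : Euc N → Euc N} (hu : IsH10Pair Ω u g) (hψ : IsTestFunction Ω ψ) :
    ∫ x in Ω, (u x - 1) • gradient ψ x = -∫ x in Ω, ψ x • g x := by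
  have i1 : Integrable (fun x => u x • gradient ψ x) (volume.restrict Ω) :=
    memLp_one_iff_integrable.1 ((hψ.memLp_gradient 2 _).smul hu.memLp (r := 1))
  have i2 : Integrable (gradient ψ) (volume.restrict Ω) :=
    memLp_one_iff_integrable.1 (hψ.memLp_gradient 1 _)
  have h1 : ∫ x in Ω, gradient ψ x = 0 := by
    have := hψ.integral_mul_gradient (φ := fun _ => 1) contDiff_const
    rw [setIntegral_eq_integral_of_forall_compl_eq_zero]
    · simpa [gradient_fun_const] using this
    · exact fun x hx => gradient_eq_zero_of_notMem_tsupport fun h => hx (hψ.tsupport_subset h)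
  simp only [sub_smul, one_smul]
  rw [integral_sub i1 i2, h1, sub_zero, hu.isWeakGradient.integral_eq ψ hψ]

lemma hasGradientAt_coord {N : ℕ} (i : Fin N) (a x : Euc N) :
    HasGradientAt (fun y : Euc N => y i - a i) (EuclideanSpace.single i (1 : ℝ)) x := by
  rw [hasGradientAt_iff_hasFDerivAt]
  refine ((EuclideanSpace.proj (𝕜 := ℝ) i).hasFDerivAt.sub_const (a i)).congr_fderiv ?_
  ext y
  simp [EuclideanSpace.inner_single_left]

/-- The (scaled) Laplacian of the radial profile `softRamp (2 - 2 |x - a|² / s²)`. -/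
noncomputable def radialLaplacian {N : ℕ} (a : Euc N) (s : ℝ) (x : Euc N) : ℝ :=
  N * cut a s x - 4 * ‖x - a‖ ^ 2 / s ^ 2
    * deriv Real.smoothTransition (2 - 2 * ‖x - a‖ ^ 2 / s ^ 2)

namespace IsContinuousMinimizer

variable {N : ℕ} {Ω : Set (Euc N)} {lam κ : ℝ} {u ψ : Euc N → ℝ}

lemma sub_one_pos {x : Euc N} (hx : x ∈ superOne Ω u) : 0 < u x - 1 := sub_pos.2 hx.2

/-- Both terms on the right of the Euler-Lagrange equation are nonnegative where u > 1. This is the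
weak superharmonicity behind the mean value inequality. -/
lemma integral_inner_gradient_nonneg (hu : IsContinuousMinimizer Ω lam κ u)
    (hψ : IsTestFunction (superOne Ω u) ψ) (h0 : ∀ x, 0 ≤ ψ x) :
    0 ≤ ∫ x in superOne Ω u, inner ℝ (weakGradient Ω u x) (gradient ψ x) := by
  obtain ⟨M, hM⟩ := hψ.hasCompactSupport.exists_bound_of_continuous hψ.continuous
  have key := (hu.euler_lagrange (IsH10Pair.of_test (hψ.mono superOne_subset))
    hψ.hasCompactSupport hψ.tsupport_subset
    (fun x hx => image_eq_zero_of_notMem_tsupport hx)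
    (fun x hx => gradient_eq_zero_of_notMem_tsupport hx) hM).2
  rw [key]
  refine add_nonneg (mul_nonneg hu.lam_pos.le ?_) (mul_nonneg hu.kappa_pos.le ?_)
  · exact setIntegral_nonneg hu.measurableSet_superOne fun x hx =>
      mul_nonneg (sub_one_pos hx).le (h0 x)
  · exact setIntegral_nonneg hu.measurableSet_superOne fun x hx =>
      mul_nonneg (Real.rpow_nonneg (sub_one_pos hx).le _) (h0 x)

/-- The Euler-Lagrange equation tested with ψ (u - 1); the extra factor raises the exponents to 2
and 2*. It feeds both the Caccioppoli identity and the energy of the competitor in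
`volume_closedBall_le`. -/
lemma integral_inner_mul (hu : IsContinuousMinimizer Ω lam κ u)
    (hψ : IsTestFunction (superOne Ω u) ψ) :
    IntegrableOn (fun x => ψ x * (u x - 1) ^ twoStar N) (superOne Ω u) ∧
    ∫ x in superOne Ω u, inner ℝ (weakGradient Ω u x)
        (ψ x • weakGradient Ω u x + (u x - 1) • gradient ψ x)
      = lam * (∫ x in superOne Ω u, ψ x * (u x - 1) ^ 2)
        + κ * ∫ x in superOne Ω u, ψ x * (u x - 1) ^ twoStar N := by
  obtain ⟨C, hC⟩ := hψ.hasCompactSupport.exists_bound_of_continuous hψ.continuous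
  obtain ⟨m, hm, V, hmV⟩ := hu.exists_bounds hψ.hasCompactSupport hψ.tsupport_subset
  have hC0 : 0 ≤ C := (norm_nonneg _).trans (hC 0)
  have key := hu.euler_lagrange (hu.pair.mul_test (hψ.mono superOne_subset))
    hψ.hasCompactSupport hψ.tsupport_subset
    (fun x hx => by rw [image_eq_zero_of_notMem_tsupport hx, zero_mul])
    (fun x hx => by
      rw [image_eq_zero_of_notMem_tsupport hx, gradient_eq_zero_of_notMem_tsupport hx, zero_smul,
        smul_zero, add_zero]) (M := C * |V|) (fun x => by
      by_cases hx : x ∈ tsupport ψ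
      · rw [abs_mul]
        obtain ⟨h1, h2⟩ := hmV x hx
        refine mul_le_mul (hC x) ?_ (abs_nonneg _) hC0
        rw [abs_of_nonneg (by linarith)]
        exact h2.trans (le_abs_self V)
      · rw [image_eq_zero_of_notMem_tsupport hx, zero_mul, abs_zero]
        positivity)
  have e : ∀ x ∈ superOne Ω u, (u x - 1) ^ (twoStar N - 1) * (ψ x * (u x - 1))
      = ψ x * (u x - 1) ^ twoStar N := fun x hx => by
    have := sub_one_pos hx
    rw [Real.rpow_sub_one this.ne']
    field_simp
  refine ⟨key.1.congr_fun e hu.measurableSet_superOne, ?_⟩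
  rw [key.2, setIntegral_congr_fun hu.measurableSet_superOne e]
  congr 3
  funext x
  ring

/-- `u - 1` is weakly superharmonic in `{u > 1}`: its integral against the radial Laplacian. -/
lemma integral_mul_radialLaplacian_nonneg (hu : IsContinuousMinimizer Ω lam κ u) {a : Euc N} {s : ℝ}
    (hs : 0 < s) (hball : Metric.closedBall a s ⊆ superOne Ω u) :
    0 ≤ ∫ x in Ω, (u x - 1) * radialLaplacian a s x := by
  set g := weakGradient Ω u with hg
  have hballΩ := hball.trans superOne_subset
  have hcut : IsTestFunction Ω (cut a s) := isTestFunction_cut hs hballΩ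
  have hcoord : ∀ i : Fin N, ContDiff ℝ ∞ (fun y : Euc N => y i - a i) := fun i =>
    (EuclideanSpace.proj (𝕜 := ℝ) i).contDiff.sub contDiff_const
  -- `radialLaplacian a s` is the divergence of the field `cut a s x • (x - a)`. Its components are
  -- test functions, so the weak gradient can be moved onto u - 1 coordinate by coordinate.
  have hψ : ∀ i : Fin N, IsTestFunction Ω (fun x => cut a s x * (x i - a i)) := fun i =>
    hcut.mul_smooth (hcoord i)
  have hgr : ∀ (i : Fin N) x, gradient (fun x => cut a s x * (x i - a i)) x
      = cut a s x • EuclideanSpace.single i (1 : ℝ) + (x i - a i) • gradient (cut a s) x :=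
    fun i x => (hasGradientAt_mul (hcut.hasGradientAt x) (hasGradientAt_coord i a x)).gradient
  have hgri : ∀ (i : Fin N) x, gradient (fun x => cut a s x * (x i - a i)) x i
      = cut a s x - 4 * deriv Real.smoothTransition (2 - 2 * ‖x - a‖ ^ 2 / s ^ 2) / s ^ 2
        * (x i - a i) ^ 2 := fun i x => by
    rw [hgr, gradient_cut]
    simp
    ring
  have : IsFiniteMeasure (volume.restrict Ω) := ⟨by simpa using hu.volume_ne_top.lt_top⟩
  have hv : MemLp (fun x => u x - 1) 2 (volume.restrict Ω) := hu.pair.memLp.sub (memLp_const 1)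
  have int1 : ∀ i : Fin N, Integrable
      (fun x => (u x - 1) • gradient (fun x => cut a s x * (x i - a i)) x) (volume.restrict Ω) :=
    fun i => memLp_one_iff_integrable.1 (((hψ i).memLp_gradient 2 _).smul hv (r := 1))
  have int2 : ∀ i : Fin N, Integrable
      (fun x => (cut a s x * (x i - a i)) • g x) (volume.restrict Ω) :=
    fun i => memLp_one_iff_integrable.1 (hu.pair.memLp_grad.smul ((hψ i).memLp 2 _) (r := 1))
  have int1' : ∀ i : Fin N, Integrable
      (fun x => (u x - 1) * gradient (fun x => cut a s x * (x i - a i)) x i) (volume.restrict Ω) :=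
    fun i => (EuclideanSpace.proj (𝕜 := ℝ) i).integrable_comp (int1 i)
  have int2' : ∀ i : Fin N, Integrable
      (fun x => (cut a s x * (x i - a i)) * g x i) (volume.restrict Ω) :=
    fun i => (EuclideanSpace.proj (𝕜 := ℝ) i).integrable_comp (int2 i)
  have hcomp : ∀ i : Fin N,
      ∫ x in Ω, (u x - 1) * gradient (fun x => cut a s x * (x i - a i)) x i
        = -∫ x in Ω, (cut a s x * (x i - a i)) * g x i := fun i => by
    have h1 := congrArg (EuclideanSpace.proj (𝕜 := ℝ) i)
      (hu.pair.integral_sub_one_smul_gradient (hψ i))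
    rw [map_neg, ← ContinuousLinearMap.integral_comp_comm _ (int1 i),
      ← ContinuousLinearMap.integral_comp_comm _ (int2 i)] at h1
    exact h1
  have hsum : ∫ x in Ω, (u x - 1) * radialLaplacian a s x
      = -∫ x in Ω, cut a s x * inner ℝ (g x) (x - a) := by
    have e1 : ∀ x, (u x - 1) * radialLaplacian a s x
        = ∑ i, (u x - 1) * gradient (fun x => cut a s x * (x i - a i)) x i := fun x => by
      simp only [hgri]
      rw [← Finset.mul_sum, Finset.sum_sub_distrib, ← Finset.mul_sum, radialLaplacian,
        EuclideanSpace.norm_sq_eq]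
      simp only [Finset.sum_const, Finset.card_univ, Fintype.card_fin, nsmul_eq_mul,
        Real.norm_eq_abs, sq_abs, PiLp.sub_apply]
      ring
    have e2 : ∀ x, cut a s x * inner ℝ (g x) (x - a)
        = ∑ i, (cut a s x * (x i - a i)) * g x i := fun x => by
      rw [PiLp.inner_apply, Finset.mul_sum]
      refine Finset.sum_congr rfl fun i _ => ?_
      simp
      ring
    simp only [e1, e2]
    rw [integral_finsetSum _ fun i _ => int1' i, integral_finsetSum _ fun i _ => int2' i,
      ← Finset.sum_neg_distrib]
    exact Finset.sum_congr rfl fun i _ => hcomp i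
  -- The same field is -s²/4 times the gradient of this nonnegative radial profile, which is an
  -- admissible test function in {u > 1}. The negative factor fixes the sign of the result.
  have hΦgr : ∀ x, HasGradientAt (fun y => softRamp (2 - 2 * ‖y - a‖ ^ 2 / s ^ 2))
      (-(4 * cut a s x / s ^ 2) • (x - a)) x := fun x =>
    hasGradientAt_radial (hasDerivAt_softRamp _)
  have hΦ0 : ∀ x ∉ Metric.closedBall a s, softRamp (2 - 2 * ‖x - a‖ ^ 2 / s ^ 2) = 0 := by
    intro x hx
    rw [Metric.mem_closedBall, dist_eq_norm, not_le] at hx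
    refine softRamp_of_nonpos ?_
    have : 2 ≤ 2 * ‖x - a‖ ^ 2 / s ^ 2 := by
      rw [le_div_iff₀ (by positivity)]
      nlinarith
    linarith
  have hΦs : tsupport (fun y : Euc N => softRamp (2 - 2 * ‖y - a‖ ^ 2 / s ^ 2))
      ⊆ Metric.closedBall a s :=
    closure_minimal (fun x hx => by
      by_contra h
      exact hx (hΦ0 x h)) Metric.isClosed_closedBall
  have hΦ : IsTestFunction (superOne Ω u) (fun y => softRamp (2 - 2 * ‖y - a‖ ^ 2 / s ^ 2)) :=
    ⟨contDiff_softRamp.comp (contDiff_const.sub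
      ((contDiff_const.mul ((contDiff_id.sub contDiff_const).norm_sq ℝ)).div_const _)),
      (isCompact_closedBall a s).of_isClosed_subset (isClosed_tsupport _) hΦs, hΦs.trans hball⟩
  have hpos := hu.integral_inner_gradient_nonneg hΦ fun x => softRamp_nonneg _
  have e3 : ∀ x, inner ℝ (g x) (gradient (fun y => softRamp (2 - 2 * ‖y - a‖ ^ 2 / s ^ 2)) x)
      = -(4 / s ^ 2) * (cut a s x * inner ℝ (g x) (x - a)) := fun x => by
    rw [(hΦgr x).gradient, inner_smul_right]
    ring
  simp only [← hg, e3] at hpos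
  rw [integral_const_mul] at hpos
  have e4 : ∫ x in superOne Ω u, cut a s x * inner ℝ (g x) (x - a)
      = ∫ x in Ω, cut a s x * inner ℝ (g x) (x - a) := by
    refine (setIntegral_eq_of_subset_of_forall_sdiff_eq_zero hu.domain.isOpen.measurableSet
      superOne_subset fun x hx => ?_).symm
    rw [image_eq_zero_of_notMem_tsupport fun h => hx.2 (hball (tsupport_cut_subset hs h)), zero_mul]
  rw [e4] at hpos
  rw [hsum]
  have h4 : 0 < 4 / s ^ 2 := by positivity
  nlinarith

end IsContinuousMinimizer

lemma continuous_deriv_smoothTransition : Continuous (deriv Real.smoothTransition) :=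
  Real.smoothTransition.contDiff.continuous_deriv (n := 1) le_rfl

/-- Differentiating the rescaled kernel s^{-N} `cut a s` in s yields -s^{-N-1} times the divergence
of `cut a s x • (x - a)`. This turns superharmonicity into monotonicity in the radius. -/
lemma hasDerivAt_cut_radius {N : ℕ} (a x : Euc N) {s : ℝ} (hs : 0 < s) :
    HasDerivAt (fun s => (s ^ N)⁻¹ * cut a s x)
      (-((s ^ N)⁻¹ * s⁻¹) * radialLaplacian a s x) s := by
  have h1 : HasDerivAt (fun s : ℝ => (s ^ N)⁻¹) (-(N * s ^ (N - 1)) / (s ^ N) ^ 2) s :=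
    (hasDerivAt_pow N s).inv (pow_pos hs N).ne'
  have h2 : HasDerivAt (fun s : ℝ => 2 - 2 * ‖x - a‖ ^ 2 / s ^ 2)
      (4 * ‖x - a‖ ^ 2 / s ^ 3) s := by
    have := (((hasDerivAt_pow 2 s).inv (pow_pos hs 2).ne').const_mul (2 * ‖x - a‖ ^ 2)).const_sub 2
    refine (this.congr_deriv ?_)
    field_simp
    norm_num
    ring
  have h3 : HasDerivAt (fun s => cut a s x)
      (deriv Real.smoothTransition (2 - 2 * ‖x - a‖ ^ 2 / s ^ 2) * (4 * ‖x - a‖ ^ 2 / s ^ 3)) s :=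
    ((Real.smoothTransition.contDiff (n := 1)).differentiable
      one_ne_zero _).hasDerivAt.comp s h2
  refine (h1.mul h3).congr_deriv ?_
  have h4 : -((N : ℝ) * s ^ (N - 1)) / (s ^ N) ^ 2 = -(N * (s ^ N)⁻¹ * s⁻¹) := by
    rcases Nat.eq_zero_or_pos N with rfl | hN
    · simp
    · have : s ^ N = s ^ (N - 1) * s := by rw [← pow_succ, Nat.sub_add_cancel hN]
      rw [this]
      field_simp
  rw [h4, radialLaplacian]
  field_simp
  ring

namespace IsContinuousMinimizer

variable {N : ℕ} {Ω : Set (Euc N)} {lam κ : ℝ} {u : Euc N → ℝ}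

/-- The mean value inequality for `u - 1` in `{u > 1}`. -/
lemma setIntegral_closedBall_le (hu : IsContinuousMinimizer Ω lam κ u) {a : Euc N} {R : ℝ}
    (hR : 0 < R) (hball : Metric.closedBall a R ⊆ superOne Ω u) :
    ∫ x in Metric.closedBall a (R / 2), (u x - 1)
      ≤ 2 * volume.real (Metric.ball (0 : Euc N) 1) * R ^ N * (u a - 1) := by
  set K := Metric.closedBall a R with hK
  have hKc : IsCompact K := isCompact_closedBall a R
  have hKm : MeasurableSet K := Metric.isClosed_closedBall.measurableSet
  have hKΩ : K ⊆ Ω := hball.trans superOne_subset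
  have hcont : ContinuousOn (fun x => u x - 1) K :=
    (hu.continuousOn.mono hKΩ).sub continuousOn_const
  have hpos : ∀ x ∈ K, 0 < u x - 1 := fun x hx => sub_one_pos (hball hx)
  have hKfin : IsFiniteMeasure (volume.restrict K) := ⟨by simpa using hKc.measure_lt_top⟩
  obtain ⟨V, hV⟩ := hKc.exists_bound_of_continuousOn hcont
  have hV0 : 0 ≤ V := (norm_nonneg _).trans (hV a (Metric.mem_closedBall_self hR.le))
  have hσ := Real.smoothTransition.continuous
  have hσ' := continuous_deriv_smoothTransition
  have hcutc : ∀ s, Continuous (cut a s) := fun s => contDiff_cut.continuous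
  have hLc : ∀ s, Continuous (radialLaplacian a s) := fun s => by
    have := hcutc s
    unfold radialLaplacian
    fun_prop
  have hint : ∀ f : Euc N → ℝ, Continuous f → IntegrableOn (fun x => (u x - 1) * f x) K :=
    fun f hf => (hcont.mul hf.continuousOn).integrableOn_compact hKc
  -- A smooth substitute for the average of u - 1 over the ball of radius s; it is nonincreasing in
  -- s by superharmonicity.
  set A : ℝ → ℝ := fun s => ∫ x in K, (u x - 1) * ((s ^ N)⁻¹ * cut a s x) with hA
  have hder : ∀ s > 0, HasDerivAt A
      (∫ x in K, (u x - 1) * (-((s ^ N)⁻¹ * s⁻¹) * radialLaplacian a s x)) s := by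
    intro s hs
    have hF'c : ContinuousOn (fun q : ℝ × Euc N =>
        -((q.1 ^ N)⁻¹ * q.1⁻¹) * radialLaplacian a q.1 q.2) (Set.Icc (s / 2) (2 * s) ×ˢ K) := by
      have hne : ∀ q ∈ Set.Icc (s / 2) (2 * s) ×ˢ K, q.1 ≠ 0 := fun q hq => by
        have := hq.1.1
        linarith
      have h1 : ContinuousOn (fun q : ℝ × Euc N => ‖q.2 - a‖ ^ 2 / q.1 ^ 2)
          (Set.Icc (s / 2) (2 * s) ×ˢ K) :=
        ContinuousOn.div (by fun_prop) (by fun_prop) fun q hq => pow_ne_zero 2 (hne q hq)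
      have h2 : ContinuousOn (fun q : ℝ × Euc N => (q.1 ^ N)⁻¹) (Set.Icc (s / 2) (2 * s) ×ˢ K) :=
        ContinuousOn.inv₀ (by fun_prop) fun q hq => pow_ne_zero N (hne q hq)
      have h3 : ContinuousOn (fun q : ℝ × Euc N => q.1⁻¹) (Set.Icc (s / 2) (2 * s) ×ˢ K) :=
        ContinuousOn.inv₀ (by fun_prop) hne
      unfold radialLaplacian cut
      simp only [mul_div_assoc]
      have h4 : ContinuousOn (fun q : ℝ × Euc N => 2 - 2 * (‖q.2 - a‖ ^ 2 / q.1 ^ 2))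
          (Set.Icc (s / 2) (2 * s) ×ˢ K) := continuousOn_const.sub (continuousOn_const.mul h1)
      exact (h2.mul h3).neg.mul ((continuousOn_const.mul (hσ.comp_continuousOn h4)).sub
        ((continuousOn_const.mul h1).mul (hσ'.comp_continuousOn h4)))
    obtain ⟨C, hC⟩ := (isCompact_Icc.prod hKc).exists_bound_of_continuousOn hF'c
    refine (hasDerivAt_integral_of_dominated_loc_of_deriv_le (𝕜 := ℝ)
      (F := fun s x => (u x - 1) * ((s ^ N)⁻¹ * cut a s x))
      (F' := fun s x => (u x - 1) * (-((s ^ N)⁻¹ * s⁻¹) * radialLaplacian a s x))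
      (s := Set.Icc (s / 2) (2 * s)) (bound := fun _ => V * C)
      (Icc_mem_nhds (by linarith) (by linarith)) ?_ ?_ ?_ ?_ (integrable_const _) ?_).2
    · exact Eventually.of_forall fun s => (hint _ (continuous_const.mul (hcutc s))).1
    · exact hint _ (continuous_const.mul (hcutc s))
    · exact (hint _ (continuous_const.mul (hLc s))).1
    · filter_upwards [ae_restrict_mem hKm] with x hx t ht
      rw [norm_mul]
      exact mul_le_mul (hV x hx) (hC (t, x) ⟨ht, hx⟩) (norm_nonneg _) hV0
    · refine ae_of_all _ fun x t ht => ?_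
      have : 0 < t := by have := ht.1; linarith
      exact (hasDerivAt_cut_radius a x this).const_mul _
  have hanti : AntitoneOn A (Set.Ioc 0 R) := by
    refine antitoneOn_of_deriv_nonpos (convex_Ioc 0 R)
      (fun s hs => (hder s hs.1).continuousAt.continuousWithinAt)
      (fun s hs => (hder s (interior_subset hs).1).differentiableAt.differentiableWithinAt) ?_
    intro s hs
    have hs0 : 0 < s := (interior_subset hs).1
    have hsR : s ≤ R := (interior_subset hs).2
    rw [(hder s hs0).deriv]
    have e : ∀ x, (u x - 1) * (-((s ^ N)⁻¹ * s⁻¹) * radialLaplacian a s x)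
        = -((s ^ N)⁻¹ * s⁻¹) * ((u x - 1) * radialLaplacian a s x) := fun x => by ring
    simp only [e]
    rw [integral_const_mul]
    have hL0 : ∀ x ∉ Metric.closedBall a s, radialLaplacian a s x = 0 := by
      intro x hx
      have hcx : cut a s x = 0 :=
        image_eq_zero_of_notMem_tsupport fun h => hx (tsupport_cut_subset hs0 h)
      have hgx : deriv Real.smoothTransition (2 - 2 * ‖x - a‖ ^ 2 / s ^ 2) = 0 := by
        have hneg : 2 - 2 * ‖x - a‖ ^ 2 / s ^ 2 < 0 := by
          rw [Metric.mem_closedBall, dist_eq_norm, not_le] at hx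
          have : 2 < 2 * ‖x - a‖ ^ 2 / s ^ 2 := by
            rw [lt_div_iff₀ (by positivity)]
            nlinarith
          linarith
        have : Real.smoothTransition =ᶠ[𝓝 (2 - 2 * ‖x - a‖ ^ 2 / s ^ 2)] fun _ => 0 := by
          filter_upwards [Iio_mem_nhds hneg] with t ht
          exact Real.smoothTransition.zero_of_nonpos (le_of_lt ht)
        rw [this.deriv_eq, deriv_const]
      rw [radialLaplacian, hcx, hgx]
      simp
    have hsub : Metric.closedBall a s ⊆ K := Metric.closedBall_subset_closedBall hsR
    have hnn : 0 ≤ ∫ x in K, (u x - 1) * radialLaplacian a s x := by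
      rw [← setIntegral_eq_of_subset_of_forall_sdiff_eq_zero hu.domain.isOpen.measurableSet hKΩ]
      · exact hu.integral_mul_radialLaplacian_nonneg hs0 (hsub.trans hball)
      · intro x hx
        rw [hL0 x fun h => hx.2 (hsub h), mul_zero]
    have : 0 ≤ (s ^ N)⁻¹ * s⁻¹ := by positivity
    nlinarith
  -- comparison with a small radius
  have hva : 0 < u a - 1 := hpos a (Metric.mem_closedBall_self hR.le)
  have haS : a ∈ Ω := hKΩ (Metric.mem_closedBall_self hR.le)
  -- Allowing the factor 2 makes one small radius sufficient, in place of the limit s → 0.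
  have hnear : ∀ᶠ x in 𝓝 a, u x - 1 < 2 * (u a - 1) := by
    have h1 : ContinuousAt (fun x => u x - 1) a :=
      (hu.continuousOn.continuousAt (hu.domain.isOpen.mem_nhds haS)).sub continuousAt_const
    exact h1.eventually_lt continuousAt_const (by linarith)
  obtain ⟨δ, hδ, hδn⟩ := Metric.eventually_nhds_iff_ball.1 hnear
  set s := min (δ / 2) R with hs
  have hs0 : 0 < s := lt_min (by linarith) hR
  have hsR : s ≤ R := min_le_right _ _
  have hsδ : s < δ := (min_le_left _ _).trans_lt (by linarith)
  have hvol : volume.real (Metric.closedBall a s) = s ^ N * volume.real (Metric.ball (0 : Euc N) 1) := by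
    have := Measure.addHaar_real_closedBall (volume : Measure (Euc N)) a hs0.le
    rwa [finrank_euclideanSpace_fin] at this
  have hAs : A s ≤ 2 * volume.real (Metric.ball (0 : Euc N) 1) * (u a - 1) := by
    have h1 : A s = ∫ x in Metric.closedBall a s, (u x - 1) * ((s ^ N)⁻¹ * cut a s x) := by
      refine setIntegral_eq_of_subset_of_forall_sdiff_eq_zero hKm
        (Metric.closedBall_subset_closedBall hsR) fun x hx => ?_
      rw [image_eq_zero_of_notMem_tsupport fun h => hx.2 (tsupport_cut_subset hs0 h), mul_zero,
        mul_zero]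
    have h2 : ∫ x in Metric.closedBall a s, (u x - 1) * ((s ^ N)⁻¹ * cut a s x)
        ≤ ∫ x in Metric.closedBall a s, 2 * (u a - 1) * (s ^ N)⁻¹ := by
      refine setIntegral_mono_on ((hint _ (continuous_const.mul (hcutc s))).mono_set
        (Metric.closedBall_subset_closedBall hsR))
        (integrableOn_const (isCompact_closedBall a s).measure_lt_top.ne)
        Metric.isClosed_closedBall.measurableSet fun x hx => ?_
      have hx1 : u x - 1 < 2 * (u a - 1) := hδn x (Metric.closedBall_subset_ball hsδ hx)
      have hx0 : 0 < u x - 1 := hpos x (Metric.closedBall_subset_closedBall hsR hx)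
      have hc1 : cut a s x ≤ 1 := cut_le_one
      have hc0 : 0 ≤ cut a s x := cut_nonneg
      have hi : 0 < (s ^ N)⁻¹ := by positivity
      have : (s ^ N)⁻¹ * cut a s x ≤ (s ^ N)⁻¹ := mul_le_of_le_one_right hi.le hc1
      exact mul_le_mul hx1.le this (by positivity) (by linarith)
    rw [h1]
    refine h2.trans (le_of_eq ?_)
    rw [setIntegral_const, hvol, smul_eq_mul]
    have : s ^ N ≠ 0 := (pow_pos hs0 N).ne'
    field_simp
  have hAR : A R ≤ A s := hanti ⟨hs0, hsR⟩ ⟨hR, le_rfl⟩ hsR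
  have hlow : (R ^ N)⁻¹ * ∫ x in Metric.closedBall a (R / 2), (u x - 1) ≤ A R := by
    rw [← integral_const_mul]
    have hsub : Metric.closedBall a (R / 2) ⊆ K :=
      Metric.closedBall_subset_closedBall (by linarith)
    have h1 : ∫ x in Metric.closedBall a (R / 2), (R ^ N)⁻¹ * (u x - 1)
        = ∫ x in Metric.closedBall a (R / 2), (u x - 1) * ((R ^ N)⁻¹ * cut a R x) := by
      refine setIntegral_congr_fun Metric.isClosed_closedBall.measurableSet fun x hx => ?_
      rw [Metric.mem_closedBall, dist_eq_norm] at hx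
      rw [cut_eq_one hR hx]
      ring
    rw [h1]
    refine setIntegral_mono_set (hint _ (continuous_const.mul (hcutc R))) ?_ hsub.eventuallyLE
    filter_upwards [ae_restrict_mem hKm] with x hx
    have := hpos x hx
    have hc0 : 0 ≤ cut a R x := cut_nonneg
    simp only [Pi.zero_apply]
    positivity
  have hfinal := hlow.trans (hAR.trans hAs)
  have hRN : 0 < R ^ N := pow_pos hR N
  rw [inv_mul_le_iff₀ hRN] at hfinal
  linarith

end IsContinuousMinimizer

/-! ### Hölder and Sobolev inequalities. -/

/-- Hölder's inequality in the form `∫ f ^ a g ^ b ≤ (∫ f) ^ a (∫ g) ^ b` for `a + b = 1`. -/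
lemma integral_rpow_mul_rpow_le {X : Type*} [MeasurableSpace X] {μ : Measure X} {f g : X → ℝ}
    (hf0 : 0 ≤ᵐ[μ] f) (hg0 : 0 ≤ᵐ[μ] g) (hf : Integrable f μ) (hg : Integrable g μ) {a b : ℝ}
    (ha : 0 ≤ a) (hb : 0 ≤ b) (hab : a + b = 1) :
    ∫ x, f x ^ a * g x ^ b ∂μ ≤ (∫ x, f x ∂μ) ^ a * (∫ x, g x ∂μ) ^ b := by
  have h1 : 0 ≤ᵐ[μ] fun x => f x ^ a * g x ^ b := by
    filter_upwards [hf0, hg0] with x hx hy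
    exact mul_nonneg (Real.rpow_nonneg hx _) (Real.rpow_nonneg hy _)
  have hm : AEStronglyMeasurable (fun x => f x ^ a * g x ^ b) μ :=
    ((hf.1.aemeasurable.pow_const a).mul (hg.1.aemeasurable.pow_const b)).aestronglyMeasurable
  rw [integral_eq_lintegral_of_nonneg_ae h1 hm, integral_eq_lintegral_of_nonneg_ae hf0 hf.1,
    integral_eq_lintegral_of_nonneg_ae hg0 hg.1, ENNReal.toReal_rpow, ENNReal.toReal_rpow,
    ← ENNReal.toReal_mul]
  have hff : ∫⁻ x, ENNReal.ofReal (f x) ∂μ ≠ ⊤ := hf.lintegral_lt_top.ne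
  have hgf : ∫⁻ x, ENNReal.ofReal (g x) ∂μ ≠ ⊤ := hg.lintegral_lt_top.ne
  refine ENNReal.toReal_mono (ENNReal.mul_ne_top (ENNReal.rpow_ne_top_of_nonneg ha hff)
    (ENNReal.rpow_ne_top_of_nonneg hb hgf)) ?_
  refine le_trans (le_of_eq (lintegral_congr_ae ?_)) (ENNReal.lintegral_mul_norm_pow_le
    hf.1.aemeasurable.ennreal_ofReal hg.1.aemeasurable.ennreal_ofReal ha hb hab)
  filter_upwards [hf0, hg0] with x hx hy
  rw [ENNReal.ofReal_mul (Real.rpow_nonneg hx _), ENNReal.ofReal_rpow_of_nonneg hx ha,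
    ENNReal.ofReal_rpow_of_nonneg hy hb]

/-- The Sobolev inequality in `H¹₀(Ω)`. -/
lemma exists_sobolev {N : ℕ} (hN : 3 ≤ N) : ∃ C > 0, ∀ {Ω : Set (Euc N)} {w : Euc N → ℝ}
    {h : Euc N → Euc N}, MeasurableSet Ω → IsH10Pair Ω w h →
    (∫ x in Ω, |w x| ^ twoStar N) ^ (2 / twoStar N) ≤ C * ∫ x in Ω, ‖h x‖ ^ 2 := by
  have hN' : (3 : ℝ) ≤ N := by exact_mod_cast hN
  have hp2 := two_lt_twoStar hN
  set p := twoStar N with hp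
  set p' : NNReal := ⟨p, by linarith⟩ with hp'
  set C := eLpNormLESNormFDerivOfEqInnerConst (volume : Measure (Euc N)) ((2 : NNReal) : ℝ) with hC
  refine ⟨(C : ℝ) ^ 2 + 1, by positivity, fun {Ω w h} hΩ hw => ?_⟩
  have hp'0 : (p' : ℝ≥0∞) ≠ 0 := by
    rw [Ne, ENNReal.coe_eq_zero, ← NNReal.coe_eq_zero]
    exact (by linarith : p ≠ 0)
  obtain ⟨φ, hφ, -, h2, hlim⟩ := hw.exists_seq
  have hbound : ∀ n, eLpNorm (φ n) p' (volume.restrict Ω)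
      ≤ C * (eLpNorm (gradient (φ n) - h) 2 (volume.restrict Ω)
        + eLpNorm h 2 (volume.restrict Ω)) := by
    intro n
    have h1 := eLpNorm_le_eLpNorm_fderiv_of_eq_inner (volume : Measure (Euc N))
      ((hφ n).contDiff.of_le (by exact_mod_cast le_top)) (hφ n).hasCompactSupport
      (p := 2) (p' := p') (by norm_num) (by rw [finrank_euclideanSpace_fin]; omega) (by
        rw [finrank_euclideanSpace_fin]
        have := half_sub_inv_twoStar hN
        change p⁻¹ = _
        simp only [one_div] at this
        push_cast
        linarith)
    have e1 : eLpNorm (fderiv ℝ (φ n)) ((2 : NNReal) : ℝ≥0∞) volume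
        = eLpNorm (gradient (φ n)) 2 (volume.restrict Ω) := by
      have : eLpNorm (gradient (φ n)) 2 (volume.restrict Ω) = eLpNorm (gradient (φ n)) 2 volume := by
        rw [← eLpNorm_indicator_eq_eLpNorm_restrict hΩ]
        congr 1
        refine Set.indicator_eq_self.2 fun x hx => ?_
        by_contra hxΩ
        exact hx (gradient_eq_zero_of_notMem_tsupport fun h' => hxΩ ((hφ n).tsupport_subset h'))
      rw [this]
      exact eLpNorm_congr_norm_ae (ae_of_all _ fun x => (norm_gradient _ x).symm)
    rw [e1] at h1
    refine (eLpNorm_mono_measure _ Measure.restrict_le_self).trans (h1.trans ?_)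
    gcongr
    have e2 : gradient (φ n) = (gradient (φ n) - h) + h := by abel
    conv_lhs => rw [e2]
    exact eLpNorm_add_le (((hφ n).memLp_gradient 2 _).sub hw.memLp_grad).1 hw.memLp_grad.1
      (by norm_num)
  -- Membership of w in L^{2*} is not known in advance. It follows by lower semicontinuity of the
  -- norm along the almost everywhere convergent approximation.
  have hsob : eLpNorm w p' (volume.restrict Ω) ≤ C * eLpNorm h 2 (volume.restrict Ω) := by
    refine (Lp.eLpNorm_lim_le_liminf_eLpNorm
      (fun n => (hφ n).continuous.aestronglyMeasurable) w hlim).trans ?_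
    have ht : Tendsto (fun n => C * (eLpNorm (gradient (φ n) - h) 2 (volume.restrict Ω)
        + eLpNorm h 2 (volume.restrict Ω))) atTop
        (𝓝 (C * (0 + eLpNorm h 2 (volume.restrict Ω)))) :=
      ENNReal.Tendsto.const_mul (h2.add tendsto_const_nhds) (Or.inr ENNReal.coe_ne_top)
    rw [zero_add] at ht
    rw [← ht.liminf_eq]
    exact liminf_le_liminf (Eventually.of_forall hbound)
  have hwp : MemLp w p' (volume.restrict Ω) :=
    ⟨hw.memLp.1, hsob.trans_lt (ENNReal.mul_lt_top ENNReal.coe_lt_top hw.memLp_grad.2)⟩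
  rw [hwp.eLpNorm_eq_integral_rpow_norm hp'0 ENNReal.coe_ne_top,
    hw.memLp_grad.eLpNorm_eq_integral_rpow_norm (by norm_num) (by norm_num)] at hsob
  have hI0 : 0 ≤ ∫ x in Ω, |w x| ^ p := integral_nonneg fun x => Real.rpow_nonneg (abs_nonneg _) _
  have hH0 : 0 ≤ ∫ x in Ω, ‖h x‖ ^ 2 := integral_nonneg fun x => by positivity
  have hr : (∫ x in Ω, |w x| ^ p) ^ p⁻¹ ≤ C * (∫ x in Ω, ‖h x‖ ^ 2) ^ (2⁻¹ : ℝ) := by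
    have e : (C : ℝ≥0∞) = ENNReal.ofReal C := (ENNReal.ofReal_coe_nnreal).symm
    rw [e, ← ENNReal.ofReal_mul (NNReal.coe_nonneg _),
      ENNReal.ofReal_le_ofReal_iff (by positivity)] at hsob
    have e3 : (p' : ℝ≥0∞).toReal = p := ENNReal.coe_toReal p'
    rw [e3] at hsob
    simpa [Real.norm_eq_abs] using hsob
  have hsq := pow_le_pow_left₀ (Real.rpow_nonneg hI0 _) hr 2
  rw [mul_pow, ← Real.rpow_natCast, ← Real.rpow_mul hI0, ← Real.rpow_natCast (_ ^ (2⁻¹ : ℝ)),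
    ← Real.rpow_mul hH0] at hsq
  have e1 : p⁻¹ * ((2 : ℕ) : ℝ) = 2 / p := by push_cast; ring
  have e2 : (2⁻¹ : ℝ) * ((2 : ℕ) : ℝ) = 1 := by norm_num
  rw [e1, e2, Real.rpow_one] at hsq
  nlinarith

/-! ### The Caccioppoli identity and the local L^{2*} estimate. -/

lemma hasGradientAt_pow {N : ℕ} {f : Euc N → ℝ} {g x : Euc N} (h : HasGradientAt f g x) (k : ℕ) :
    HasGradientAt (fun y => f y ^ k) ((k * f x ^ (k - 1)) • g) x :=
  hasGradientAt_comp (hasDerivAt_pow k (f x)) h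

lemma IsTestFunction.pow {N : ℕ} {Ω : Set (Euc N)} {φ : Euc N → ℝ} (hφ : IsTestFunction Ω φ)
    {k : ℕ} (hk : k ≠ 0) : IsTestFunction Ω (fun x => φ x ^ k) :=
  hφ.comp (T := fun s => s ^ k) (contDiff_id.pow k) (zero_pow hk)

/-- Absorbing the power on the right-hand side of the interpolated Caccioppoli inequality. -/
lemma rpow_le_of_le_interpolation {N : ℕ} (hN : 3 ≤ N) {F G D : ℝ} (hF : 0 ≤ F) (hG : 0 ≤ G)
    (hD : 0 ≤ D) (h : F ^ (2 / twoStar N) ≤ D * (F ^ (((N : ℝ) - 2) / (N + 2)) * G ^ (4 / ((N : ℝ) + 2)))) :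
    F ^ (2 / twoStar N) ≤ D ^ (((N : ℝ) + 2) / 2) * G ^ 2 := by
  have hN' : (3 : ℝ) ≤ N := by exact_mod_cast hN
  have hp2 := two_lt_twoStar hN
  rcases hF.eq_or_lt with rfl | hFpos
  · rw [Real.zero_rpow (by positivity)]
    positivity
  have hθ : 0 < F ^ (((N : ℝ) - 2) / (N + 2)) := Real.rpow_pos_of_pos hFpos _
  have h1 : F ^ (2 / twoStar N - ((N : ℝ) - 2) / (N + 2)) ≤ D * G ^ (4 / ((N : ℝ) + 2)) := by
    rw [Real.rpow_sub hFpos, div_le_iff₀ hθ]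
    linarith
  have h2 := Real.rpow_le_rpow (Real.rpow_nonneg hF _) h1
    (by positivity : (0 : ℝ) ≤ ((N : ℝ) + 2) / 2)
  rw [← Real.rpow_mul hF, Real.mul_rpow hD (Real.rpow_nonneg hG _), ← Real.rpow_mul hG] at h2
  have e1 : (2 / twoStar N - ((N : ℝ) - 2) / (N + 2)) * (((N : ℝ) + 2) / 2) = 2 / twoStar N := by
    have h0 : (N : ℝ) - 2 ≠ 0 := by linarith
    rw [twoStar]
    field_simp
    ring
  have e2 : 4 / ((N : ℝ) + 2) * (((N : ℝ) + 2) / 2) = ((2 : ℕ) : ℝ) := by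
    push_cast
    field_simp
    norm_num
  rwa [e1, e2, Real.rpow_natCast] at h2

namespace IsContinuousMinimizer

variable {N : ℕ} {Ω : Set (Euc N)} {lam κ : ℝ} {u : Euc N → ℝ}

/-- The Caccioppoli identity. -/
lemma integral_norm_sq_mul (hu : IsContinuousMinimizer Ω lam κ u) {χ : Euc N → ℝ}
    (hχ : IsTestFunction (superOne Ω u) χ) :
    ∫ x in Ω, ‖χ x • weakGradient Ω u x + (u x - 1) • gradient χ x‖ ^ 2
      = lam * (∫ x in superOne Ω u, χ x ^ 2 * (u x - 1) ^ 2)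
        + κ * (∫ x in superOne Ω u, χ x ^ 2 * (u x - 1) ^ twoStar N)
        + ∫ x in superOne Ω u, (u x - 1) ^ 2 * ‖gradient χ x‖ ^ 2 := by
  set S := superOne Ω u with hS
  set g := weakGradient Ω u with hg
  have hχ2 : IsTestFunction S (fun x => χ x ^ 2) := hχ.pow two_ne_zero
  have key := hu.integral_inner_mul hχ2
  have hgr : ∀ x, gradient (fun x => χ x ^ 2) x = (2 * χ x) • gradient χ x := fun x => by
    rw [(hasGradientAt_pow (hχ.hasGradientAt x) 2).gradient]
    simp
  -- The mixed term on the left is exactly the one produced by the gradient of χ², so an identity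
  -- results and no gradient term has to be absorbed.
  have e : ∀ x, ‖χ x • g x + (u x - 1) • gradient χ x‖ ^ 2
      = inner ℝ (g x) (χ x ^ 2 • g x + (u x - 1) • gradient (fun x => χ x ^ 2) x)
        + (u x - 1) ^ 2 * ‖gradient χ x‖ ^ 2 := fun x => by
    rw [hgr, norm_add_sq_real, inner_add_right, inner_smul_right, inner_smul_right,
      inner_smul_right, inner_smul_left, inner_smul_right, norm_smul, norm_smul, mul_pow, mul_pow,
      Real.norm_eq_abs, Real.norm_eq_abs, sq_abs, sq_abs, real_inner_self_eq_norm_sq]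
    simp only [conj_trivial]
    ring
  rw [setIntegral_eq_of_subset_of_forall_sdiff_eq_zero (s := S) hu.domain.isOpen.measurableSet
    superOne_subset]
  · simp only [e]
    have i1 : IntegrableOn (fun x => (inner ℝ (g x)
        (χ x ^ 2 • g x + (u x - 1) • gradient (fun x => χ x ^ 2) x) : ℝ)) S := by
      refine integrable_inner_of_memLp hu.memLp_grad ?_
      exact (hu.pair.mul_test (hχ2.mono superOne_subset)).memLp_grad.mono_measure
        (Measure.restrict_mono superOne_subset le_rfl)
    have i2 : IntegrableOn (fun x => (u x - 1) ^ 2 * ‖gradient χ x‖ ^ 2) S := by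
      obtain ⟨C, hC⟩ := hχ.hasCompactSupport_gradient.exists_bound_of_continuous
        hχ.continuous_gradient
      refine hu.memLp_sub_one.integrable_sq.mul_bdd (c := C ^ 2)
        (hχ.continuous_gradient.norm.pow 2).aestronglyMeasurable (ae_of_all _ fun x => ?_)
      rw [Real.norm_eq_abs, abs_of_nonneg (by positivity)]
      exact pow_le_pow_left₀ (norm_nonneg _) (hC x) 2
    rw [integral_add i1 i2, key.2]
  · intro x hx
    rw [image_eq_zero_of_notMem_tsupport fun h => hx.2 (hχ.tsupport_subset h),
      gradient_eq_zero_of_notMem_tsupport fun h => hx.2 (hχ.tsupport_subset h)]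
    simp

/-- Small balls carry little volume and little critical energy, uniformly in the center. -/
lemma exists_radius_forall_le (hu : IsContinuousMinimizer Ω lam κ u) {ε : ℝ} (hε : 0 < ε) :
    ∃ r₁ > 0, ∀ (a : Euc N) (r : ℝ), 0 < r → r ≤ r₁ → Metric.closedBall a r ⊆ superOne Ω u →
      volume.real (Metric.closedBall a r) ≤ ε ∧
      ∫ x in Metric.closedBall a r, (u x - 1) ^ twoStar N ≤ ε := by
  have hfin : ∫⁻ x in superOne Ω u, ENNReal.ofReal ((u x - 1) ^ twoStar N) ≠ ⊤ :=
    hu.integrable_rpow.lintegral_lt_top.ne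
  -- Absolute continuity of the integral makes the smallness depend on the volume of the ball only,
  -- hence uniform in the center.
  obtain ⟨δ, hδ, hδi⟩ := exists_pos_setLIntegral_lt_of_measure_lt hfin
    (ENNReal.ofReal_pos.2 hε).ne'
  have hlim : Tendsto (fun r : ℝ => volume (Metric.closedBall (0 : Euc N) r)) (𝓝[>] 0) (𝓝 0) := by
    have h1 : Tendsto (fun r : ℝ => ENNReal.ofReal (r ^ N) * volume (Metric.ball (0 : Euc N) 1))
        (𝓝[>] 0) (𝓝 (ENNReal.ofReal (0 ^ N) * volume (Metric.ball (0 : Euc N) 1))) := by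
      refine ENNReal.Tendsto.mul_const (ENNReal.tendsto_ofReal ?_) (Or.inr measure_ball_lt_top.ne)
      exact ((continuous_pow N).tendsto 0).mono_left nhdsWithin_le_nhds
    have hN0 : N ≠ 0 := by have := hu.three_le; omega
    rw [zero_pow hN0, ENNReal.ofReal_zero, zero_mul] at h1
    refine h1.congr' ?_
    filter_upwards [self_mem_nhdsWithin] with r hr
    rw [Measure.addHaar_closedBall _ _ (le_of_lt hr), finrank_euclideanSpace_fin]
  have hmin : 0 < min δ (ENNReal.ofReal ε) := lt_min hδ (ENNReal.ofReal_pos.2 hε)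
  obtain ⟨r₁, hr₁, hr₁v⟩ := ((hlim.eventually (gt_mem_nhds hmin)).and self_mem_nhdsWithin).exists
  refine ⟨r₁, hr₁v, fun a r hr hrr hball => ?_⟩
  have hvol : volume (Metric.closedBall a r) < min δ (ENNReal.ofReal ε) := by
    rw [Measure.addHaar_closedBall_center]
    exact (measure_mono (Metric.closedBall_subset_closedBall hrr)).trans_lt hr₁
  constructor
  · exact ENNReal.toReal_le_of_le_ofReal hε.le (hvol.trans_le (min_le_right _ _)).le
  · have h1 := hδi (Metric.closedBall a r)
      ((Measure.restrict_le_self _).trans_lt (hvol.trans_le (min_le_left _ _)))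
    rw [Measure.restrict_restrict Metric.isClosed_closedBall.measurableSet,
      Set.inter_eq_self_of_subset_left hball] at h1
    rw [integral_eq_lintegral_of_nonneg_ae]
    · exact ENNReal.toReal_le_of_le_ofReal hε.le h1.le
    · filter_upwards [ae_restrict_mem Metric.isClosed_closedBall.measurableSet] with x hx
      exact Real.rpow_nonneg (sub_one_pos (hball hx)).le _
    · exact (hu.integrable_rpow.mono_set hball).1

/-- The local `L^{2*}` bound of `u - 1` by its `L¹` norm on small balls inside `{u > 1}`. -/
lemma exists_local_bound (hu : IsContinuousMinimizer Ω lam κ u) :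
    ∃ C > 0, ∃ r₁ > 0, ∀ (a : Euc N) (r : ℝ), 0 < r → r ≤ r₁ →
      Metric.closedBall a r ⊆ superOne Ω u →
      (∫ x in Metric.closedBall a r, (cut a r x ^ (N + 2) * (u x - 1)) ^ twoStar N)
          ^ (2 / twoStar N)
        ≤ (C / r ^ 2) ^ (((N : ℝ) + 2) / 2) * (∫ x in Metric.closedBall a r, (u x - 1)) ^ 2 := by
  have hN' : (3 : ℝ) ≤ N := by exact_mod_cast hu.three_le
  have hp2 := two_lt_twoStar hu.three_le
  set p := twoStar N with hp
  obtain ⟨CS, hCS, hsob⟩ := exists_sobolev hu.three_le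
  obtain ⟨C₁, hC₁, hgrad⟩ := exists_norm_gradient_cut_le
  set γ := 1 - 2 / p with hγ
  have hγ0 : 0 < γ := by
    rw [hγ, sub_pos, div_lt_one (by linarith)]
    exact hp2
  have hlk : 0 < lam + κ := add_pos hu.lam_pos hu.kappa_pos
  -- ε solves CS (lam + κ) ε^γ = 1/2, where γ is the Hölder exponent complementary to 2/2*. Both
  -- right-hand terms of the equation then amount to at most half of the left-hand side of Sobolev's
  -- inequality.
  obtain ⟨r₁, hr₁, hsmall⟩ := hu.exists_radius_forall_le
    (ε := (1 / (2 * CS * (lam + κ))) ^ (1 / γ)) (by positivity)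
  set ε := (1 / (2 * CS * (lam + κ))) ^ (1 / γ) with hε
  have hεγ : ε ^ γ = 1 / (2 * CS * (lam + κ)) := by
    rw [hε, ← Real.rpow_mul (by positivity), one_div_mul_cancel hγ0.ne', Real.rpow_one]
  set C₂ := 2 * CS * ((N + 2) * C₁) ^ 2 with hC₂
  refine ⟨C₂, by positivity, r₁, hr₁, fun a r hr hrr hball => ?_⟩
  set B := Metric.closedBall a r with hB
  have hBc : IsCompact B := isCompact_closedBall a r
  have hBm : MeasurableSet B := Metric.isClosed_closedBall.measurableSet
  have hBΩ : B ⊆ Ω := hball.trans superOne_subset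
  obtain ⟨hvol, hen⟩ := hsmall a r hr hrr hball
  have hpos : ∀ x ∈ B, 0 < u x - 1 := fun x hx => sub_one_pos (hball hx)
  have hvc : ContinuousOn (fun x => u x - 1) B :=
    (hu.continuousOn.mono hBΩ).sub continuousOn_const
  have hβ : IsTestFunction (superOne Ω u) (cut a r) := isTestFunction_cut hr hball
  have hβc : Continuous (cut a r) := hβ.continuous
  -- With the power N + 2 one has |∇ξ|² ≤ C `cut`^{2N} / r², and `cut`^{2N} v² equals (ξ
  -- v)^{2N/(N+2)} v^{4/(N+2)} exactly, where v = u - 1. This is what Hölder's inequality between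
  -- L^{2*} and L¹ needs in `H3`.
  set ξ : Euc N → ℝ := fun x => cut a r x ^ (N + 2) with hξ
  have hξt : IsTestFunction (superOne Ω u) ξ := hβ.pow (by omega)
  have hξ0 : ∀ x, 0 ≤ ξ x := fun x => pow_nonneg cut_nonneg _
  have hβB : ∀ x ∉ B, cut a r x = 0 := fun x hx =>
    image_eq_zero_of_notMem_tsupport fun h => hx (tsupport_cut_subset hr h)
  have hξB : ∀ x ∉ B, ξ x = 0 := fun x hx => by
    rw [hξ]
    simp only
    rw [hβB x hx, zero_pow (by omega)]
  have hfc : ContinuousOn (fun x => (ξ x * (u x - 1)) ^ p) B :=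
    (hξt.continuous.continuousOn.mul hvc).rpow_const fun x _ => Or.inr (by linarith)
  have hfi : IntegrableOn (fun x => (ξ x * (u x - 1)) ^ p) B := hfc.integrableOn_compact hBc
  have hf0 : 0 ≤ᵐ[volume.restrict B] fun x => (ξ x * (u x - 1)) ^ p := by
    filter_upwards [ae_restrict_mem hBm] with x hx
    exact Real.rpow_nonneg (mul_nonneg (hξ0 x) (hpos x hx).le) _
  set F := ∫ x in B, (ξ x * (u x - 1)) ^ p with hF
  have hF0 : 0 ≤ F := integral_nonneg_of_ae hf0
  set G := ∫ x in B, (u x - 1) with hG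
  have hv0 : 0 ≤ᵐ[volume.restrict B] fun x => u x - 1 := by
    filter_upwards [ae_restrict_mem hBm] with x hx
    exact (hpos x hx).le
  have hG0 : 0 ≤ G := integral_nonneg_of_ae hv0
  have hvi : IntegrableOn (fun x => u x - 1) B := hvc.integrableOn_compact hBc
  -- the powers of the three Hölder inequalities
  have hfpow : ∀ x ∈ B, ((ξ x * (u x - 1)) ^ p) ^ (2 / p) = ξ x ^ 2 * (u x - 1) ^ 2 := by
    intro x hx
    have h0 := mul_nonneg (hξ0 x) (hpos x hx).le
    rw [← Real.rpow_mul h0, mul_div_cancel₀ _ (by linarith : p ≠ 0), Real.rpow_two, mul_pow]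
  have hab : 2 / p + γ = 1 := by rw [hγ]; ring
  have hp20 : 0 ≤ 2 / p := by positivity
  have H1 : ∫ x in B, ξ x ^ 2 * (u x - 1) ^ 2 ≤ F ^ (2 / p) * ε ^ γ := by
    have := integral_rpow_mul_rpow_le hf0 (ae_of_all _ fun _ => zero_le_one) hfi
      (integrableOn_const hBc.measure_lt_top.ne (C := (1 : ℝ))) hp20 hγ0.le hab
    rw [setIntegral_const, smul_eq_mul, mul_one] at this
    refine le_trans (le_of_eq ?_) (this.trans ?_)
    · refine setIntegral_congr_fun hBm fun x hx => ?_
      rw [hfpow x hx, Real.one_rpow, mul_one]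
    · exact mul_le_mul_of_nonneg_left (Real.rpow_le_rpow measureReal_nonneg hvol hγ0.le)
        (Real.rpow_nonneg hF0 _)
  have hvp0 : 0 ≤ᵐ[volume.restrict B] fun x => (u x - 1) ^ p := by
    filter_upwards [ae_restrict_mem hBm] with x hx
    exact Real.rpow_nonneg (hpos x hx).le _
  have H2 : ∫ x in B, ξ x ^ 2 * (u x - 1) ^ p ≤ F ^ (2 / p) * ε ^ γ := by
    have := integral_rpow_mul_rpow_le hf0 hvp0 hfi (hu.integrable_rpow.mono_set hball)
      hp20 hγ0.le hab
    refine le_trans (le_of_eq ?_) (this.trans ?_)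
    · refine setIntegral_congr_fun hBm fun x hx => ?_
      have hv := hpos x hx
      rw [hfpow x hx, ← Real.rpow_mul hv.le, mul_assoc, ← Real.rpow_two, ← Real.rpow_two,
        ← Real.rpow_add hv]
      congr 2
      rw [hγ]
      have : p ≠ 0 := by linarith
      field_simp
      ring
    · exact mul_le_mul_of_nonneg_left
        (Real.rpow_le_rpow (integral_nonneg_of_ae hvp0) hen hγ0.le) (Real.rpow_nonneg hF0 _)
  have H3 : ∫ x in B, cut a r x ^ (2 * N) * (u x - 1) ^ 2
      ≤ F ^ (((N : ℝ) - 2) / (N + 2)) * G ^ (4 / ((N : ℝ) + 2)) := by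
    have hθ0 : 0 ≤ ((N : ℝ) - 2) / (N + 2) := div_nonneg (by linarith) (by linarith)
    have := integral_rpow_mul_rpow_le hf0 hv0 hfi hvi hθ0
      (by positivity : (0 : ℝ) ≤ 4 / ((N : ℝ) + 2)) (by field_simp; ring)
    refine le_trans (le_of_eq ?_) this
    refine setIntegral_congr_fun hBm fun x hx => ?_
    have hv := hpos x hx
    have hc0 : 0 ≤ cut a r x := cut_nonneg
    have hpN : p * (((N : ℝ) - 2) / (N + 2)) = 2 * N / (N + 2) := by
      have h0 : (N : ℝ) - 2 ≠ 0 := by linarith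
      rw [hp, twoStar]
      field_simp
    rw [← Real.rpow_mul (mul_nonneg (hξ0 x) hv.le), hpN, Real.mul_rpow (hξ0 x) hv.le, mul_assoc,
      ← Real.rpow_add hv, hξ]
    simp only
    rw [← Real.rpow_natCast (cut a r x) (N + 2), ← Real.rpow_mul hc0, ← Real.rpow_natCast _ (2 * N),
      ← Real.rpow_two]
    congr 2
    · push_cast
      field_simp
    · field_simp
      ring
  have hSB : ∀ f : Euc N → ℝ, (∀ x ∉ B, f x = 0) → ∫ x in superOne Ω u, f x = ∫ x in B, f x :=
    fun f hf => setIntegral_eq_of_subset_of_forall_sdiff_eq_zero hu.measurableSet_superOne hball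
      fun x hx => hf x hx.2
  have hgξ : ∀ x, ‖gradient ξ x‖ ^ 2 ≤ ((N + 2) * C₁) ^ 2 / r ^ 2 * cut a r x ^ (2 * N) := by
    intro x
    have hc0 : 0 ≤ cut a r x := cut_nonneg
    have hc1 : cut a r x ≤ 1 := cut_le_one
    rw [(hasGradientAt_pow (hβ.hasGradientAt x) (N + 2)).gradient, norm_smul, mul_pow, norm_mul,
      mul_pow]
    have h1 : ‖gradient (cut a r) x‖ ^ 2 ≤ (C₁ / r) ^ 2 :=
      pow_le_pow_left₀ (norm_nonneg _) (hgrad a hr x) 2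
    have h2 : ‖cut a r x ^ (N + 2 - 1)‖ ^ 2 ≤ cut a r x ^ (2 * N) := by
      rw [Real.norm_eq_abs, sq_abs, ← pow_mul]
      exact pow_le_pow_of_le_one hc0 hc1 (by omega)
    have h3 : ‖((N + 2 : ℕ) : ℝ)‖ ^ 2 = ((N : ℝ) + 2) ^ 2 := by
      rw [Real.norm_eq_abs, sq_abs]
      push_cast
      ring
    rw [h3]
    calc ((N : ℝ) + 2) ^ 2 * ‖cut a r x ^ (N + 2 - 1)‖ ^ 2 * ‖gradient (cut a r) x‖ ^ 2
        ≤ ((N : ℝ) + 2) ^ 2 * cut a r x ^ (2 * N) * (C₁ / r) ^ 2 := by gcongr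
      _ = ((N + 2) * C₁) ^ 2 / r ^ 2 * cut a r x ^ (2 * N) := by ring
  have H4 : ∫ x in B, (u x - 1) ^ 2 * ‖gradient ξ x‖ ^ 2
      ≤ ((N + 2) * C₁) ^ 2 / r ^ 2 * ∫ x in B, cut a r x ^ (2 * N) * (u x - 1) ^ 2 := by
    rw [← integral_const_mul]
    refine setIntegral_mono_on ?_ ?_ hBm fun x _ => ?_
    · exact ((hvc.pow 2).mul (hξt.continuous_gradient.norm.pow 2).continuousOn).integrableOn_compact
        hBc
    · exact (((hβc.pow (2 * N)).continuousOn.mul (hvc.pow 2)).integrableOn_compact hBc).const_mul _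
    · have := mul_le_mul_of_nonneg_left (hgξ x) (sq_nonneg (u x - 1))
      linarith
  have hsobB := hsob hu.domain.isOpen.measurableSet (hu.pair.mul_test (hξt.mono superOne_subset))
  have hFe : ∫ x in Ω, |ξ x * (u x - 1)| ^ p = F := by
    rw [setIntegral_eq_of_subset_of_forall_sdiff_eq_zero (s := B) hu.domain.isOpen.measurableSet hBΩ]
    · refine setIntegral_congr_fun hBm fun x hx => ?_
      rw [abs_of_nonneg (mul_nonneg (hξ0 x) (hpos x hx).le)]
    · intro x hx
      rw [hξB x hx.2, zero_mul, abs_zero, Real.zero_rpow (by linarith)]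
  rw [hFe, hu.integral_norm_sq_mul hξt, hSB _ fun x hx => by rw [hξB x hx]; ring,
    hSB _ fun x hx => by rw [hξB x hx]; ring,
    hSB _ fun x hx => by
      rw [gradient_eq_zero_of_notMem_tsupport fun h => hx (closure_minimal (fun y hy => by
        by_contra hyB
        exact hy (hξB y hyB)) Metric.isClosed_closedBall h)]
      simp] at hsobB
  set X := F ^ (2 / p) with hX
  have hX0 : 0 ≤ X := Real.rpow_nonneg hF0 _
  have habs : CS * (lam * (X * ε ^ γ) + κ * (X * ε ^ γ)) = X / 2 := by
    rw [hεγ]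
    field_simp
  have hmain : X ≤ C₂ / r ^ 2 * (F ^ (((N : ℝ) - 2) / (N + 2)) * G ^ (4 / ((N : ℝ) + 2))) := by
    have s1 := mul_le_mul_of_nonneg_left H1 hu.lam_pos.le
    have s2 := mul_le_mul_of_nonneg_left H2 hu.kappa_pos.le
    have s3 := H4.trans (mul_le_mul_of_nonneg_left H3
      (by positivity : 0 ≤ (((N : ℝ) + 2) * C₁) ^ 2 / r ^ 2))
    have s4 := mul_le_mul_of_nonneg_left (add_le_add (add_le_add s1 s2) s3) hCS.le
    have s5 := hsobB.trans s4
    rw [mul_add, habs] at s5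
    have e : C₂ / r ^ 2 * (F ^ (((N : ℝ) - 2) / (N + 2)) * G ^ (4 / ((N : ℝ) + 2)))
        = 2 * (CS * ((((N : ℝ) + 2) * C₁) ^ 2 / r ^ 2
          * (F ^ (((N : ℝ) - 2) / (N + 2)) * G ^ (4 / ((N : ℝ) + 2))))) := by
      rw [hC₂]; ring
    rw [e]
    linarith
  exact rpow_le_of_le_interpolation hu.three_le hF0 hG0 (by positivity) hmain

end IsContinuousMinimizer

/-! ### Energy comparison after removing a ball. -/

/-- The left-hand side is the largest reduced energy compatible with A ≤ A₀ + y and B ≥ A₀ - y. It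
is differentiable at y = 0 with value A₀ there, so it exceeds A₀ at most linearly; η < A₀ keeps the
denominator positive. -/
lemma exists_reduced_energy_le {A₀ : ℝ} (hA₀ : 0 < A₀) (q : ℝ) : ∃ η > 0, η < A₀ ∧ ∃ L > 0,
    ∀ y, 0 ≤ y → y ≤ η → (A₀ + y) * ((A₀ + y) / (A₀ - y)) ^ q ≤ A₀ + L * y := by
  have hd : DifferentiableAt ℝ (fun y : ℝ => (A₀ + y) * ((A₀ + y) / (A₀ - y)) ^ q) 0 := by
    have h1 : DifferentiableAt ℝ (fun y : ℝ => A₀ + y) 0 := by fun_prop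
    have h2 : DifferentiableAt ℝ (fun y : ℝ => A₀ - y) 0 := by fun_prop
    refine h1.mul ((h1.div h2 (by simpa using hA₀.ne')).rpow_const (Or.inl ?_))
    simp [hA₀.ne']
  obtain ⟨L, hL, hO⟩ := hd.isBigO_sub.exists_pos
  obtain ⟨δ, hδ, hb⟩ := Metric.eventually_nhds_iff_ball.1 hO.bound
  refine ⟨min (δ / 2) (A₀ / 2), by positivity, (min_le_right _ _).trans_lt (by linarith), L, hL,
    fun y hy hyη => ?_⟩
  have h := hb y (by
    rw [Metric.mem_ball, dist_zero_right, Real.norm_eq_abs, abs_of_nonneg hy]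
    exact (hyη.trans (min_le_left _ _)).trans_lt (by linarith))
  simp only [add_zero, sub_zero, div_self hA₀.ne', Real.one_rpow, mul_one, Real.norm_eq_abs,
    abs_of_nonneg hy] at h
  linarith [le_abs_self ((A₀ + y) * ((A₀ + y) / (A₀ - y)) ^ q - A₀)]

namespace IsContinuousMinimizer

variable {N : ℕ} {Ω : Set (Euc N)} {lam κ : ℝ} {u : Euc N → ℝ}

/-- Removing a ball from `{u > 1}` cannot lower the energy. -/
lemma volume_closedBall_le (hu : IsContinuousMinimizer Ω lam κ u) {a : Euc N} {ρ A₀ y : ℝ}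
    (hρ : 0 < ρ) (hball : Metric.closedBall a ρ ⊆ superOne Ω u)
    (hA₀ : A₀ = κ * ∫ x in superOne Ω u, (u x - 1) ^ twoStar N)
    (hP : κ * ∫ x in Metric.closedBall a ρ, (u x - 1) ^ twoStar N ≤ y)
    (hD : ∫ x in superOne Ω u, (u x - 1) ^ 2 * ‖gradient (cut a ρ) x‖ ^ 2 ≤ y) (hy : y < A₀) :
    volume.real (Metric.closedBall a (ρ / 2))
      ≤ ((A₀ + y) * ((A₀ + y) / (A₀ - y)) ^ (((N : ℝ) - 2) / 2) - A₀) / N := by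
  have hfinm := hu.isFiniteMeasure_restrict
  have hN' : (3 : ℝ) ≤ N := by exact_mod_cast hu.three_le
  have hp2 := two_lt_twoStar hu.three_le
  have hSm := hu.measurableSet_superOne
  set S := superOne Ω u with hS
  set g := weakGradient Ω u with hg
  set p := twoStar N with hp
  set χ := cut a ρ with hχ
  have hχt : IsTestFunction S χ := isTestFunction_cut hρ hball
  have hχ0 : ∀ x, 0 ≤ χ x := fun x => cut_nonneg
  have hχ1 : ∀ x, χ x ≤ 1 := fun x => cut_le_one
  have hχB : ∀ x ∉ Metric.closedBall a ρ, χ x = 0 := fun x hx =>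
    image_eq_zero_of_notMem_tsupport fun h => hx (tsupport_cut_subset hρ h)
  have hχc : Continuous χ := hχt.continuous
  have hBm : MeasurableSet (Metric.closedBall a ρ) := Metric.isClosed_closedBall.measurableSet
  have hpair := hu.pair.mul_test (hχt.mono superOne_subset)
  have hw := hu.pair.add (hpair.const_mul (-1))
  -- Here w - 1 = (1 - χ)(u - 1), so w equals 1 on the ball of radius ρ/2 and u outside the ball of
  -- radius ρ.
  set w : Euc N → ℝ := fun x => u x + -1 * (χ x * (u x - 1)) with hwdef
  set h : Euc N → Euc N := fun x => g x + (-1 : ℝ) • (χ x • g x + (u x - 1) • gradient χ x)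
    with hhdef
  have hw1 : ∀ x, w x - 1 = (1 - χ x) * (u x - 1) := fun x => by rw [hwdef]; ring
  have hSw : superOne Ω w = S ∩ {x | χ x < 1} := by
    ext x
    constructor
    · rintro ⟨hxΩ, hx⟩
      have h1 : 0 < (1 - χ x) * (u x - 1) := by rw [← hw1]; linarith
      have h2 : 0 < 1 - χ x := by
        rcases (sub_nonneg.2 (hχ1 x)).eq_or_lt with h | h
        · rw [← h, zero_mul] at h1
          exact absurd h1 (lt_irrefl _)
        · exact h
      have h3 : 0 < u x - 1 := pos_of_mul_pos_right h1 h2.le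
      exact ⟨⟨hxΩ, by linarith⟩, sub_pos.1 h2⟩
    · rintro ⟨hxS, hx⟩
      refine ⟨hxS.1, ?_⟩
      have h1 : 0 < (1 - χ x) * (u x - 1) := mul_pos (sub_pos.2 hx) (sub_one_pos hxS)
      rw [← hw1] at h1
      linarith
  have hSwm : MeasurableSet (superOne Ω w) := by
    rw [hSw]
    exact hSm.inter (measurableSet_lt hχc.measurable measurable_const)
  have hsub : superOne Ω w ⊆ S := hSw ▸ Set.inter_subset_left
  have hone : ∀ x ∈ S \ superOne Ω w, χ x = 1 := fun x hx => by
    refine le_antisymm (hχ1 x) (not_lt.1 fun hlt => hx.2 ?_)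
    rw [hSw]
    exact ⟨hx.1, hlt⟩
  -- Where χ = 1 it attains its maximum, so its gradient vanishes and the gradient of w vanishes
  -- too.
  have hzero : ∀ x ∈ S \ superOne Ω w, h x = 0 := fun x hx => by
    have h1 := hone x hx
    have hmax : IsLocalMax χ x := Eventually.of_forall fun z => by rw [h1]; exact hχ1 z
    have hgr : gradient χ x = 0 := by simp [gradient, hmax.fderiv_eq_zero]
    rw [hhdef]
    simp only
    rw [h1, hgr, smul_zero, one_smul, add_zero, neg_one_smul, add_neg_cancel]
  have hout : ∀ x ∈ Ω \ S, h x = g x := fun x hx => by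
    have h1 : x ∉ tsupport χ := fun h => hx.2 (hχt.tsupport_subset h)
    rw [hhdef]
    simp only
    rw [image_eq_zero_of_notMem_tsupport h1, gradient_eq_zero_of_notMem_tsupport h1]
    simp
  -- the critical term
  have hvp := hu.integrable_rpow
  have hpos : ∀ x ∈ S, 0 < u x - 1 := fun x hx => sub_one_pos hx
  have hwpow : ∀ x ∈ S, (w x - 1) ^ p = (1 - χ x) ^ p * (u x - 1) ^ p := fun x hx => by
    rw [hw1, Real.mul_rpow (sub_nonneg.2 (hχ1 x)) (hpos x hx).le]
  have hχp : Continuous fun x => (1 - χ x) ^ p :=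
    (continuous_const.sub hχc).rpow_const fun x => Or.inr (by linarith)
  have hχp1 : ∀ x, ‖(1 - χ x) ^ p‖ ≤ 1 := fun x => by
    rw [Real.norm_eq_abs, abs_of_nonneg (Real.rpow_nonneg (sub_nonneg.2 (hχ1 x)) _)]
    exact Real.rpow_le_one (sub_nonneg.2 (hχ1 x)) (by linarith [hχ0 x]) (by linarith)
  have hint : IntegrableOn (fun x => (w x - 1) ^ p) S := by
    have : IntegrableOn (fun x => (1 - χ x) ^ p * (u x - 1) ^ p) S :=
      hvp.bdd_mul (c := 1) hχp.aestronglyMeasurable (ae_of_all _ hχp1)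
    exact this.congr_fun (fun x hx => (hwpow x hx).symm) hSm
  have hBeq : ∫ x in superOne Ω w, (w x - 1) ^ p = ∫ x in S, (w x - 1) ^ p :=
    (setIntegral_eq_of_subset_of_forall_sdiff_eq_zero hSm hsub fun x hx => by
      rw [hw1, hone x hx, sub_self, zero_mul, Real.zero_rpow (by linarith)]).symm
  have hBlow : (∫ x in S, (u x - 1) ^ p) - ∫ x in Metric.closedBall a ρ, (u x - 1) ^ p
      ≤ ∫ x in S, (w x - 1) ^ p := by
    rw [← setIntegral_sdiff hBm hvp hball]
    have e : ∫ x in S \ Metric.closedBall a ρ, (u x - 1) ^ p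
        = ∫ x in S \ Metric.closedBall a ρ, (w x - 1) ^ p :=
      setIntegral_congr_fun (hSm.diff hBm) fun x hx => by
        rw [hw1, hχB x hx.2, sub_zero, one_mul]
    rw [e]
    refine setIntegral_mono_set hint ?_ (ae_of_all _ Set.sdiff_subset)
    filter_upwards [ae_restrict_mem hSm] with x hx
    rw [Pi.zero_apply, hwpow x hx]
    exact mul_nonneg (Real.rpow_nonneg (sub_nonneg.2 (hχ1 x)) _)
      (Real.rpow_nonneg (hpos x hx).le _)
  -- the quadratic term
  set k : Euc N → Euc N := fun x => χ x • g x + (u x - 1) • gradient χ x with hk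
  have hg2 : MemLp g 2 (volume.restrict S) := hu.memLp_grad
  have hk2 : MemLp k 2 (volume.restrict S) :=
    hpair.memLp_grad.mono_measure (Measure.restrict_mono superOne_subset le_rfl)
  have hv2 : MemLp (fun x => u x - 1) 2 (volume.restrict S) := hu.memLp_sub_one
  have ivv : IntegrableOn (fun x => (u x - 1) ^ 2) S := hv2.integrable_sq
  have hbχ : ∀ x, ‖χ x‖ ≤ 1 := fun x => by
    rw [Real.norm_eq_abs, abs_of_nonneg (hχ0 x)]
    exact hχ1 x
  have hbχ2 : ∀ x, ‖χ x ^ 2‖ ≤ 1 := fun x => by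
    rw [norm_pow]
    exact pow_le_one₀ (norm_nonneg _) (hbχ x)
  have hχm : AEStronglyMeasurable χ (volume.restrict S) := hχc.aestronglyMeasurable
  have hχ2m : AEStronglyMeasurable (fun x => χ x ^ 2) (volume.restrict S) :=
    (hχc.pow 2).aestronglyMeasurable
  have j1 : IntegrableOn (fun x => χ x * (u x - 1) ^ 2) S :=
    ivv.bdd_mul (c := 1) hχm (ae_of_all _ hbχ)
  have j2 : IntegrableOn (fun x => χ x ^ 2 * (u x - 1) ^ 2) S :=
    ivv.bdd_mul (c := 1) hχ2m (ae_of_all _ hbχ2)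
  have j3 : IntegrableOn (fun x => χ x * (u x - 1) ^ p) S :=
    hvp.bdd_mul (c := 1) hχm (ae_of_all _ hbχ)
  have j4 : IntegrableOn (fun x => χ x ^ 2 * (u x - 1) ^ p) S :=
    hvp.bdd_mul (c := 1) hχ2m (ae_of_all _ hbχ2)
  have igk : IntegrableOn (fun x => (inner ℝ (g x) (k x) : ℝ)) S := integrable_inner_of_memLp hg2 hk2
  have ikk : IntegrableOn (fun x => ‖k x‖ ^ 2) S := hk2.integrable_norm_pow (by norm_num)
  have i0 : IntegrableOn (fun x => ‖g x‖ ^ 2 - lam * (u x - 1) ^ 2) S :=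
    (hg2.integrable_norm_pow (by norm_num)).sub (ivv.const_mul _)
  have hkS : ∫ x in Ω, ‖k x‖ ^ 2 = ∫ x in S, ‖k x‖ ^ 2 :=
    setIntegral_eq_of_subset_of_forall_sdiff_eq_zero hu.domain.isOpen.measurableSet
      superOne_subset fun x hx => by
        have h1 : x ∉ tsupport χ := fun h => hx.2 (hχt.tsupport_subset h)
        rw [hk]
        simp only
        rw [image_eq_zero_of_notMem_tsupport h1, gradient_eq_zero_of_notMem_tsupport h1]
        simp
  have hkk := hu.integral_norm_sq_mul hχt
  rw [hkS] at hkk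
  have hgk := (hu.integral_inner_mul hχt).2
  set A := ∫ x in superOne Ω w, (‖h x‖ ^ 2 - lam * (w x - 1) ^ 2) with hA
  have hAS : A = ∫ x in S, (‖h x‖ ^ 2 - lam * (w x - 1) ^ 2) :=
    (setIntegral_eq_of_subset_of_forall_sdiff_eq_zero hSm hsub fun x hx => by
      rw [hw1, hone x hx, hzero x hx]; simp).symm
  -- The equation tested with χ (u - 1), combined with the Caccioppoli identity, cancels all
  -- Dirichlet and lam terms. What remains is supported in the ball: a critical integral and the
  -- cutoff error.
  have hAexp : A = A₀ - κ * ((2 * ∫ x in S, χ x * (u x - 1) ^ p)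
      - ∫ x in S, χ x ^ 2 * (u x - 1) ^ p)
      + ∫ x in S, (u x - 1) ^ 2 * ‖gradient χ x‖ ^ 2 := by
    have e : ∀ x, ‖h x‖ ^ 2 - lam * (w x - 1) ^ 2
        = (‖g x‖ ^ 2 - lam * (u x - 1) ^ 2) + ((‖k x‖ ^ 2 - 2 * inner ℝ (g x) (k x))
          + lam * (2 * (χ x * (u x - 1) ^ 2) - χ x ^ 2 * (u x - 1) ^ 2)) := fun x => by
      have : h x = g x - k x := by
        rw [hhdef, hk]
        simp only
        rw [neg_one_smul]
        exact (sub_eq_add_neg _ _).symm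
      rw [this, hw1, norm_sub_sq_real]
      ring
    have i1 : IntegrableOn (fun x => ‖k x‖ ^ 2 - 2 * (inner ℝ (g x) (k x) : ℝ)) S :=
      ikk.sub (igk.const_mul 2)
    have i2 : IntegrableOn (fun x => lam * (2 * (χ x * (u x - 1) ^ 2) - χ x ^ 2 * (u x - 1) ^ 2)) S :=
      ((j1.const_mul 2).sub j2).const_mul lam
    have i3 : IntegrableOn (fun x => (‖k x‖ ^ 2 - 2 * (inner ℝ (g x) (k x) : ℝ))
      + lam * (2 * (χ x * (u x - 1) ^ 2) - χ x ^ 2 * (u x - 1) ^ 2)) S := i1.add i2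
    rw [hAS]
    simp only [e]
    rw [integral_add i0 i3, integral_add i1 i2, integral_sub ikk (igk.const_mul 2),
      integral_const_mul, integral_const_mul, integral_sub (j1.const_mul 2) j2, integral_const_mul,
      hgk, hkk, hg, hu.mem.2.1, hA₀]
    ring
  have hβ : (2 * ∫ x in S, χ x * (u x - 1) ^ p) - ∫ x in S, χ x ^ 2 * (u x - 1) ^ p
      = ∫ x in Metric.closedBall a ρ, (2 * χ x - χ x ^ 2) * (u x - 1) ^ p := by
    rw [← integral_const_mul, ← integral_sub (j3.const_mul 2) j4,
      ← setIntegral_eq_of_subset_of_forall_sdiff_eq_zero hSm hball fun x hx => by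
        rw [hχB x hx.2]; ring]
    refine setIntegral_congr_fun hSm fun x _ => ?_
    ring
  -- The weight 2χ - χ² = 1 - (1 - χ)² lies in [0, 1], which gives this bound and the next one.
  have hβ0 : 0 ≤ (2 * ∫ x in S, χ x * (u x - 1) ^ p) - ∫ x in S, χ x ^ 2 * (u x - 1) ^ p := by
    rw [hβ]
    refine setIntegral_nonneg hBm fun x hx => mul_nonneg ?_ (Real.rpow_nonneg (hpos x (hball hx)).le _)
    nlinarith [hχ0 x, hχ1 x]
  have hβ1 : (2 * ∫ x in S, χ x * (u x - 1) ^ p) - ∫ x in S, χ x ^ 2 * (u x - 1) ^ p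
      ≤ ∫ x in Metric.closedBall a ρ, (u x - 1) ^ p := by
    have j5 : IntegrableOn (fun x => 2 * (χ x * (u x - 1) ^ p) - χ x ^ 2 * (u x - 1) ^ p) S :=
      (j3.const_mul 2).sub j4
    rw [hβ]
    refine setIntegral_mono_on ?_ (hvp.mono_set hball) hBm fun x hx => ?_
    · refine (j5.mono_set hball).congr_fun (fun x _ => ?_) hBm
      ring
    · refine mul_le_of_le_one_left (Real.rpow_nonneg (hpos x (hball hx)).le _) ?_
      nlinarith [sq_nonneg (1 - χ x)]
  have hκ := hu.kappa_pos
  have hD0 : 0 ≤ ∫ x in S, (u x - 1) ^ 2 * ‖gradient χ x‖ ^ 2 :=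
    integral_nonneg fun x => by positivity
  have hy0 : 0 ≤ y := hD0.trans hD
  have hA1 : A ≤ A₀ + y := by
    rw [hAexp]
    linarith [mul_nonneg hκ.le hβ0]
  have hA2 : A₀ - y ≤ A := by
    rw [hAexp]
    linarith [mul_le_mul_of_nonneg_left hβ1 hκ.le]
  set B := κ * ∫ x in superOne Ω w, (w x - 1) ^ p with hBdef
  have hB2 : A₀ - y ≤ B := by
    rw [hBdef, hBeq, hA₀]
    linarith [mul_le_mul_of_nonneg_left hBlow hκ.le]
  have hApos : 0 < A := by linarith
  have hBpos : 0 < B := by linarith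
  have key := energy_le_of_isMinOn hu.three_le hu.domain.isOpen hu.volume_ne_top hu.mem hu.isMinOn
    hSm hw hSwm hsub hout hzero (hint.mono_set hsub) hA hBdef hApos hBpos
  rw [← hS, ← hp, ← hA₀] at key
  have hsm : Metric.closedBall a (ρ / 2) ⊆ S \ superOne Ω w := fun x hx => by
    refine ⟨hball (Metric.closedBall_subset_closedBall (by linarith) hx), fun hxw => ?_⟩
    rw [hSw] at hxw
    rw [Metric.mem_closedBall, dist_eq_norm] at hx
    exact absurd hxw.2 (not_lt.2 (cut_eq_one hρ hx).ge)
  have hSfin : volume S ≠ ⊤ := ((measure_mono superOne_subset).trans_lt hu.volume_ne_top.lt_top).ne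
  have hvol : volume.real (Metric.closedBall a (ρ / 2)) ≤ volume.real S - volume.real (superOne Ω w) := by
    rw [← measureReal_sdiff hsub hSwm hSfin]
    exact measureReal_mono hsm ((measure_mono Set.sdiff_subset).trans_lt hSfin.lt_top).ne
  have hq : 0 ≤ ((N : ℝ) - 2) / 2 := by linarith
  have hmono : A * (A / B) ^ (((N : ℝ) - 2) / 2)
      ≤ (A₀ + y) * ((A₀ + y) / (A₀ - y)) ^ (((N : ℝ) - 2) / 2) := by
    have hy' : 0 < A₀ - y := sub_pos.2 hy
    refine mul_le_mul hA1 (Real.rpow_le_rpow (by positivity) ?_ hq) (by positivity) (by linarith)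
    exact div_le_div₀ (by linarith) hA1 hy' hB2
  have hN0 : (0 : ℝ) < N := by linarith
  have hfinal := div_le_div_of_nonneg_right hmono hN0.le
  rw [sub_div]
  linarith

end IsContinuousMinimizer

/-! ### Linear growth and nondegeneracy. -/

lemma volume_real_ball_one_pos {N : ℕ} : 0 < volume.real (Metric.ball (0 : Euc N) 1) :=
  ENNReal.toReal_pos (Metric.measure_ball_pos volume 0 one_pos).ne' measure_ball_lt_top.ne

namespace IsContinuousMinimizer

variable {N : ℕ} {Ω : Set (Euc N)} {lam κ : ℝ} {u : Euc N → ℝ}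

/-- The local `L^{2*}` bound of `u - 1` by its value at the center of the ball. -/
lemma exists_critical_le (hu : IsContinuousMinimizer Ω lam κ u) :
    ∃ C > 0, ∃ r₁ > 0, ∀ (a : Euc N) (r : ℝ), 0 < r → r ≤ r₁ →
      Metric.closedBall a (2 * r) ⊆ superOne Ω u →
      (∫ x in Metric.closedBall a (r / 2), (u x - 1) ^ twoStar N) ^ (2 / twoStar N)
        ≤ C * ((u a - 1) / r) ^ 2 * r ^ N := by
  have hp2 := two_lt_twoStar hu.three_le
  obtain ⟨C, hC, r₁, hr₁, hloc⟩ := hu.exists_local_bound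
  set β := volume.real (Metric.ball (0 : Euc N) 1) with hb
  have hb0 : 0 < β := volume_real_ball_one_pos
  refine ⟨C ^ (((N : ℝ) + 2) / 2) * (2 * β * 2 ^ N) ^ 2, by positivity, r₁, hr₁,
    fun a r hr hrr hball => ?_⟩
  have hballr : Metric.closedBall a r ⊆ superOne Ω u :=
    (Metric.closedBall_subset_closedBall (by linarith)).trans hball
  have hsub : Metric.closedBall a (r / 2) ⊆ Metric.closedBall a r :=
    Metric.closedBall_subset_closedBall (by linarith)
  have hBm : ∀ s, MeasurableSet (Metric.closedBall a s) := fun s =>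
    Metric.isClosed_closedBall.measurableSet
  have hpos : ∀ x ∈ Metric.closedBall a r, 0 < u x - 1 := fun x hx => sub_one_pos (hballr hx)
  have hG0 : 0 ≤ ∫ x in Metric.closedBall a r, (u x - 1) :=
    setIntegral_nonneg (hBm r) fun x hx => (hpos x hx).le
  -- The mean value inequality controls the ball of half the radius, whence the hypothesis on the
  -- ball of radius 2r.
  have hG : ∫ x in Metric.closedBall a r, (u x - 1) ≤ 2 * β * (2 * r) ^ N * (u a - 1) := by
    have := hu.setIntegral_closedBall_le (by positivity : 0 < 2 * r) hball
    rwa [mul_div_cancel_left₀ r two_ne_zero] at this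
  have hle : ∫ x in Metric.closedBall a (r / 2), (u x - 1) ^ twoStar N
      ≤ ∫ x in Metric.closedBall a r, (cut a r x ^ (N + 2) * (u x - 1)) ^ twoStar N := by
    have hcc : ContinuousOn (fun x => (cut a r x ^ (N + 2) * (u x - 1)) ^ twoStar N)
        (Metric.closedBall a r) :=
      ((((isTestFunction_cut hr hballr).continuous.pow _).continuousOn.mul
        ((hu.continuousOn.mono (hballr.trans superOne_subset)).sub
          continuousOn_const)).rpow_const fun x _ => Or.inr (by linarith))
    have e : ∫ x in Metric.closedBall a (r / 2), (u x - 1) ^ twoStar N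
        = ∫ x in Metric.closedBall a (r / 2), (cut a r x ^ (N + 2) * (u x - 1)) ^ twoStar N :=
      setIntegral_congr_fun (hBm _) fun x hx => by
        rw [cut_eq_one hr (by simpa [dist_eq_norm] using hx), one_pow, one_mul]
    rw [e]
    refine setIntegral_mono_set (hcc.integrableOn_compact (isCompact_closedBall a r)) ?_
      (ae_of_all _ hsub)
    filter_upwards [ae_restrict_mem (hBm r)] with x hx
    exact Real.rpow_nonneg (mul_nonneg (pow_nonneg cut_nonneg _) (hpos x hx).le) _
  have h0 : 0 ≤ ∫ x in Metric.closedBall a (r / 2), (u x - 1) ^ twoStar N :=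
    setIntegral_nonneg (hBm _) fun x hx => Real.rpow_nonneg (hpos x (hsub hx)).le _
  -- Powers of r: the factor r^{-(N+2)} times the square of r^N (u(a) - 1) gives ((u(a) - 1)/r)²
  -- r^N.
  have hrpow : (r ^ 2) ^ (((N : ℝ) + 2) / 2) = r ^ (N + 2) := by
    rw [← Real.rpow_natCast r 2, ← Real.rpow_mul hr.le, ← Real.rpow_natCast r (N + 2)]
    congr 1
    push_cast
    ring
  calc (∫ x in Metric.closedBall a (r / 2), (u x - 1) ^ twoStar N) ^ (2 / twoStar N)
      ≤ _ := Real.rpow_le_rpow h0 hle (div_nonneg two_pos.le (by linarith))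
    _ ≤ _ := hloc a r hr hrr hballr
    _ ≤ (C / r ^ 2) ^ (((N : ℝ) + 2) / 2) * (2 * β * (2 * r) ^ N * (u a - 1)) ^ 2 := by gcongr
    _ = _ := by
      rw [Real.div_rpow hC.le (by positivity), hrpow]
      field_simp
      ring

/-- Hölder's inequality for the error term created by a cut-off function. -/
lemma exists_integral_gradient_cut_le (hu : IsContinuousMinimizer Ω lam κ u) :
    ∃ C > 0, ∀ (a : Euc N) (ρ : ℝ), 0 < ρ → Metric.closedBall a ρ ⊆ superOne Ω u →
      ∫ x in superOne Ω u, (u x - 1) ^ 2 * ‖gradient (cut a ρ) x‖ ^ 2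
        ≤ C * (∫ x in Metric.closedBall a ρ, (u x - 1) ^ twoStar N) ^ (2 / twoStar N) := by
  have hN' : (3 : ℝ) ≤ N := by exact_mod_cast hu.three_le
  have hp2 := two_lt_twoStar hu.three_le
  obtain ⟨C, hC, hgrad⟩ := exists_norm_gradient_cut_le
  set β := volume.real (Metric.ball (0 : Euc N) 1) with hb
  have hb0 : 0 < β := volume_real_ball_one_pos
  refine ⟨C ^ 2 * β ^ (2 / (N : ℝ)), by positivity, fun a ρ hρ hball => ?_⟩
  set p := twoStar N with hp
  set B := Metric.closedBall a ρ with hB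
  have hBm : MeasurableSet B := Metric.isClosed_closedBall.measurableSet
  have hpos : ∀ x ∈ B, 0 < u x - 1 := fun x hx => sub_one_pos (hball hx)
  have hv2 : IntegrableOn (fun x => (u x - 1) ^ 2) B :=
    hu.memLp_sub_one.integrable_sq.mono_measure (Measure.restrict_mono hball le_rfl)
  -- The volume of the ball to this power is a multiple of ρ², which compensates the factor ρ^{-2}
  -- from the squared gradient of the cutoff.
  have hexp : 1 - 2 / p = 2 / (N : ℝ) := by
    have := half_sub_inv_twoStar hu.three_le
    rw [← hp] at this
    linear_combination 2 * this
  have hvol : volume.real B = ρ ^ N * β := by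
    rw [hB, Measure.addHaar_real_closedBall _ _ hρ.le, finrank_euclideanSpace_fin]
  have hρN : (ρ ^ N) ^ (2 / (N : ℝ)) = ρ ^ 2 := by
    rw [← Real.rpow_natCast ρ N, ← Real.rpow_mul hρ.le, mul_div_cancel₀ _ (by linarith),
      Real.rpow_two]
  have hholder : ∫ x in B, (u x - 1) ^ 2
      ≤ (∫ x in B, (u x - 1) ^ p) ^ (2 / p) * (ρ ^ 2 * β ^ (2 / (N : ℝ))) := by
    have hf0 : 0 ≤ᵐ[volume.restrict B] fun x => (u x - 1) ^ p := by
      filter_upwards [ae_restrict_mem hBm] with x hx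
      exact Real.rpow_nonneg (hpos x hx).le _
    have h := integral_rpow_mul_rpow_le hf0 (ae_of_all _ fun _ => zero_le_one)
      (hu.integrable_rpow.mono_set hball)
      (integrableOn_const (C := (1 : ℝ)) (isCompact_closedBall a ρ).measure_lt_top.ne)
      (div_pos two_pos (by linarith) : 0 < 2 / p).le
      (by positivity : 0 < 2 / (N : ℝ)).le (by rw [← hexp]; ring)
    rw [setIntegral_const, smul_eq_mul, mul_one, hvol,
      Real.mul_rpow (by positivity) hb0.le, hρN] at h
    refine le_trans (le_of_eq (setIntegral_congr_fun hBm fun x hx => ?_)) h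
    rw [Real.one_rpow, mul_one, ← Real.rpow_mul (hpos x hx).le,
      mul_div_cancel₀ _ (by linarith), Real.rpow_two]
  have hSB : ∫ x in superOne Ω u, (u x - 1) ^ 2 * ‖gradient (cut a ρ) x‖ ^ 2
      = ∫ x in B, (u x - 1) ^ 2 * ‖gradient (cut a ρ) x‖ ^ 2 :=
    setIntegral_eq_of_subset_of_forall_sdiff_eq_zero hu.measurableSet_superOne hball
      fun x hx => by
        rw [gradient_eq_zero_of_notMem_tsupport fun h => hx.2 (tsupport_cut_subset hρ h)]
        simp
  rw [hSB]
  calc ∫ x in B, (u x - 1) ^ 2 * ‖gradient (cut a ρ) x‖ ^ 2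
      ≤ ∫ x in B, (u x - 1) ^ 2 * (C / ρ) ^ 2 := by
        refine integral_mono_of_nonneg (ae_of_all _ fun x => by positivity)
          (hv2.mul_const _) (ae_of_all _ fun x => ?_)
        exact mul_le_mul_of_nonneg_left (pow_le_pow_left₀ (norm_nonneg _) (hgrad a hρ x) 2)
          (sq_nonneg _)
    _ = (C / ρ) ^ 2 * ∫ x in B, (u x - 1) ^ 2 := by rw [integral_mul_const, mul_comm]
    _ ≤ (C / ρ) ^ 2 * ((∫ x in B, (u x - 1) ^ p) ^ (2 / p) * (ρ ^ 2 * β ^ (2 / (N : ℝ)))) := by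
        gcongr
    _ = _ := by field_simp

/-- A continuous minimizer grows linearly away from the boundary of `{u > 1}`: in the center of a
small ball contained in `{u > 1}`, the quotient of `u - 1` by the radius is bounded below. -/
lemma exists_linear_growth (hu : IsContinuousMinimizer Ω lam κ u) :
    ∃ c > 0, ∃ r₁ > 0, ∀ (a : Euc N) (r : ℝ), 0 < r → r ≤ r₁ →
      Metric.closedBall a (2 * r) ⊆ superOne Ω u → c * r ≤ u a - 1 := by
  have hN' : (3 : ℝ) ≤ N := by exact_mod_cast hu.three_le
  have hp2 := two_lt_twoStar hu.three_le
  have hκ := hu.kappa_pos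
  obtain ⟨C, hC, r₁, hr₁, hcrit⟩ := hu.exists_critical_le
  obtain ⟨C', hC', hgrad⟩ := hu.exists_integral_gradient_cut_le
  obtain ⟨η, hη, hηA, L, hL, hred⟩ := exists_reduced_energy_le hu.mem.2.2 (((N : ℝ) - 2) / 2)
  set β := volume.real (Metric.ball (0 : Euc N) 1) with hb
  have hb0 : 0 < β := volume_real_ball_one_pos
  set K := κ + C' with hK
  have hK0 : 0 < K := by positivity
  -- The three bounds serve in turn to get m r^N ≤ 1, to stay in the range of
  -- `exists_reduced_energy_le`, and to contradict the volume estimate; the 2 in the last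
  -- denominator leaves room for a strict inequality. The growth constant √(m / C) turns smallness
  -- of (u(a) - 1)/r into C ((u(a) - 1)/r)² ≤ m.
  set m := min 1 (min (η / K) (β * N / (2 * 4 ^ N * L * K))) with hm
  have hm0 : 0 < m := by
    have : (0 : ℝ) < N := by linarith
    refine lt_min one_pos (lt_min (by positivity) (by positivity))
  have hm1 : m ≤ 1 := min_le_left _ _
  have hmη : K * m ≤ η := by
    have : m ≤ η / K := (min_le_right _ _).trans (min_le_left _ _)
    rw [le_div_iff₀ hK0] at this
    linarith
  have hmβ : m * (2 * 4 ^ N * L * K) ≤ β * N := by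
    have : m ≤ β * N / (2 * 4 ^ N * L * K) := (min_le_right _ _).trans (min_le_right _ _)
    rwa [le_div_iff₀ (by positivity)] at this
  refine ⟨√(m / C), Real.sqrt_pos.2 (by positivity), min r₁ 1, lt_min hr₁ one_pos,
    fun a r hr hrr hball => ?_⟩
  by_contra! hlt
  have hball2 : Metric.closedBall a (r / 2) ⊆ superOne Ω u :=
    (Metric.closedBall_subset_closedBall (by linarith)).trans hball
  have ha : 0 < u a - 1 :=
    sub_one_pos (hball (Metric.mem_closedBall_self (by positivity)))
  have hr1 : r ^ N ≤ 1 := pow_le_one₀ hr.le (hrr.trans (min_le_right _ _))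
  have hr0 : 0 < r ^ N := by positivity
  set P := ∫ x in Metric.closedBall a (r / 2), (u x - 1) ^ twoStar N with hP
  have hP0 : 0 ≤ P := setIntegral_nonneg Metric.isClosed_closedBall.measurableSet
    fun x hx => Real.rpow_nonneg (sub_one_pos (hball2 hx)).le _
  have hsq : C * ((u a - 1) / r) ^ 2 ≤ m := by
    have h1 : (u a - 1) / r ≤ √(m / C) := (div_le_iff₀ hr).2 hlt.le
    have h2 := pow_le_pow_left₀ (by positivity) h1 2
    rw [Real.sq_sqrt (by positivity), le_div_iff₀ hC] at h2
    linarith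
  have hY : P ^ (2 / twoStar N) ≤ m * r ^ N :=
    (hcrit a r hr (hrr.trans (min_le_left _ _)) hball).trans
      (mul_le_mul_of_nonneg_right hsq hr0.le)
  have hY1 : m * r ^ N ≤ 1 := mul_le_one₀ hm1 hr0.le hr1
  -- The critical energy enters the comparison linearly but is controlled through its power 2/2* <
  -- 1; for P ≤ 1 the power is the larger of the two.
  have hPle : P ≤ P ^ (2 / twoStar N) := by
    have hP1 : P ≤ 1 := by
      by_contra! h
      have := Real.one_lt_rpow h (div_pos two_pos (by linarith) : 0 < 2 / twoStar N)
      linarith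
    rcases hP0.eq_or_lt with h | h
    · rw [← h]
      exact Real.rpow_nonneg le_rfl _
    · have := Real.rpow_le_rpow_of_exponent_ge h hP1
        ((div_le_one (by linarith : 0 < twoStar N)).2 hp2.le)
      rwa [Real.rpow_one] at this
  have hyη : K * (m * r ^ N) ≤ η := by
    refine le_trans ?_ hmη
    exact mul_le_mul_of_nonneg_left (mul_le_of_le_one_right hm0.le hr1) hK0.le
  have hvol := hu.volume_closedBall_le (half_pos hr) hball2 rfl (y := K * (m * r ^ N))
    (by
      rw [hK, add_mul]
      have := mul_le_mul_of_nonneg_left (hPle.trans hY) hκ.le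
      have : 0 ≤ C' * (m * r ^ N) := by positivity
      linarith)
    (by
      rw [hK, add_mul]
      have h1 := hgrad a (r / 2) (half_pos hr) hball2
      have := mul_le_mul_of_nonneg_left hY hC'.le
      have : 0 ≤ κ * (m * r ^ N) := by positivity
      linarith)
    (hyη.trans_lt hηA)
  rw [Measure.addHaar_real_closedBall _ _ (by positivity), finrank_euclideanSpace_fin,
    ← hb, le_div_iff₀ (by linarith)] at hvol
  have hle := hred _ (by positivity) hyη
  have h1 : (r / 2 / 2) ^ N * β * N ≤ L * (K * (m * r ^ N)) := by linarith
  have h2 : (r / 2 / 2) ^ N = r ^ N / 4 ^ N := by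
    rw [div_div, div_pow]
    norm_num
  rw [h2, div_mul_eq_mul_div, div_mul_eq_mul_div, div_le_iff₀ (by positivity)] at h1
  -- With `h1` this gives 2 r^N β N ≤ r^N β N, which is absurd.
  have h3 := mul_le_mul_of_nonneg_left hmβ hr0.le
  have h4 : 0 < r ^ N * (β * N) := by
    have : (0 : ℝ) < N := by linarith
    positivity
  nlinarith

lemma nondegenerate (hu : IsContinuousMinimizer Ω lam κ u) : Nondegenerate Ω u := by
  obtain ⟨c, hc, r₁, hr₁, hgrow⟩ := hu.exists_linear_growth
  refine ⟨4 * r₁, by positivity, c / 4, by positivity, fun x₀ hx₀ hd => ?_⟩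
  set d := Metric.infDist x₀ (subOne Ω u)
  -- The case d = 0 includes an empty {u ≤ 1}, for which `Metric.infDist` is zero by convention;
  -- then u(x₀) > 1 is enough.
  rcases (show 0 ≤ d from Metric.infDist_nonneg).eq_or_lt with h | h
  · rw [← h, mul_zero, add_zero]
    exact hx₀.2.le
  -- With radius d/4 the doubled closed ball has radius d/2 and fits into the open ball of radius d;
  -- this accounts for the factors 4 in both constants.
  · have := hgrow x₀ (d / 4) (by positivity) (by linarith)
      ((Metric.closedBall_subset_ball (by linarith)).trans
        (ball_infDist_subset_superOne hu.domain hu.mem.1 hx₀))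
    linarith

end IsContinuousMinimizer

end CriticalFreeBoundary

theorem theorem1p1 {N : ℕ} (hN : 3 ≤ N) {Ω : Set (CriticalFreeBoundary.Euc N)}
    (hΩ : CriticalFreeBoundary.IsBoundedC2Domain Ω)
    {lam κ : ℝ} (hlam : 0 < lam) (hκ : 0 < κ)
    (u : CriticalFreeBoundary.Euc N → ℝ)
    (hu : LocallyLipschitzOn Ω u)
    (hmem : u ∈ CriticalFreeBoundary.nehari Ω lam κ)
    (hmin : IsMinOn (CriticalFreeBoundary.J Ω lam κ) (CriticalFreeBoundary.nehari Ω lam κ) u) :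
    CriticalFreeBoundary.Nondegenerate Ω u :=
  CriticalFreeBoundary.IsContinuousMinimizer.nondegenerate
    ⟨hN, hΩ, hlam, hκ, hu.continuousOn, hmem, hmin⟩
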